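/- Let $K$ be a field and let $A$ be the graded $K$-algebra $\Pi Q/I^3$, where $Q$ is the quiver with two vertices $a,b$, an arrow $u\colon a\to b$ of degree $1$ and an arrow $v\colon b\to a$ of degree $0$, $\Pi Q$ is its path algebra, and $I$ is the ideal generated by the paths of positive length. Explicitly, $A$ has basis $e_0,v,f_0$ in degree $0$ and $u,\,e_1=vu,\,f_1=uv$ in degree $1$, where $e_0,f_0$ are the trivial paths at $a,b$ and $e_0+f_0=1$. For integers $r\ge 0$ and $s$ let $CC^{r+s}(A,A)^s$ be the space of degree-preserving linear maps $A^{\otimes r}\to A[s]$ that vanish on monomials one of whose factors is $1$, with the differential $$(\delta f)(a_0,\dots,a_r)=(-1)^{s|a_0|}a_0f(a_1,\dots,a_r)+\sum_{i=0}^{r-1}(-1)^{i+1}f(a_0,\dots,a_ia_{i+1},\dots,a_r)+(-1)^{r+1}f(a_0,\dots,a_{r-1})a_r ,$$ and let $HH^{r+s}(A,A)^s$ be its cohomology at $CC^{r+s}(A,A)^s$. Here $A[s]^i=A^{i+s}$, and $A[s]$ is the graded bimodule with left action $a\cdot x=(-1)^{s|a|}ax$ and the usual right action. (0) $HH^{r+s}(A,A)^s\cong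 \mathrm{Ext}^r_{(A,A)}(A,A[s])$ for all $r\ge 0$, $s\in\mathbb Z$, where $\mathrm{Ext}^r_{(A,A)}(A,B)$ is the $r$-th cohomology of the complex of degree-preserving bimodule homomorphisms $P_*\to B$ for any resolution $P_*$ of $A$ by projective graded $(A,A)$-bimodules (and such a resolution exists). (a) For all $r>0$ and $s\in\mathbb Z$ one has $HH^{r+s+2}(A,A)^{s-6}\cong HH^{r+s}(A,A)^s$ (that is, $r$ increases by $8$). If $\mathrm{char}\,K=2$, then also $HH^{r+s+1}(A,A)^{s-3}\cong HH^{r+s}(A,A)^s$ for all $r>0$ and $s\in\mathbb Z$ (that is, $r$ increases by $4$). (b) For $0\le r\le 8$ and $s\in\mathbb Z$, the space $HH^{r+s}(A,A)^s$ is zero except in the following cases: - $(r,s)=(0,1)$: it is isomorphic to $K^2$; - $(r,s)\in\{(0,0),(1,0),(6,-4),(7,-4),(8,-6)\}$: it is isomorphic to $K$; - $(r,s)\in\{(2,-1),(3,-1),(4,-3),(5,-3)\}$: it is isomorphic to $K/(2)$; - $(r,s)\in\{(3,-2),(4,-2)\}$: it is isomorphic to $K/(3)$. Here $K/(n)=K/nK$,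 which is $K$ if $\mathrm{char}\,K$ divides $n$ and $0$ otherwise. In particular $HH^2(A,A)^{-4}\cong K$ and $HH^2(A,A)^{-6}\cong K$. -/

import Mathlib

universe u

namespace TwoCycle

/-! ### The two-cycle quiver and its path algebra -/

/-- The two vertices of the quiver. -/
inductive Vertex : Type
  | a | b
  deriving DecidableEq

/-- The two arrows `u : a ⟶ b` and `v : b ⟶ a`. -/
inductive Arrow : Vertex → Vertex → Type
  | u : Arrow Vertex.a Vertex.b
  | v : Arrow Vertex.b Vertex.a

instance : Quiver Vertex := ⟨Arrow⟩

/-- Degree of an arrow: `u` has degree `1`, `v` has degree `0`. -/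
def Arrow.deg : {x y : Vertex} → Arrow x y → ℤ
  | _, _, Arrow.u => 1
  | _, _, Arrow.v => 0

/-- The degree of a path is the sum of the degrees of its arrows. -/
def pathDeg {x : Vertex} : {y : Vertex} → Quiver.Path x y → ℤ
  | _, Quiver.Path.nil => 0
  | _, Quiver.Path.cons p e => pathDeg p + Arrow.deg e

/-- A path of the quiver, together with its source and its target. -/
abbrev QPath : Type := Σ x y : Vertex, Quiver.Path x y

/-- The product `p q` of two paths is "first `q`, then `p`" (composition order), where that is
composable. -/
def QPath.mul (p q : QPath) : Option QPath :=
  if h : q.2.1 = p.1 then some ⟨q.1, p.2.1, (q.2.2.cast rfl h).comp p.2.2⟩ else none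

/-- The underlying vector space of the path algebra: it has the paths as a basis. -/
def PathAlgebra (K : Type u) [Field K] : Type u := QPath →₀ K

section PathAlgebra

variable (K : Type u) [Field K]

noncomputable instance : AddCommGroup (PathAlgebra K) := inferInstanceAs (AddCommGroup (QPath →₀ K))
noncomputable instance : Module K (PathAlgebra K) := inferInstanceAs (Module K (QPath →₀ K))

/-- The basis of the path algebra that consists of the paths. -/
noncomputable def pathBasis : Module.Basis QPath K (PathAlgebra K) :=
  Module.Basis.ofRepr (LinearEquiv.refl K (QPath →₀ K))

/-- The basis element of the path algebra given by a path. -/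
noncomputable def ofPath (p : QPath) : PathAlgebra K := pathBasis K p

/-- The basis element of a path, or `0` in the non-composable case. -/
noncomputable def ofPath? : Option QPath → PathAlgebra K
  | some p => ofPath K p
  | none => 0

/-- The bilinear extension of the product of paths. -/
noncomputable def pathMul : PathAlgebra K →ₗ[K] PathAlgebra K →ₗ[K] PathAlgebra K :=
  (pathBasis K).constr K fun p => (pathBasis K).constr K fun q => ofPath? K (p.mul q)

noncomputable instance : Mul (PathAlgebra K) := ⟨fun x y => pathMul K x y⟩

/-- The unit is the sum of the two trivial paths. -/
noncomputable instance : One (PathAlgebra K) :=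
  ⟨ofPath K ⟨.a, .a, .nil⟩ + ofPath K ⟨.b, .b, .nil⟩⟩

theorem mul_def' (x y : PathAlgebra K) : x * y = pathMul K x y := rfl

theorem pathMul_ofPath (p q : QPath) :
    pathMul K (ofPath K p) (ofPath K q) = ofPath? K (p.mul q) := by
  simp only [pathMul, ofPath, Module.Basis.constr_basis]

theorem ofPath_mul_assoc (p q r : QPath) :
    pathMul K (ofPath? K (p.mul q)) (ofPath K r) = pathMul K (ofPath K p) (ofPath? K (q.mul r)) := by
  obtain ⟨x, y, p⟩ := p
  obtain ⟨x', y', q⟩ := q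
  obtain ⟨x'', y'', r⟩ := r
  by_cases h₁ : y' = x
  · subst h₁
    by_cases h₂ : y'' = x'
    · subst h₂
      simp [QPath.mul, ofPath?, pathMul_ofPath]
    · simp [QPath.mul, ofPath?, pathMul_ofPath, h₂]
  · by_cases h₂ : y'' = x'
    · subst h₂
      simp [QPath.mul, ofPath?, pathMul_ofPath, h₁]
    · simp [QPath.mul, ofPath?, h₁, h₂]

theorem pathAlgebra_induction {P : PathAlgebra K → Prop} (h0 : P 0)
    (hadd : ∀ y z, P y → P z → P (y + z)) (hsm : ∀ (c : K) y, P y → P (c • y)) (hs : ∀ p, P (ofPath K p))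
    (x : PathAlgebra K) : P x := by
  have hx : x ∈ Submodule.span K (Set.range (pathBasis K)) := by
    rw [(pathBasis K).span_eq]; trivial
  induction hx using Submodule.span_induction with
  | mem x h =>
    obtain ⟨p, rfl⟩ := h
    exact hs p
  | zero => exact h0
  | add y z _ _ hy hz => exact hadd y z hy hz
  | smul c y _ hy => exact hsm c y hy

theorem one_pathMul (x : PathAlgebra K) : pathMul K 1 x = x := by
  induction x using pathAlgebra_induction with
  | h0 => simp
  | hadd y z hy hz => simp only [map_add, hy, hz]
  | hsm c y hy => simp only [map_smul, hy]
  | hs p =>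
    obtain ⟨x, y, p⟩ := p
    change pathMul K (ofPath K _ + ofPath K _) _ = _
    cases y <;> simp [pathMul_ofPath, QPath.mul, ofPath?]

theorem pathMul_one (x : PathAlgebra K) : pathMul K x 1 = x := by
  induction x using pathAlgebra_induction with
  | h0 => simp
  | hadd y z hy hz => simp only [map_add, LinearMap.add_apply, hy, hz]
  | hsm c y hy => simp only [map_smul, LinearMap.smul_apply, hy]
  | hs p =>
    obtain ⟨x, y, p⟩ := p
    change pathMul K _ (ofPath K _ + ofPath K _) = _
    cases x <;> simp [pathMul_ofPath, QPath.mul, ofPath?]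

theorem pathMul_assoc (x y z : PathAlgebra K) :
    pathMul K (pathMul K x y) z = pathMul K x (pathMul K y z) := by
  induction x using pathAlgebra_induction with
  | h0 => simp
  | hadd _ _ h₁ h₂ => simp only [map_add, LinearMap.add_apply, h₁, h₂]
  | hsm c y hy => simp only [map_smul, LinearMap.smul_apply, hy]
  | hs p =>
  induction y using pathAlgebra_induction with
  | h0 => simp
  | hadd _ _ h₁ h₂ => simp only [map_add, LinearMap.add_apply, h₁, h₂]
  | hsm c y hy => simp only [map_smul, LinearMap.smul_apply, hy]
  | hs q =>
  induction z using pathAlgebra_induction with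
  | h0 => simp
  | hadd _ _ h₁ h₂ => simp only [map_add, h₁, h₂]
  | hsm c y hy => simp only [map_smul, hy]
  | hs r =>
  simp only [pathMul_ofPath, ofPath_mul_assoc]

noncomputable instance : Ring (PathAlgebra K) :=
  { (inferInstance : AddCommGroup (PathAlgebra K)),
    (inferInstance : Mul (PathAlgebra K)),
    (inferInstance : One (PathAlgebra K)) with
    left_distrib := fun x y z => by simp [mul_def']
    right_distrib := fun x y z => by simp [mul_def']
    zero_mul := fun x => by simp [mul_def']
    mul_zero := fun x => by simp [mul_def']
    mul_assoc := pathMul_assoc K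
    one_mul := one_pathMul K
    mul_one := pathMul_one K }

noncomputable instance : Algebra K (PathAlgebra K) :=
  Algebra.ofModule (fun c x y => by simp [mul_def']) (fun c x y => by simp [mul_def'])

/-- The arrow ideal: the span of all paths of positive length. -/
noncomputable def arrowIdeal : Submodule K (PathAlgebra K) :=
  Submodule.span K (ofPath K '' {p | 0 < p.2.2.length})

end PathAlgebra

/-! ### The graded algebra `A` -/

/-- The six basis elements of `A`: the identities `e0` of `a` and `f0` of `b`, the arrows
`u : a ⟶ b` and `v : b ⟶ a`, and the loops `e1 = v u` at `a` and `f1 = u v` at `b`. -/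
inductive Gen : Type
  | e0 | f0 | u | v | e1 | f1
  deriving DecidableEq

instance : Fintype Gen :=
  ⟨{.e0, .f0, .u, .v, .e1, .f1}, fun g => by cases g <;> simp⟩

/-- The degrees of the basis elements. -/
def Gen.deg : Gen → ℤ
  | .e0 => 0
  | .f0 => 0
  | .u => 1
  | .v => 0
  | .e1 => 1
  | .f1 => 1

/-- The underlying vector space of `A`: an element is given by its six coordinates. -/
structure A (K : Type u) [Field K] : Type u where
  coeff : Gen → K

section AlgebraA

variable (K : Type u) [Field K]

instance : CoeFun (A K) fun _ => Gen → K := ⟨A.coeff⟩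

/-- An element of `A` is the same as the family of its coordinates. -/
def A.equiv : A K ≃ (Gen → K) := ⟨A.coeff, A.mk, fun _ => rfl, fun _ => rfl⟩

instance : AddCommGroup (A K) := (A.equiv K).addCommGroup
instance : Module K (A K) := (A.equiv K).module K

variable {K}

/-- The product of `A`: `e0` and `f0` are orthogonal idempotents with `e0 + f0 = 1`,
`u = f0 u e0`, `v = e0 v f0`, `v u = e1`, `u v = f1`, and all products of three of the elements
`u`, `v` vanish. -/
def mulA (x y : A K) : Gen → K
  | .e0 => x .e0 * y .e0
  | .f0 => x .f0 * y .f0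
  | .u => x .f0 * y .u + x .u * y .e0
  | .v => x .e0 * y .v + x .v * y .f0
  | .e1 => x .e0 * y .e1 + x .v * y .u + x .e1 * y .e0
  | .f1 => x .f0 * y .f1 + x .u * y .v + x .f1 * y .f0

/-- The unit `e0 + f0`. -/
def oneA : Gen → K
  | .e0 => 1
  | .f0 => 1
  | _ => 0

instance : Mul (A K) := ⟨fun x y => ⟨mulA x y⟩⟩
instance : One (A K) := ⟨⟨oneA⟩⟩

@[ext]
theorem A.ext {x y : A K} (h : ∀ g, x g = y g) : x = y := by
  cases x; cases y; congr 1; exact funext h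

theorem A.mul_def (x y : A K) : x * y = ⟨mulA x y⟩ := rfl
theorem A.one_def : (1 : A K) = ⟨oneA⟩ := rfl
@[simp] theorem A.add_apply (x y : A K) (g : Gen) : (x + y) g = x g + y g := rfl
@[simp] theorem A.sub_apply (x y : A K) (g : Gen) : (x - y) g = x g - y g := rfl
@[simp] theorem A.neg_apply (x : A K) (g : Gen) : (-x) g = -x g := rfl
@[simp] theorem A.zero_apply (g : Gen) : (0 : A K) g = 0 := rfl
@[simp] theorem A.smul_apply (c : K) (x : A K) (g : Gen) : (c • x) g = c * x g := rfl

instance : Ring (A K) :=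
  { (inferInstance : AddCommGroup (A K)),
    (inferInstance : Mul (A K)),
    (inferInstance : One (A K)) with
    left_distrib := fun x y z => by
      ext g; cases g <;> simp only [A.mul_def, mulA, A.add_apply] <;> ring
    right_distrib := fun x y z => by
      ext g; cases g <;> simp only [A.mul_def, mulA, A.add_apply] <;> ring
    zero_mul := fun x => by ext g; cases g <;> simp [A.mul_def, mulA]
    mul_zero := fun x => by ext g; cases g <;> simp [A.mul_def, mulA]
    mul_assoc := fun x y z => by
      ext g; cases g <;> simp only [A.mul_def, mulA] <;> ring
    one_mul := fun x => by ext g; cases g <;> simp [A.mul_def, A.one_def, mulA, oneA]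
    mul_one := fun x => by ext g; cases g <;> simp [A.mul_def, A.one_def, mulA, oneA] }

instance : Algebra K (A K) :=
  Algebra.ofModule
    (fun c x y => by ext g; cases g <;> simp only [A.mul_def, mulA, A.smul_apply] <;> ring)
    (fun c x y => by ext g; cases g <;> simp only [A.mul_def, mulA, A.smul_apply] <;> ring)

/-- A basis element, as an element of `A`. -/
def gen (g : Gen) : A K := ⟨fun h => if h = g then 1 else 0⟩

variable (K)

/-- The subspace of the elements of `A` that are homogeneous of degree `i`. -/
def piece (i : ℤ) : Submodule K (A K) where
  carrier := {x | ∀ g, g.deg ≠ i → x g = 0}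
  add_mem' hx hy g hg := by simp [hx g hg, hy g hg]
  zero_mem' _ _ := rfl
  smul_mem' c x hx g hg := by simp [hx g hg]

theorem mul_mem_piece {i j : ℤ} {x y : A K} (hx : x ∈ piece K i) (hy : y ∈ piece K j) :
    x * y ∈ piece K (i + j) := by
  intro g hg
  have key : ∀ a b : Gen, a.deg + b.deg = g.deg → x a * y b = 0 := by
    intro a b hab
    by_cases ha : a.deg = i
    · by_cases hb : b.deg = j
      · exact absurd (by rw [← hab, ha, hb]) hg
      · rw [hy b hb, mul_zero]
    · rw [hx a ha, zero_mul]
  cases g <;> simp only [A.mul_def, mulA]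
  · exact key .e0 .e0 rfl
  · exact key .f0 .f0 rfl
  · rw [key .f0 .u rfl, key .u .e0 rfl, add_zero]
  · rw [key .e0 .v rfl, key .v .f0 rfl, add_zero]
  · rw [key .e0 .e1 rfl, key .v .u rfl, key .e1 .e0 rfl, add_zero, add_zero]
  · rw [key .f0 .f1 rfl, key .u .v rfl, key .f1 .f0 rfl, add_zero, add_zero]

theorem gen_mem_piece (g : Gen) : (gen g : A K) ∈ piece K g.deg := by
  intro h hh
  have : h ≠ g := by rintro rfl; exact hh rfl
  simp [gen, this]

theorem sum_gen (x : A K) : x = ∑ g, x g • gen g := by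
  ext h
  have : (∑ g, x g • gen g : A K) h = ∑ g, x g * gen g h := by
    let φ : A K →+ K := ⟨⟨fun y => y h, rfl⟩, fun _ _ => rfl⟩
    exact map_sum φ (fun g => x g • gen g) Finset.univ
  rw [this, Finset.sum_eq_single h]
  · simp [gen]
  · intro g _ hg
    simp [gen, hg.symm]
  · simp

/-- `A` is the direct sum of its homogeneous pieces. -/
theorem piece_isInternal : DirectSum.IsInternal (piece K) := by
  rw [DirectSum.isInternal_submodule_iff_iSupIndep_and_iSup_eq_top]
  constructor
  · intro i
    rw [Submodule.disjoint_def]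
    intro x hx hx'
    let C : Submodule K (A K) :=
      { carrier := {x | ∀ g, g.deg = i → x g = 0}
        add_mem' := fun hx hy g hg => by simp [hx g hg, hy g hg]
        zero_mem' := fun _ _ => rfl
        smul_mem' := fun c x hx g hg => by simp [hx g hg] }
    have hC : ⨆ j, ⨆ (_ : j ≠ i), piece K j ≤ C :=
      iSup₂_le fun j hj y hy g hg => hy g (by rw [hg]; exact hj.symm)
    ext g
    by_cases hg : g.deg = i
    · exact hC hx' g hg
    · exact hx g hg
  · rw [eq_top_iff]
    intro x _
    rw [sum_gen K x]
    exact sum_mem fun g _ => Submodule.smul_mem _ _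
      (Submodule.mem_iSup_of_mem g.deg (gen_mem_piece K g))

end AlgebraA

/-! ### `A` is the path algebra modulo the cube of the arrow ideal -/

section Presentation

variable (K : Type u) [Field K]

/-- The image of a path in `A`. -/
def pathImage : QPath → A K
  | ⟨.a, _, p⟩ => match p.length with
    | 0 => gen .e0
    | 1 => gen .u
    | 2 => gen .e1
    | _ => 0
  | ⟨.b, _, p⟩ => match p.length with
    | 0 => gen .f0
    | 1 => gen .v
    | 2 => gen .f1
    | _ => 0

/-- The six paths of length at most two. -/
def shortPath : Gen → QPath
  | .e0 => ⟨.a, .a, .nil⟩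
  | .f0 => ⟨.b, .b, .nil⟩
  | .u => ⟨.a, .b, .cons .nil Arrow.u⟩
  | .v => ⟨.b, .a, .cons .nil Arrow.v⟩
  | .e1 => ⟨.a, .a, .cons (.cons .nil Arrow.u) Arrow.v⟩
  | .f1 => ⟨.b, .b, .cons (.cons .nil Arrow.v) Arrow.u⟩

theorem pathImage_shortPath (g : Gen) : pathImage K (shortPath g) = gen g := by
  cases g <;> rfl

theorem pathImage_long {p : QPath} (h : 3 ≤ p.2.2.length) : pathImage K p = 0 := by
  obtain ⟨x, y, p⟩ := p
  obtain ⟨n, hn⟩ := Nat.exists_eq_add_of_le' h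
  simp only at hn
  cases x <;> simp [pathImage, hn]

theorem short_or_long (p : QPath) : (∃ g, p = shortPath g) ∨ 3 ≤ p.2.2.length := by
  obtain ⟨x, y, p⟩ := p
  rcases p with _ | ⟨p, e⟩
  · cases x
    exacts [.inl ⟨.e0, rfl⟩, .inl ⟨.f0, rfl⟩]
  rcases p with _ | ⟨p, e'⟩
  · rcases e with _ | _
    exacts [.inl ⟨.u, rfl⟩, .inl ⟨.v, rfl⟩]
  rcases p with _ | ⟨p, e''⟩
  · rcases e with _ | _ <;> rcases e' with _ | _
    exacts [.inl ⟨.f1, rfl⟩, .inl ⟨.e1, rfl⟩]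
  · right
    simp

theorem length_mul {p q r : QPath} (h : p.mul q = some r) :
    r.2.2.length = p.2.2.length + q.2.2.length := by
  obtain ⟨x, y, p⟩ := p
  obtain ⟨x', y', q⟩ := q
  by_cases h₁ : y' = x
  · subst h₁
    simp only [QPath.mul, dite_true, Option.some.injEq] at h
    subst h
    simp [Nat.add_comm]
  · simp [QPath.mul, h₁] at h

/-- The image in `A` of a path, or `0`. -/
def pathImage? : Option QPath → A K
  | some p => pathImage K p
  | none => 0

theorem pathImage_mul (p q : QPath) :
    pathImage? K (p.mul q) = pathImage K p * pathImage K q := by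
  rcases short_or_long p with ⟨g, rfl⟩ | hp
  · rcases short_or_long q with ⟨h, rfl⟩ | hq
    · rw [pathImage_shortPath, pathImage_shortPath]
      cases g <;> cases h <;> ext k <;> cases k <;>
        simp [QPath.mul, shortPath, pathImage?, pathImage, gen, A.mul_def, mulA,
          Quiver.Path.cast]
    · rw [pathImage_long K hq, mul_zero]
      rcases h : (shortPath g).mul q with _ | r
      · rfl
      · exact pathImage_long K (by rw [length_mul h]; omega)
  · rw [pathImage_long K hp, zero_mul]
    rcases h : p.mul q with _ | r
    · rfl
    · exact pathImage_long K (by rw [length_mul h]; omega)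

/-- The linear map from the path algebra to `A`. -/
noncomputable def projLinear : PathAlgebra K →ₗ[K] A K :=
  (pathBasis K).constr K (pathImage K)

theorem projLinear_ofPath (p : QPath) : projLinear K (ofPath K p) = pathImage K p := by
  simp only [projLinear, ofPath, Module.Basis.constr_basis]

theorem projLinear_mul (x y : PathAlgebra K) :
    projLinear K (x * y) = projLinear K x * projLinear K y := by
  rw [mul_def']
  induction x using pathAlgebra_induction with
  | h0 => simp
  | hadd _ _ h₁ h₂ => simp only [map_add, LinearMap.add_apply, h₁, h₂, add_mul]
  | hsm c y hy => simp only [map_smul, LinearMap.smul_apply, hy, smul_mul_assoc]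
  | hs p =>
  induction y using pathAlgebra_induction with
  | h0 => simp
  | hadd _ _ h₁ h₂ => simp only [map_add, h₁, h₂, mul_add]
  | hsm c y hy => simp only [map_smul, hy, mul_smul_comm]
  | hs q =>
  rw [pathMul_ofPath, projLinear_ofPath, projLinear_ofPath, ← pathImage_mul]
  rcases p.mul q with _ | r
  · simp [ofPath?, pathImage?]
  · simp [ofPath?, pathImage?, projLinear_ofPath]

theorem projLinear_one : projLinear K 1 = 1 := by
  change projLinear K (ofPath K (shortPath .e0) + ofPath K (shortPath .f0)) = 1
  rw [map_add, projLinear_ofPath, projLinear_ofPath, pathImage_shortPath, pathImage_shortPath]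
  ext g
  cases g <;> simp [gen, A.one_def, oneA]

/-- The algebra homomorphism from the path algebra to `A`. -/
noncomputable def proj : PathAlgebra K →ₐ[K] A K :=
  AlgHom.ofLinearMap (projLinear K) (projLinear_one K) (projLinear_mul K)

theorem proj_surjective : Function.Surjective (proj K) := by
  intro x
  refine ⟨∑ g, x g • ofPath K (shortPath g), ?_⟩
  change projLinear K _ = _
  conv_rhs => rw [sum_gen K x]
  simp [projLinear_ofPath, pathImage_shortPath]

theorem ofPath_mul_ofPath (p q : QPath) : ofPath K p * ofPath K q = ofPath? K (p.mul q) :=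
  pathMul_ofPath K p q

/-- The kernel of the projection is the cube of the arrow ideal. -/
theorem ker_proj : LinearMap.ker (proj K).toLinearMap = arrowIdeal K ^ 3 := by
  apply le_antisymm
  · intro x hx
    have key : ∀ x : PathAlgebra K,
        x - ∑ g, projLinear K x g • ofPath K (shortPath g) ∈ arrowIdeal K ^ 3 := by
      intro x
      induction x using pathAlgebra_induction with
      | h0 => simp
      | hadd y z hy hz =>
        have := add_mem hy hz
        simp only [map_add, A.add_apply, add_smul, Finset.sum_add_distrib]
        convert this using 1
        abel
      | hsm c y hy =>
        have := Submodule.smul_mem _ c hy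
        simp only [map_smul, A.smul_apply, mul_smul, ← Finset.smul_sum, ← smul_sub]
        exact this
      | hs p =>
        rw [projLinear_ofPath]
        rcases short_or_long p with ⟨g, rfl⟩ | hp
        · rw [pathImage_shortPath]
          simp [gen]
        · rw [pathImage_long K hp]
          simp only [A.zero_apply, zero_smul, Finset.sum_const_zero, sub_zero]
          obtain ⟨x, y, p⟩ := p
          rcases p with _ | ⟨p, e⟩
          · simp at hp
          rcases p with _ | ⟨p, e'⟩
          · simp at hp
          have hmem : ∀ q : QPath, 0 < q.2.2.length → ofPath K q ∈ arrowIdeal K :=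
            fun q hq => Submodule.subset_span ⟨q, hq, rfl⟩
          have hfac : ofPath K ⟨x, y, (p.cons e').cons e⟩ =
              ofPath K ⟨_, _, Quiver.Path.nil.cons e⟩ *
                (ofPath K ⟨_, _, Quiver.Path.nil.cons e'⟩ * ofPath K ⟨_, _, p⟩) := by
            simp [ofPath_mul_ofPath, QPath.mul, ofPath?]
          rw [hfac, pow_succ', pow_two]
          refine Submodule.mul_mem_mul (hmem _ (by simp)) (Submodule.mul_mem_mul (hmem _ (by simp))
            (hmem _ ?_))
          simp at hp ⊢
          omega
    have := key x
    have hx' : projLinear K x = 0 := hx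
    simpa [hx'] using this
  · have h₁ : ∀ x ∈ arrowIdeal K, projLinear K x .e0 = 0 ∧ projLinear K x .f0 = 0 := by
      intro x hx
      induction hx using Submodule.span_induction with
      | mem x h =>
        obtain ⟨p, hp, rfl⟩ := h
        rw [projLinear_ofPath]
        rcases short_or_long p with ⟨g, rfl⟩ | hp'
        · rw [pathImage_shortPath]
          cases g <;> simp [gen, shortPath] at hp ⊢
        · simp [pathImage_long K hp']
      | zero => simp
      | add y z _ _ hy hz => simp [hy, hz]
      | smul c y _ hy => simp [hy]
    rw [pow_succ', pow_two, Submodule.mul_le]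
    intro x hx y hy
    have h₂ : ∀ y ∈ arrowIdeal K * arrowIdeal K, projLinear K y .e0 = 0 ∧
        projLinear K y .f0 = 0 ∧ projLinear K y .u = 0 ∧ projLinear K y .v = 0 := by
      intro y hy
      induction hy using Submodule.mul_induction_on' with
      | mem_mul_mem y hy z hz =>
        rw [projLinear_mul]
        have hy' := h₁ y hy
        have hz' := h₁ z hz
        simp [A.mul_def, mulA, hy', hz']
      | add y _ z _ hy hz => simp [hy, hz]
    have hx' := h₁ x hx
    have hy' := h₂ y hy
    change projLinear K (x * y) = 0
    rw [projLinear_mul]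
    ext g
    cases g <;> simp [A.mul_def, mulA, hx', hy']

/-- The projection respects the gradings. -/
theorem proj_ofPath_mem (p : QPath) : proj K (ofPath K p) ∈ piece K (pathDeg p.2.2) := by
  change projLinear K _ ∈ _
  rw [projLinear_ofPath]
  rcases short_or_long p with ⟨g, rfl⟩ | hp
  · rw [pathImage_shortPath]
    intro h hh
    have : h ≠ g := by
      rintro rfl
      apply hh
      cases h <;> simp [shortPath, pathDeg, Gen.deg, Arrow.deg]
    simp [gen, this]
  · rw [pathImage_long K hp]
    exact zero_mem _

end Presentation

/-! ### Hochschild cochains and Hochschild cohomology -/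

section Hochschild

variable (K : Type u) [Field K]

/-- The map `x ↦ (-1) ^ (s * |x|) x` (for homogeneous `x`). -/
def twistFun (s : ℤ) (x : A K) : A K := ⟨fun g => (-1 : K) ^ (s * g.deg) * x g⟩

@[simp]
theorem twistFun_apply (s : ℤ) (x : A K) (g : Gen) :
    twistFun K s x g = (-1 : K) ^ (s * g.deg) * x g := rfl

/-- The map `x ↦ (-1) ^ (s * |x|) x` is an endomorphism of the algebra `A`. -/
def twist (s : ℤ) : A K →ₐ[K] A K where
  toFun := twistFun K s
  map_one' := by ext g; cases g <;> simp [A.one_def, oneA, Gen.deg]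
  map_mul' x y := by
    ext g; cases g <;> simp [A.mul_def, mulA, Gen.deg] <;> ring
  map_zero' := by ext g; simp
  map_add' x y := by ext g; simp [mul_add]
  commutes' c := by
    ext g; cases g <;> simp [Algebra.algebraMap_eq_smul_one, A.one_def, oneA, Gen.deg]

theorem twist_of_mem (s i : ℤ) {x : A K} (hx : x ∈ piece K i) :
    twist K s x = (-1 : K) ^ (s * i) • x := by
  change twistFun K s x = _
  ext g
  by_cases h : g.deg = i
  · simp [h]
  · simp [hx g h]

/-- `CC^{r+s}(A,A)^s`: the `K`-multilinear maps `A ^ r → A` that raise the degree by `s` (that is,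
the degree-preserving linear maps `A^{⊗ r} → A[s]`) and vanish if one of the inputs is `1`. -/
def cochains (r : ℕ) (s : ℤ) : Submodule K (MultilinearMap K (fun _ : Fin r => A K) (A K)) where
  carrier := {f | (∀ (d : Fin r → ℤ) (x : Fin r → A K), (∀ i, x i ∈ piece K (d i)) →
      f x ∈ piece K ((∑ i, d i) + s)) ∧ ∀ x : Fin r → A K, (∃ i, x i = 1) → f x = 0}
  add_mem' hf hg := ⟨fun d x hx => add_mem (hf.1 d x hx) (hg.1 d x hx),
    fun x hx => by simp [hf.2 x hx, hg.2 x hx]⟩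
  zero_mem' := ⟨fun _ _ _ => zero_mem _, fun _ _ => rfl⟩
  smul_mem' c f hf := ⟨fun d x hx => Submodule.smul_mem _ c (hf.1 d x hx),
    fun x hx => by simp [hf.2 x hx]⟩

variable {K}

/-- Multiplying two adjacent entries of a tuple, as one of the entries varies. -/
theorem contractNth_update {r : ℕ} (i : Fin r) (a : Fin (r + 1) → A K) (j : Fin (r + 1)) :
    ∃ (k : Fin r) (φ : A K →ₗ[K] A K), ∀ x,
      Fin.contractNth i.castSucc (· * ·) (Function.update a j x) =
        Function.update (Fin.contractNth i.castSucc (· * ·) a) k (φ x) := by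
  obtain ⟨i, hi⟩ := i
  obtain ⟨j, hj⟩ := j
  rcases lt_trichotomy j i with h | h | h
  · refine ⟨⟨j, by omega⟩, .id, fun x => ?_⟩
    ext1 ⟨k, hk⟩
    simp only [Fin.contractNth, Function.update_apply, Fin.ext_iff, Fin.castSucc_mk, Fin.succ_mk,
      LinearMap.id_apply]
    split_ifs <;> first | rfl | omega
  · subst h
    refine ⟨⟨j, hi⟩, LinearMap.mulRight K (a ⟨j + 1, by omega⟩), fun x => ?_⟩
    ext1 ⟨k, hk⟩
    simp only [Fin.contractNth, Function.update_apply, Fin.ext_iff, Fin.castSucc_mk, Fin.succ_mk,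
      LinearMap.mulRight_apply]
    split_ifs with h₁ h₂ h₃ h₄ h₅ <;> first | rfl | omega | (subst h₃; rfl)
  · by_cases h' : j = i + 1
    · subst h'
      refine ⟨⟨i, hi⟩, LinearMap.mulLeft K (a ⟨i, by omega⟩), fun x => ?_⟩
      ext1 ⟨k, hk⟩
      simp only [Fin.contractNth, Function.update_apply, Fin.ext_iff, Fin.castSucc_mk, Fin.succ_mk,
        LinearMap.mulLeft_apply]
      split_ifs <;> first | rfl | omega | (subst_vars; rfl)
    · refine ⟨⟨j - 1, by omega⟩, .id, fun x => ?_⟩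
      ext1 ⟨k, hk⟩
      simp only [Fin.contractNth, Function.update_apply, Fin.ext_iff, Fin.castSucc_mk, Fin.succ_mk,
        LinearMap.id_apply]
      split_ifs <;> first | rfl | omega

/-- The multilinear map `(a_0, …, a_r) ↦ f (a_0, …, a_i a_{i+1}, …, a_r)`. -/
def contract {r : ℕ} (i : Fin r) (f : MultilinearMap K (fun _ : Fin r => A K) (A K)) :
    MultilinearMap K (fun _ : Fin (r + 1) => A K) (A K) where
  toFun a := f (Fin.contractNth i.castSucc (· * ·) a)
  map_update_add' {inst} a j x y := by
    rw [Subsingleton.elim inst (instDecidableEqFin _)]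
    obtain ⟨k, φ, h⟩ := contractNth_update i a j
    simp only [h, map_add, MultilinearMap.map_update_add]
  map_update_smul' {inst} a j c x := by
    rw [Subsingleton.elim inst (instDecidableEqFin _)]
    obtain ⟨k, φ, h⟩ := contractNth_update i a j
    simp only [h, map_smul, MultilinearMap.map_update_smul]

/-- The multilinear map `(a_0, …, a_r) ↦ (-1) ^ (s * |a_0|) a_0 f (a_1, …, a_r)`; the sign is that
of the left action of `A` on the shifted bimodule `A[s]`. -/
def firstTerm {r : ℕ} (s : ℤ) (f : MultilinearMap K (fun _ : Fin r => A K) (A K)) :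
    MultilinearMap K (fun _ : Fin (r + 1) => A K) (A K) :=
  LinearMap.uncurryLeft (M := fun _ : Fin (r + 1) => A K)
    { toFun := fun x => (LinearMap.mulLeft K (twist K s x)).compMultilinearMap f
      map_add' := fun x y => MultilinearMap.ext fun a => by simp [add_mul]
      map_smul' := fun c x => MultilinearMap.ext fun a => by simp }

/-- The multilinear map `(a_0, …, a_r) ↦ f (a_0, …, a_{r-1}) a_r`. -/
def lastTerm {r : ℕ} (f : MultilinearMap K (fun _ : Fin r => A K) (A K)) :
    MultilinearMap K (fun _ : Fin (r + 1) => A K) (A K) :=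
  MultilinearMap.uncurryRight (M := fun _ : Fin (r + 1) => A K)
    ((LinearMap.mul K (A K)).compMultilinearMap f)

theorem contract_apply {r : ℕ} (i : Fin r) (f : MultilinearMap K (fun _ : Fin r => A K) (A K))
    (a : Fin (r + 1) → A K) :
    contract i f a = f (Fin.contractNth i.castSucc (· * ·) a) := rfl

theorem firstTerm_apply {r : ℕ} (s : ℤ) (f : MultilinearMap K (fun _ : Fin r => A K) (A K))
    (a : Fin (r + 1) → A K) :
    firstTerm s f a = twist K s (a 0) * f (fun i => a i.succ) := rfl

theorem lastTerm_apply {r : ℕ} (f : MultilinearMap K (fun _ : Fin r => A K) (A K))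
    (a : Fin (r + 1) → A K) :
    lastTerm f a = f (fun i => a i.castSucc) * a (Fin.last r) := rfl

variable (K)

/-- The Hochschild differential, in internal degree `s`, on `r`-cochains:
`(δ f)(a_0, …, a_r) = (-1) ^ (s * |a_0|) a_0 f (a_1, …, a_r)
  + ∑_{0 ≤ i < r} (-1) ^ (i + 1) f (a_0, …, a_i a_{i+1}, …, a_r)
  + (-1) ^ (r + 1) f (a_0, …, a_{r-1}) a_r`.
This is the differential that the bar resolution induces on bimodule maps into `A[s]`. -/
def delta (r : ℕ) (s : ℤ) :
    MultilinearMap K (fun _ : Fin r => A K) (A K) →ₗ[K]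
      MultilinearMap K (fun _ : Fin (r + 1) => A K) (A K) where
  toFun f := firstTerm s f + ∑ i : Fin r, (-1 : K) ^ ((i : ℕ) + 1) • contract i f +
    (-1 : K) ^ (r + 1) • lastTerm f
  map_add' f g := MultilinearMap.ext fun a => by
    simp only [add_apply, sum_apply, smul_apply,
      firstTerm_apply, lastTerm_apply, contract_apply, mul_add, add_mul, smul_add,
      Finset.sum_add_distrib]
    abel
  map_smul' c f := MultilinearMap.ext fun a => by
    simp only [add_apply, sum_apply, smul_apply,
      firstTerm_apply, lastTerm_apply, contract_apply, RingHom.id_apply, smul_add,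
      Finset.smul_sum, mul_smul_comm, smul_mul_assoc, smul_comm c]

theorem delta_apply (r : ℕ) (s : ℤ) (f : MultilinearMap K (fun _ : Fin r => A K) (A K))
    (a : Fin (r + 1) → A K) :
    delta K r s f a = twist K s (a 0) * f (fun i => a i.succ) +
      ∑ i : Fin r, (-1 : K) ^ ((i : ℕ) + 1) • f (Fin.contractNth i.castSucc (· * ·) a) +
      (-1 : K) ^ (r + 1) • (f (fun i => a i.castSucc) * a (Fin.last r)) := by
  simp only [delta, LinearMap.coe_mk, AddHom.coe_mk, add_apply,
    sum_apply, smul_apply, firstTerm_apply, lastTerm_apply,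
    contract_apply]

/-- The Hochschild cocycles of length `r` and internal degree `s`. -/
def cocycles (r : ℕ) (s : ℤ) : Submodule K (MultilinearMap K (fun _ : Fin r => A K) (A K)) :=
  cochains K r s ⊓ LinearMap.ker (delta K r s)

/-- The Hochschild coboundaries of length `r` and internal degree `s`. -/
def coboundaries : (r : ℕ) → (s : ℤ) →
    Submodule K (MultilinearMap K (fun _ : Fin r => A K) (A K))
  | 0, _ => ⊥
  | r + 1, s => (cochains K r s).map (delta K r s)

/-- The bigraded Hochschild cohomology. In terms of the length `r` of the cochains and of the
internal degree `s`, the module `HH K r s` is `HH^{r+s}(A,A)^s`. -/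
abbrev HH (r : ℕ) (s : ℤ) : Type u :=
  ↥(cocycles K r s) ⧸ (coboundaries K r s).submoduleOf (cocycles K r s)

end Hochschild

/-! ### Graded bimodules and graded `Ext` -/

/-- A graded `(A,A)`-bimodule: a `K`-vector space that is the direct sum of its homogeneous pieces,
with commuting unital left and right actions of `A` that are compatible with the gradings. -/
structure GradedBimodule (K : Type u) [Field K] where
  carrier : Type u
  [addCommGroup : AddCommGroup carrier]
  [module : Module K carrier]
  /-- The left action: `lact a m` is `a m`. -/
  lact : A K →ₐ[K] Module.End K carrier
  /-- The right action: `ract (op a) m` is `m a`. -/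
  ract : (A K)ᵐᵒᵖ →ₐ[K] Module.End K carrier
  comm : ∀ a b m, lact a (ract b m) = ract b (lact a m)
  /-- The homogeneous pieces. -/
  grade : ℤ → Submodule K carrier
  isInternal : DirectSum.IsInternal grade
  lact_mem : ∀ {i j : ℤ} {a : A K} {m : carrier}, a ∈ piece K i → m ∈ grade j →
    lact a m ∈ grade (i + j)
  ract_mem : ∀ {i j : ℤ} {a : A K} {m : carrier}, a ∈ piece K i → m ∈ grade j →
    ract (MulOpposite.op a) m ∈ grade (j + i)

namespace GradedBimodule

attribute [instance] GradedBimodule.addCommGroup GradedBimodule.module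

variable {K : Type u} [Field K]

/-- The degree-preserving bimodule homomorphisms `M → N`. -/
def hom (M N : GradedBimodule K) : Submodule K (M.carrier →ₗ[K] N.carrier) where
  carrier := {f | (∀ a m, f (M.lact a m) = N.lact a (f m)) ∧
    (∀ a m, f (M.ract a m) = N.ract a (f m)) ∧ ∀ i, ∀ m ∈ M.grade i, f m ∈ N.grade i}
  add_mem' hf hg := ⟨fun a m => by simp [hf.1, hg.1], fun a m => by simp [hf.2.1, hg.2.1],
    fun i m hm => add_mem (hf.2.2 i m hm) (hg.2.2 i m hm)⟩
  zero_mem' := ⟨fun _ _ => by simp, fun _ _ => by simp, fun _ _ _ => zero_mem _⟩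
  smul_mem' c f hf := ⟨fun a m => by simp [hf.1], fun a m => by simp [hf.2.1],
    fun i m hm => Submodule.smul_mem _ c (hf.2.2 i m hm)⟩

/-- The shift `M[s]`: its piece of degree `i` is the piece of degree `i + s` of `M`, its left action
is `a ⊗ m ↦ (-1) ^ (s * |a|) a m`, and its right action is that of `M`. -/
def shift (M : GradedBimodule K) (s : ℤ) : GradedBimodule K where
  carrier := M.carrier
  lact := M.lact.comp (twist K s)
  ract := M.ract
  comm a b m := M.comm _ _ _
  grade i := M.grade (i + s)
  isInternal := by
    have h := (DirectSum.isInternal_submodule_iff_iSupIndep_and_iSup_eq_top _).1 M.isInternal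
    rw [DirectSum.isInternal_submodule_iff_iSupIndep_and_iSup_eq_top]
    refine ⟨h.1.comp (add_left_injective s), ?_⟩
    rw [← h.2]
    exact (Equiv.addRight s).iSup_comp (g := M.grade)
  lact_mem {i j a m} ha hm := by
    rw [AlgHom.comp_apply, twist_of_mem K s i ha, map_smul, LinearMap.smul_apply, add_assoc]
    exact Submodule.smul_mem _ _ (M.lact_mem ha hm)
  ract_mem {i j a m} ha hm := by
    rw [add_right_comm]
    exact M.ract_mem ha hm

variable (K) in
/-- The graded algebra `A` as a graded bimodule over itself. -/
def regular : GradedBimodule K where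
  carrier := A K
  lact := Algebra.lmul K (A K)
  ract := AlgHom.ofLinearMap
    ((LinearMap.mul K (A K)).flip ∘ₗ (MulOpposite.opLinearEquiv K).symm.toLinearMap)
    (by ext x; simp) (fun a b => by ext x : 1; simp [mul_assoc])
  comm a b m := by simp [mul_assoc]
  grade := piece K
  isInternal := piece_isInternal K
  lact_mem ha hm := mul_mem_piece K ha hm
  ract_mem ha hm := by
    exact mul_mem_piece K hm ha

/-- A graded bimodule is projective if degree-preserving homomorphisms out of it lift along
surjective degree-preserving homomorphisms. -/
def IsProjective (P : GradedBimodule K) : Prop :=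
  ∀ (M N : GradedBimodule K), ∀ g ∈ hom M N, Function.Surjective g →
    ∀ f ∈ hom P N, ∃ h ∈ hom P M, g ∘ₗ h = f

end GradedBimodule

/-- A resolution `⋯ → X 2 → X 1 → X 0 → A → 0` of `A` by projective graded bimodules, with
degree-preserving homomorphisms. -/
structure ProjectiveResolution (K : Type u) [Field K] where
  X : ℕ → GradedBimodule K
  projective : ∀ n, (X n).IsProjective
  d : ∀ n, (X (n + 1)).carrier →ₗ[K] (X n).carrier
  d_mem : ∀ n, d n ∈ (X (n + 1)).hom (X n)
  ε : (X 0).carrier →ₗ[K] (GradedBimodule.regular K).carrier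
  ε_mem : ε ∈ (X 0).hom (GradedBimodule.regular K)
  ε_surjective : Function.Surjective ε
  exact_zero : Function.Exact (d 0) ε
  exact_succ : ∀ n, Function.Exact (d (n + 1)) (d n)

namespace ProjectiveResolution

variable {K : Type u} [Field K] (P : ProjectiveResolution K) (B : GradedBimodule K)

/-- The cocycles of the complex of the degree-preserving homomorphisms `X r → B`. -/
def cocycles (r : ℕ) : Submodule K ((P.X r).carrier →ₗ[K] B.carrier) :=
  (P.X r).hom B ⊓ LinearMap.ker (LinearMap.lcomp K B.carrier (P.d r))

/-- The coboundaries of the complex of the degree-preserving homomorphisms `X r → B`. -/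
def coboundaries : (r : ℕ) → Submodule K ((P.X r).carrier →ₗ[K] B.carrier)
  | 0 => ⊥
  | r + 1 => ((P.X r).hom B).map (LinearMap.lcomp K B.carrier (P.d r))

/-- `Ext^r(A, B)` for graded bimodules, computed from the projective resolution `P` of `A`: the
`r`-th cohomology of the complex of the degree-preserving homomorphisms from `P` to `B`. -/
abbrev Ext (r : ℕ) : Type u :=
  ↥(P.cocycles B r) ⧸ (P.coboundaries B r).submoduleOf (P.cocycles B r)

end ProjectiveResolution

end TwoCycle

/-! Ext does not depend on the projective resolution (`nonempty_ext_equiv`), and the normalized bar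
resolution turns degree-preserving bimodule maps into `A[s]` into normalized cochains with
differential `delta` (`nonempty_HH_equiv_ext_bar`). This identifies `HH` with Ext, and so `HH` may
be computed from any convenient resolution.

The convenient one uses that `A` is a path algebra truncated at length three. Its term of index `n`
is a sum of bimodules `A e ⊗ e' A`, one for each of the two paths of length `⌊3n/2⌋` (lengths 0, 1,
3, 4, 6, 7, ...). All terms share one underlying vector space. On it, moving the last or the first
arrow of the generating path into the left or the right factor gives two commuting operators `l` and
`r` with `l³ = r³ = 0`. The differentials alternate between `l - r` and `l² + lr + r²`; their
products are `l³ - r³ = 0`, and the explicit homotopies `minD₁_homotopy` and `minD₂_homotopy` give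
exactness.

A bimodule map into `A[s]` is given by its values at the two generators, each value being a
combination of paths parallel to the generating path (`nonempty_ext_equiv_smallHH`). Lengthening the
paths by `2t` keeps their ends and raises their degrees by `t`, which a change of `s` by `-t`
compensates. Four steps of the resolution have `2t = 6`, so `s` drops by 3. The only other
dependence on `s` is the sign `(-1)^s` of the left action of `u`; it is restored after eight steps,
or at once in characteristic 2.

For given `n` and `s` the cochains form `0` or a copy of `K²`. With `ε = (-1)^s`, a differential
that does not vanish for reasons of path length is a 2×2 matrix, of determinant `ε - 1` for even `n`
and `2 + ε` for odd `n`. The value 0 comes with rank one and gives a copy of `K` as kernel and as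
cokernel; the values -2 and 3 give `K/(2)` and `K/(3)` twice; the value 1 gives nothing. Only at
`(0,1)` does a whole `K²` survive: nothing maps to it, and its differential is zero. -/

namespace TwoCycle

/-! ### Isomorphisms of subquotients -/

/-- Two subquotients are isomorphic as soon as there are linear maps in both directions that are
inverse to each other up to boundaries. -/
theorem nonempty_subquotient_equiv {K V W : Type*} [Field K] [AddCommGroup V] [Module K V]
    [AddCommGroup W] [Module K W] {Z B : Submodule K V} {Z' B' : Submodule K W}
    (F : V →ₗ[K] W) (G : W →ₗ[K] V) (hZ : ∀ z ∈ Z, F z ∈ Z') (hB : ∀ b ∈ B, F b ∈ B')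
    (hZ' : ∀ z ∈ Z', G z ∈ Z) (hB' : ∀ b ∈ B', G b ∈ B)
    (hGF : ∀ z ∈ Z, G (F z) - z ∈ B) (hFG : ∀ z ∈ Z', F (G z) - z ∈ B') :
    Nonempty ((Z ⧸ B.submoduleOf Z) ≃ₗ[K] (Z' ⧸ B'.submoduleOf Z')) := by
  refine ⟨LinearEquiv.ofLinearMap
    (Submodule.mapQ _ _ (F.restrict hZ) fun x hx => hB _ hx)
    (Submodule.mapQ _ _ (G.restrict hZ') fun x hx => hB' _ hx) ?_ ?_⟩
  · ext x
    simp only [LinearMap.comp_apply, Submodule.mkQ_apply, LinearMap.id_apply]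
    exact (Submodule.Quotient.eq _).2 (hFG _ x.2)
  · ext x
    simp only [LinearMap.comp_apply, Submodule.mkQ_apply, LinearMap.id_apply]
    exact (Submodule.Quotient.eq _).2 (hGF _ x.2)

/-- Two subquotients are isomorphic as soon as there are linear maps in both directions that are
inverse to each other. -/
theorem nonempty_subquotient_equiv_of_inverse {K V W : Type*} [Field K] [AddCommGroup V]
    [Module K V] [AddCommGroup W] [Module K W] {Z B : Submodule K V} {Z' B' : Submodule K W}
    (F : V →ₗ[K] W) (G : W →ₗ[K] V) (hZ : ∀ z ∈ Z, F z ∈ Z') (hB : ∀ b ∈ B, F b ∈ B')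
    (hZ' : ∀ z ∈ Z', G z ∈ Z) (hB' : ∀ b ∈ B', G b ∈ B)
    (hGF : ∀ z ∈ Z, G (F z) = z) (hFG : ∀ z ∈ Z', F (G z) = z) :
    Nonempty ((Z ⧸ B.submoduleOf Z) ≃ₗ[K] (Z' ⧸ B'.submoduleOf Z')) :=
  nonempty_subquotient_equiv F G hZ hB hZ' hB'
    (fun z hz => by rw [hGF z hz, sub_self]; exact zero_mem _)
    (fun z hz => by rw [hFG z hz, sub_self]; exact zero_mem _)

/-! ### Homogeneous components, kernels and lifting for graded bimodules -/

namespace GradedBimodule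

variable {K : Type u} [Field K]

/-- The direct sum of the homogeneous pieces is the whole bimodule. -/
noncomputable def sumEquiv (M : GradedBimodule K) :
    (DirectSum ℤ fun i => M.grade i) ≃ₗ[K] M.carrier :=
  have h : Function.Bijective (DirectSum.coeLinearMap M.grade) := M.isInternal
  LinearEquiv.ofBijective (DirectSum.coeLinearMap M.grade) h

theorem sumEquiv_apply (M : GradedBimodule K) (y : DirectSum ℤ fun i => M.grade i) :
    M.sumEquiv y = DirectSum.coeLinearMap M.grade y := rfl

/-- The projection to the homogeneous piece of degree `i`. -/
noncomputable def component (M : GradedBimodule K) (i : ℤ) : M.carrier →ₗ[K] M.carrier :=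
  (M.grade i).subtype ∘ₗ DirectSum.component K ℤ (fun i => M.grade i) i ∘ₗ
    M.sumEquiv.symm.toLinearMap

theorem component_mem (M : GradedBimodule K) (i : ℤ) (x : M.carrier) :
    M.component i x ∈ M.grade i :=
  Subtype.mem _

theorem component_of_mem (M : GradedBimodule K) {i j : ℤ} {x : M.carrier} (hx : x ∈ M.grade j) :
    M.component i x = if j = i then x else 0 := by
  have : M.sumEquiv.symm x =
      DirectSum.lof K ℤ (fun i => M.grade i) j ⟨x, hx⟩ := by
    rw [LinearEquiv.symm_apply_eq, sumEquiv_apply, DirectSum.coeLinearMap_lof]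
  simp only [component, LinearMap.comp_apply, LinearEquiv.coe_coe, this]
  split_ifs with h
  · subst h
    simp [DirectSum.component.lof_self]
  · simp [DirectSum.component.of, h]

theorem induction_on (M : GradedBimodule K) {p : M.carrier → Prop} (x : M.carrier)
    (h : ∀ i, ∀ x ∈ M.grade i, p x) (h0 : p 0) (hadd : ∀ x y, p x → p y → p (x + y)) : p x :=
  Submodule.iSup_induction (p := M.grade) (motive := p)
    (by rw [M.isInternal.submodule_iSup_eq_top]; trivial) h h0 hadd

theorem map_component {M N : GradedBimodule K} {f : M.carrier →ₗ[K] N.carrier} (hf : f ∈ hom M N)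
    (i : ℤ) (x : M.carrier) : f (M.component i x) = N.component i (f x) := by
  induction x using M.induction_on with
  | h j x hx =>
    rw [component_of_mem _ hx, component_of_mem _ (hf.2.2 j x hx)]
    split_ifs <;> simp
  | h0 => simp
  | hadd x y hx hy => simp [hx, hy]

/-- Every element is a finite sum of its components. This is what makes the kernel of a
degree-preserving map the sum of its homogeneous pieces. -/
theorem mem_of_component_mem (M : GradedBimodule K) (S : Submodule K M.carrier) (x : M.carrier)
    (h : ∀ i, M.component i x ∈ S) : x ∈ S := by
  have key : ∃ s : Finset ℤ, x = ∑ i ∈ s, M.component i x := by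
    set y := M.sumEquiv.symm x with hy
    have hx : x = DirectSum.coeLinearMap M.grade y := by
      rw [hy, ← sumEquiv_apply, LinearEquiv.apply_symm_apply]
    classical
    refine ⟨DFinsupp.support y, ?_⟩
    conv_lhs => rw [hx, DirectSum.coeLinearMap_eq_dfinsuppSum]
    rfl
  obtain ⟨s, hs⟩ := key
  rw [hs]
  exact sum_mem fun i _ => h i

theorem comp_mem_hom {M N L : GradedBimodule K} {g : N.carrier →ₗ[K] L.carrier}
    {f : M.carrier →ₗ[K] N.carrier} (hg : g ∈ hom N L) (hf : f ∈ hom M N) : g ∘ₗ f ∈ hom M L :=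
  ⟨fun a m => by simp [hf.1, hg.1], fun a m => by simp [hf.2.1, hg.2.1],
    fun i m hm => hg.2.2 i _ (hf.2.2 i m hm)⟩

theorem id_mem_hom (M : GradedBimodule K) : LinearMap.id ∈ hom M M :=
  ⟨fun _ _ => rfl, fun _ _ => rfl, fun _ _ h => h⟩

/-- The kernel of a degree-preserving homomorphism, as a graded bimodule. -/
def ker {M N : GradedBimodule K} (g : M.carrier →ₗ[K] N.carrier) (hg : g ∈ hom M N) :
    GradedBimodule K where
  carrier := LinearMap.ker g
  lact := AlgHom.ofLinearMap
    { toFun := fun a => (M.lact a).restrict fun x hx => by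
        rw [LinearMap.mem_ker] at hx ⊢; rw [hg.1, hx, map_zero]
      map_add' := fun a b => by ext x; simp
      map_smul' := fun c a => by ext x; simp }
    (by ext x; simp) (fun a b => by ext x; simp)
  ract := AlgHom.ofLinearMap
    { toFun := fun a => (M.ract a).restrict fun x hx => by
        rw [LinearMap.mem_ker] at hx ⊢; rw [hg.2.1, hx, map_zero]
      map_add' := fun a b => by ext x; simp
      map_smul' := fun c a => by ext x; simp }
    (by ext x; simp) (fun a b => by ext x; simp)
  comm a b m := Subtype.ext (M.comm a b m)
  grade i := (M.grade i).comap (LinearMap.ker g).subtype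
  isInternal := by
    have h := (DirectSum.isInternal_submodule_iff_iSupIndep_and_iSup_eq_top _).1 M.isInternal
    rw [DirectSum.isInternal_submodule_iff_iSupIndep_and_iSup_eq_top]
    constructor
    · intro i
      rw [Submodule.disjoint_def]
      intro x hx hx'
      have hle : (⨆ j, ⨆ (_ : j ≠ i), (M.grade j).comap (LinearMap.ker g).subtype) ≤
          (⨆ j, ⨆ (_ : j ≠ i), M.grade j).comap (LinearMap.ker g).subtype :=
        iSup₂_le fun j hj => Submodule.comap_mono (le_iSup₂_of_le j hj le_rfl)
      exact Subtype.ext ((Submodule.disjoint_def.1 (h.1 i)) _ hx (hle hx'))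
    · rw [eq_top_iff]
      rintro x -
      have := M.mem_of_component_mem
        ((⨆ j, (M.grade j).comap (LinearMap.ker g).subtype).map (LinearMap.ker g).subtype) x.1
        fun i => ⟨⟨M.component i x, by rw [LinearMap.mem_ker, map_component hg,
          LinearMap.mem_ker.1 x.2, map_zero]⟩,
          Submodule.mem_iSup_of_mem i (M.component_mem i x), rfl⟩
      obtain ⟨y, hy, hyx⟩ := this
      rwa [← Subtype.ext hyx]
  lact_mem ha hm := M.lact_mem ha hm
  ract_mem ha hm := M.ract_mem ha hm

/-- A homomorphism from a projective bimodule lifts along an exact sequence. -/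
theorem IsProjective.exists_lift {P L M N : GradedBimodule K} (hP : P.IsProjective)
    {e : L.carrier →ₗ[K] M.carrier} {g : M.carrier →ₗ[K] N.carrier} (he : e ∈ hom L M)
    (hg : g ∈ hom M N) (hex : Function.Exact e g) {f : P.carrier →ₗ[K] M.carrier} (hf : f ∈ hom P M)
    (hgf : g ∘ₗ f = 0) : ∃ h ∈ hom P L, e ∘ₗ h = f := by
  -- Projectivity speaks only of surjections, so it is applied to `L → ker g`, which is onto by
  -- exactness. For this the kernel has to be a graded bimodule.
  obtain ⟨h, hh, hh'⟩ := hP L (ker g hg) (LinearMap.codRestrict (LinearMap.ker g) e fun x =>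
      (hex _).2 ⟨x, rfl⟩)
    ⟨fun a m => Subtype.ext (he.1 a m), fun a m => Subtype.ext (he.2.1 a m),
      fun i m hm => he.2.2 i m hm⟩
    (by
      rintro ⟨x, hx⟩
      obtain ⟨y, rfl⟩ := (hex x).1 hx
      exact ⟨y, rfl⟩)
    (LinearMap.codRestrict (LinearMap.ker g) f fun x => LinearMap.congr_fun hgf x)
    ⟨fun a m => Subtype.ext (hf.1 a m), fun a m => Subtype.ext (hf.2.1 a m),
      fun i m hm => hf.2.2 i m hm⟩
  refine ⟨h, hh, ?_⟩
  ext x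
  exact congrArg Subtype.val (LinearMap.congr_fun hh' x)

end GradedBimodule

/-! ### Comparison of projective resolutions -/

namespace ProjectiveResolution

variable {K : Type u} [Field K]

open GradedBimodule

theorem ε_comp_d (P : ProjectiveResolution K) : P.ε ∘ₗ P.d 0 = 0 :=
  P.exact_zero.linearMap_comp_eq_zero

theorem d_comp_d (P : ProjectiveResolution K) (n : ℕ) : P.d n ∘ₗ P.d (n + 1) = 0 :=
  (P.exact_succ n).linearMap_comp_eq_zero

/-- Two projective resolutions are related by a chain map over the identity of `A`. -/
theorem exists_chainMap (P Q : ProjectiveResolution K) :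
    ∃ φ : ∀ n, (P.X n).carrier →ₗ[K] (Q.X n).carrier, (∀ n, φ n ∈ hom (P.X n) (Q.X n)) ∧
      Q.ε ∘ₗ φ 0 = P.ε ∧ ∀ n, Q.d n ∘ₗ φ (n + 1) = φ n ∘ₗ P.d n := by
  obtain ⟨φ₀, h₀, hφ₀⟩ := P.projective 0 _ _ Q.ε Q.ε_mem Q.ε_surjective P.ε P.ε_mem
  obtain ⟨φ₁, h₁, hφ₁⟩ := (P.projective 1).exists_lift (Q.d_mem 0) Q.ε_mem Q.exact_zero
    (comp_mem_hom h₀ (P.d_mem 0)) (by rw [← LinearMap.comp_assoc, hφ₀, ε_comp_d])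
  -- The recursion carries two consecutive components together with their commuting square, because
  -- the square is what allows the next component to be lifted.
  let S : ℕ → Type u := fun n => { p : ((P.X n).carrier →ₗ[K] (Q.X n).carrier) ×
    ((P.X (n + 1)).carrier →ₗ[K] (Q.X (n + 1)).carrier) //
      p.1 ∈ hom (P.X n) (Q.X n) ∧ p.2 ∈ hom (P.X (n + 1)) (Q.X (n + 1)) ∧
        Q.d n ∘ₗ p.2 = p.1 ∘ₗ P.d n }
  have step : ∀ n (p : S n), ∃ q : S (n + 1), q.1.1 = p.1.2 := by
    rintro n ⟨⟨f, g⟩, hf, hg, hfg⟩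
    obtain ⟨k, hk, hk'⟩ := (P.projective (n + 2)).exists_lift (Q.d_mem (n + 1)) (Q.d_mem n)
      (Q.exact_succ n) (comp_mem_hom hg (P.d_mem (n + 1)))
      (by rw [← LinearMap.comp_assoc, hfg, LinearMap.comp_assoc, d_comp_d, LinearMap.comp_zero])
    exact ⟨⟨(g, k), hg, hk, hk'⟩, rfl⟩
  choose next hnext using step
  let seq : ∀ n, S n := fun n => Nat.rec ⟨(φ₀, φ₁), h₀, h₁, hφ₁⟩ next n
  have hseq : ∀ n, (seq (n + 1)).1.1 = (seq n).1.2 := fun n => hnext n _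
  refine ⟨fun n => (seq n).1.1, fun n => (seq n).2.1, hφ₀, fun n => ?_⟩
  simp only [hseq]
  exact (seq n).2.2.2

/-- A chain endomorphism over the zero map of `A` is null-homotopic. -/
theorem exists_homotopy (P : ProjectiveResolution K)
    (φ : ∀ n, (P.X n).carrier →ₗ[K] (P.X n).carrier) (hφ : ∀ n, φ n ∈ hom (P.X n) (P.X n))
    (h0 : P.ε ∘ₗ φ 0 = 0) (hd : ∀ n, P.d n ∘ₗ φ (n + 1) = φ n ∘ₗ P.d n) :
    ∃ h : ∀ n, (P.X n).carrier →ₗ[K] (P.X (n + 1)).carrier,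
      (∀ n, h n ∈ hom (P.X n) (P.X (n + 1))) ∧ P.d 0 ∘ₗ h 0 = φ 0 ∧
        ∀ n, P.d (n + 1) ∘ₗ h (n + 1) + h n ∘ₗ P.d n = φ (n + 1) := by
  obtain ⟨k₀, m₀, hk₀⟩ := (P.projective 0).exists_lift (P.d_mem 0) P.ε_mem P.exact_zero (hφ 0) h0
  have lift : ∀ n (k : (P.X n).carrier →ₗ[K] (P.X (n + 1)).carrier), k ∈ hom (P.X n) (P.X (n + 1)) →
      P.d n ∘ₗ k ∘ₗ P.d n = φ n ∘ₗ P.d n →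
      ∃ l ∈ hom (P.X (n + 1)) (P.X (n + 2)), P.d (n + 1) ∘ₗ l + k ∘ₗ P.d n = φ (n + 1) := by
    intro n k hk hkd
    obtain ⟨l, hl, hl'⟩ := (P.projective (n + 1)).exists_lift (P.d_mem (n + 1)) (P.d_mem n)
      (P.exact_succ n) (sub_mem (hφ (n + 1)) (comp_mem_hom hk (P.d_mem n)))
      (by rw [LinearMap.comp_sub, hd, hkd, sub_self])
    exact ⟨l, hl, by rw [hl', sub_add_cancel]⟩
  -- The condition says that `φ (n + 1) - k d` is killed by `d n`, so that the next homotopy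
  -- component can be lifted; it passes on to that component because `d d = 0`.
  let S : ℕ → Type u := fun n => { k : (P.X n).carrier →ₗ[K] (P.X (n + 1)).carrier //
    k ∈ hom (P.X n) (P.X (n + 1)) ∧ P.d n ∘ₗ k ∘ₗ P.d n = φ n ∘ₗ P.d n }
  have step : ∀ n (k : S n), ∃ l : S (n + 1), P.d (n + 1) ∘ₗ l.1 + k.1 ∘ₗ P.d n = φ (n + 1) := by
    rintro n ⟨k, hk, hk'⟩
    obtain ⟨l, hl, hl'⟩ := lift n k hk hk'
    refine ⟨⟨l, hl, ?_⟩, hl'⟩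
    rw [← hl', LinearMap.add_comp, LinearMap.comp_assoc _ _ k, d_comp_d, LinearMap.comp_zero,
      add_zero, LinearMap.comp_assoc]
  choose next hnext using step
  let seq : ∀ n, S n := fun n => Nat.rec
    ⟨k₀, m₀, by rw [← LinearMap.comp_assoc, hk₀]⟩ next n
  exact ⟨fun n => (seq n).1, fun n => (seq n).2.1, hk₀, fun n => hnext n (seq n)⟩

theorem lcomp_mem_cocycles {P Q : ProjectiveResolution K} (B : GradedBimodule K)
    {φ : ∀ n, (P.X n).carrier →ₗ[K] (Q.X n).carrier} (hφ : ∀ n, φ n ∈ hom (P.X n) (Q.X n))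
    (hd : ∀ n, Q.d n ∘ₗ φ (n + 1) = φ n ∘ₗ P.d n) (r : ℕ) :
    ∀ z ∈ Q.cocycles B r, LinearMap.lcomp K B.carrier (φ r) z ∈ P.cocycles B r := by
  rintro z ⟨hz, hz'⟩
  refine ⟨comp_mem_hom hz (hφ r), ?_⟩
  have hz' : z ∘ₗ Q.d r = 0 := hz'
  change (z ∘ₗ φ r) ∘ₗ P.d r = 0
  rw [LinearMap.comp_assoc, ← hd, ← LinearMap.comp_assoc, hz', LinearMap.zero_comp]

theorem lcomp_mem_coboundaries {P Q : ProjectiveResolution K} (B : GradedBimodule K)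
    {φ : ∀ n, (P.X n).carrier →ₗ[K] (Q.X n).carrier} (hφ : ∀ n, φ n ∈ hom (P.X n) (Q.X n))
    (hd : ∀ n, Q.d n ∘ₗ φ (n + 1) = φ n ∘ₗ P.d n) (r : ℕ) :
    ∀ z ∈ Q.coboundaries B r, LinearMap.lcomp K B.carrier (φ r) z ∈ P.coboundaries B r := by
  cases r with
  | zero =>
    rintro z (rfl : z = 0)
    exact (LinearMap.lcomp K B.carrier (φ 0)).map_zero
  | succ r =>
    rintro _ ⟨y, hy, rfl⟩
    refine ⟨y ∘ₗ φ r, comp_mem_hom hy (hφ r), ?_⟩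
    change (y ∘ₗ φ r) ∘ₗ P.d r = (y ∘ₗ Q.d r) ∘ₗ φ (r + 1)
    rw [LinearMap.comp_assoc, LinearMap.comp_assoc, hd]

/-- A chain endomorphism over the identity of `A` differs from the identity by a null-homotopic map,
so it acts trivially on Ext. Applied to both composites of two comparison maps, this shows that they
are inverse on Ext. -/
theorem lcomp_sub_mem_coboundaries {P : ProjectiveResolution K} (B : GradedBimodule K)
    {φ : ∀ n, (P.X n).carrier →ₗ[K] (P.X n).carrier} (hφ : ∀ n, φ n ∈ hom (P.X n) (P.X n))
    (h0 : P.ε ∘ₗ φ 0 = P.ε) (hd : ∀ n, P.d n ∘ₗ φ (n + 1) = φ n ∘ₗ P.d n) (r : ℕ) :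
    ∀ z ∈ P.cocycles B r, z ∘ₗ φ r - z ∈ P.coboundaries B r := by
  obtain ⟨h, hh, hh0, hhd⟩ := P.exists_homotopy (fun n => φ n - LinearMap.id)
    (fun n => sub_mem (hφ n) (id_mem_hom _))
    (by rw [LinearMap.comp_sub, h0, LinearMap.comp_id, sub_self])
    (fun n => by rw [LinearMap.comp_sub, hd, LinearMap.sub_comp]; rfl)
  rintro z ⟨hz, hz'⟩
  have hz' : z ∘ₗ P.d r = 0 := hz'
  have key : z ∘ₗ φ r - z = z ∘ₗ (φ r - LinearMap.id) := by
    rw [LinearMap.comp_sub, LinearMap.comp_id]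
  rw [key]
  cases r with
  | zero =>
    rw [← hh0, ← LinearMap.comp_assoc, hz', LinearMap.zero_comp]
    exact zero_mem _
  | succ r =>
    rw [← hhd, LinearMap.comp_add, ← LinearMap.comp_assoc, hz', LinearMap.zero_comp, zero_add]
    exact ⟨z ∘ₗ h r, comp_mem_hom hz (hh r), rfl⟩

/-- `Ext` does not depend on the projective resolution. -/
theorem nonempty_ext_equiv (P Q : ProjectiveResolution K) (B : GradedBimodule K) (r : ℕ) :
    Nonempty (P.Ext B r ≃ₗ[K] Q.Ext B r) := by
  obtain ⟨φ, hφ, hφ0, hφd⟩ := exists_chainMap P Q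
  obtain ⟨ψ, hψ, hψ0, hψd⟩ := exists_chainMap Q P
  refine nonempty_subquotient_equiv (LinearMap.lcomp K B.carrier (ψ r))
    (LinearMap.lcomp K B.carrier (φ r))
    (lcomp_mem_cocycles B hψ hψd r) (lcomp_mem_coboundaries B hψ hψd r)
    (lcomp_mem_cocycles B hφ hφd r) (lcomp_mem_coboundaries B hφ hφd r) ?_ ?_
  · exact lcomp_sub_mem_coboundaries (φ := fun n => ψ n ∘ₗ φ n) B
      (fun n => comp_mem_hom (hψ n) (hφ n))
      (by rw [← LinearMap.comp_assoc, hψ0, hφ0])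
      (fun n => by rw [← LinearMap.comp_assoc, hψd, LinearMap.comp_assoc, hφd]; rfl) r
  · exact lcomp_sub_mem_coboundaries (φ := fun n => φ n ∘ₗ ψ n) B
      (fun n => comp_mem_hom (hφ n) (hψ n))
      (by rw [← LinearMap.comp_assoc, hφ0, hψ0])
      (fun n => by rw [← LinearMap.comp_assoc, hφd, LinearMap.comp_assoc, hψd]; rfl) r

end ProjectiveResolution

end TwoCycle

/-! ### The projective bimodules `A e_x ⊗ e_y A` as spaces of 3×3 matrices -/

namespace TwoCycle

/-- The other vertex. -/
def Vertex.swap : Vertex → Vertex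
  | .a => .b
  | .b => .a

@[simp] theorem Vertex.swap_swap (x : Vertex) : x.swap.swap = x := by cases x <;> rfl

instance : Fintype Vertex := ⟨{.a, .b}, fun x => by cases x <;> simp⟩

theorem Vertex.sum_univ {M : Type*} [AddCommMonoid M] (f : Vertex → M) :
    ∑ x, f x = f .a + f .b := by
  change ∑ x ∈ {Vertex.a, Vertex.b}, f x = _
  rw [Finset.sum_insert (by simp), Finset.sum_singleton]

/-- The path of length `n` that starts at `x`. -/
def pathFrom : Vertex → Fin 3 → Gen
  | .a => ![.e0, .u, .e1]
  | .b => ![.f0, .v, .f1]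

/-- The path of length `n` that ends at `y`. -/
def pathTo : Vertex → Fin 3 → Gen
  | .a => ![.e0, .v, .e1]
  | .b => ![.f0, .u, .f1]

section Matrices

variable {K : Type u} [Field K]

theorem Gen.sum_univ {M : Type*} [AddCommMonoid M] (f : Gen → M) :
    ∑ g, f g = f .e0 + f .f0 + f .u + f .v + f .e1 + f .f1 := by
  change ∑ g ∈ {Gen.e0, Gen.f0, Gen.u, Gen.v, Gen.e1, Gen.f1}, f g = _
  rw [Finset.sum_insert (by simp), Finset.sum_insert (by simp), Finset.sum_insert (by simp),
    Finset.sum_insert (by simp), Finset.sum_insert (by simp), Finset.sum_singleton]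
  simp only [add_assoc]

/-- The matrix of the left multiplication by `a` on the paths that start at `x`. -/
def leftMatFun (x : Vertex) (a : A K) : Matrix (Fin 3) (Fin 3) K :=
  match x with
  | .a => !![a .e0, 0, 0; a .u, a .f0, 0; a .e1, a .v, a .e0]
  | .b => !![a .f0, 0, 0; a .v, a .e0, 0; a .f1, a .u, a .f0]

/-- The matrix of the right multiplication by `a` on the paths that end at `y`, acting on rows. -/
def rightMatFun (y : Vertex) (a : A K) : Matrix (Fin 3) (Fin 3) K :=
  match y with
  | .a => !![a .e0, a .v, a .e1; 0, a .f0, a .u; 0, 0, a .e0]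
  | .b => !![a .f0, a .u, a .f1; 0, a .e0, a .v; 0, 0, a .f0]

/-- The representation of `A` on the paths that start at `x`. -/
def leftMat (x : Vertex) : A K →ₐ[K] Matrix (Fin 3) (Fin 3) K :=
  AlgHom.ofLinearMap
    { toFun := leftMatFun x
      map_add' := fun a b => by
        cases x <;> simp only [leftMatFun, Matrix.of_add_of, Matrix.add_cons, Matrix.head_cons,
          Matrix.tail_cons, A.add_apply, add_zero, Matrix.empty_add_empty]
      map_smul' := fun c a => by
        cases x <;> simp only [leftMatFun, Matrix.smul_of, Matrix.smul_cons, A.smul_apply,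
          smul_eq_mul, mul_zero, Matrix.smul_empty, RingHom.id_apply] }
    (by cases x <;> simp only [LinearMap.coe_mk, AddHom.coe_mk, leftMatFun, A.one_def, oneA,
          Matrix.one_fin_three])
    (fun a b => by
      cases x <;> simp only [LinearMap.coe_mk, AddHom.coe_mk, leftMatFun, Matrix.mul_fin_three,
        A.mul_def, mulA, mul_zero, zero_mul, add_zero, zero_add, add_comm, add_left_comm])

/-- The representation of `A` on the paths that end at `y`, acting on rows. -/
def rightMat (y : Vertex) : A K →ₐ[K] Matrix (Fin 3) (Fin 3) K :=
  AlgHom.ofLinearMap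
    { toFun := rightMatFun y
      map_add' := fun a b => by
        cases y <;> simp only [rightMatFun, Matrix.of_add_of, Matrix.add_cons, Matrix.head_cons,
          Matrix.tail_cons, A.add_apply, add_zero, Matrix.empty_add_empty]
      map_smul' := fun c a => by
        cases y <;> simp only [rightMatFun, Matrix.smul_of, Matrix.smul_cons, A.smul_apply,
          smul_eq_mul, mul_zero, Matrix.smul_empty, RingHom.id_apply] }
    (by cases y <;> simp only [LinearMap.coe_mk, AddHom.coe_mk, rightMatFun, A.one_def, oneA,
          Matrix.one_fin_three])
    (fun a b => by
      cases y <;> simp only [LinearMap.coe_mk, AddHom.coe_mk, rightMatFun, Matrix.mul_fin_three,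
        A.mul_def, mulA, mul_zero, zero_mul, add_zero, zero_add, add_comm])

theorem leftMat_apply (x : Vertex) (a : A K) : leftMat x a = leftMatFun x a := rfl
theorem rightMat_apply (y : Vertex) (a : A K) : rightMat y a = rightMatFun y a := rfl

theorem mul_gen_pathFrom (x : Vertex) (a : A K) (n : Fin 3) :
    a * gen (pathFrom x n) = ∑ k, leftMat x a k n • gen (pathFrom x k) := by
  rw [Fin.sum_univ_three]
  cases x <;> fin_cases n <;> ext g <;> cases g <;>
    simp [leftMat_apply, leftMatFun, pathFrom, A.mul_def, mulA, gen]

theorem gen_pathTo_mul (y : Vertex) (a : A K) (n : Fin 3) :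
    gen (pathTo y n) * a = ∑ k, rightMat y a n k • gen (pathTo y k) := by
  rw [Fin.sum_univ_three]
  cases y <;> fin_cases n <;> ext g <;> cases g <;>
    simp [rightMat_apply, rightMatFun, pathTo, A.mul_def, mulA, gen]

/-- The entry `(n, k)` is the coefficient of the path of length `n` in `a` times the path of length
`k`, so for homogeneous `a` the degrees must add up. -/
theorem leftMat_eq_zero (x : Vertex) {a : A K} {i : ℤ} (ha : a ∈ piece K i) (n k : Fin 3)
    (h : (pathFrom x n).deg ≠ i + (pathFrom x k).deg) : leftMat x a n k = 0 := by
  cases x <;> fin_cases n <;> fin_cases k <;>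
    simp [leftMat_apply, leftMatFun, pathFrom, Gen.deg] at h ⊢ <;>
    exact ha _ (by simp [Gen.deg]; omega)

theorem rightMat_eq_zero (y : Vertex) {a : A K} {i : ℤ} (ha : a ∈ piece K i) (n k : Fin 3)
    (h : (pathTo y n).deg ≠ i + (pathTo y k).deg) : rightMat y a k n = 0 := by
  cases y <;> fin_cases n <;> fin_cases k <;>
    simp [rightMat_apply, rightMatFun, pathTo, Gen.deg] at h ⊢ <;>
    exact ha _ (by simp [Gen.deg]; omega)

end Matrices

section Projective

variable (K : Type u) [Field K] {J : Type} (x y : J → Vertex) (δ : J → ℤ)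

theorem eq_sum_single {K : Type u} [Field K] {J : Type} [Fintype J] [DecidableEq J]
    (X : J → Matrix (Fin 3) (Fin 3) K) :
    X = ∑ j, ∑ n, ∑ m, X j n m • Pi.single j (Matrix.single n m 1) := by
  conv_lhs => rw [← Finset.univ_sum_single X]
  refine Finset.sum_congr rfl fun j _ => ?_
  conv_lhs => rw [Matrix.matrix_eq_sum_single (X j)]
  change LinearMap.single K (fun _ => Matrix (Fin 3) (Fin 3) K) j _ = _
  simp only [map_sum]
  refine Finset.sum_congr rfl fun n _ => Finset.sum_congr rfl fun m _ => ?_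
  rw [LinearMap.coe_single, ← Pi.single_smul, Matrix.smul_single, smul_eq_mul, mul_one]

/-- The degree of the basis element with index `(n, m)` of the summand `j` of `projBimod`. -/
def entryDeg (j : J) (n m : Fin 3) : ℤ :=
  (pathFrom (x j) n).deg + δ j + (pathTo (y j) m).deg

/-- The left action of `A` on `projBimod`. -/
def projLact : A K →ₐ[K] Module.End K (J → Matrix (Fin 3) (Fin 3) K) :=
  AlgHom.ofLinearMap
    { toFun := fun a => LinearMap.pi fun j =>
        LinearMap.mulLeft K (leftMat (x j) a) ∘ₗ LinearMap.proj j
      map_add' := fun a b => LinearMap.ext fun X => funext fun j => by simp [add_mul]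
      map_smul' := fun c a => LinearMap.ext fun X => funext fun j => by simp }
    (LinearMap.ext fun X => funext fun j => by simp)
    (fun a b => LinearMap.ext fun X => funext fun j => by simp)

/-- The right action of `A` on `projBimod`. -/
def projRact : (A K)ᵐᵒᵖ →ₐ[K] Module.End K (J → Matrix (Fin 3) (Fin 3) K) :=
  AlgHom.ofLinearMap
    { toFun := fun a => LinearMap.pi fun j =>
        LinearMap.mulRight K (rightMat (y j) a.unop) ∘ₗ LinearMap.proj j
      map_add' := fun a b => LinearMap.ext fun X => funext fun j => by simp [mul_add]
      map_smul' := fun c a => LinearMap.ext fun X => funext fun j => by simp }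
    (LinearMap.ext fun X => funext fun j => by simp)
    (fun a b => LinearMap.ext fun X => funext fun j => by simp [mul_assoc])

variable {K x y}

theorem projLact_apply (a : A K) (X : J → Matrix (Fin 3) (Fin 3) K) (j : J) :
    projLact K x a X j = leftMat (x j) a * X j := rfl

theorem projRact_apply (a : A K) (X : J → Matrix (Fin 3) (Fin 3) K) (j : J) :
    projRact K y (MulOpposite.op a) X j = X j * rightMat (y j) a := rfl

variable (K x y)

/-- The homogeneous pieces of `projBimod`. -/
def projGrade (i : ℤ) : Submodule K (J → Matrix (Fin 3) (Fin 3) K) where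
  carrier := {X | ∀ j n m, entryDeg x y δ j n m ≠ i → X j n m = 0}
  add_mem' := fun hX hY j n m h => by simp [hX j n m h, hY j n m h]
  zero_mem' := fun _ _ _ _ => rfl
  smul_mem' := fun c X hX j n m h => by simp [hX j n m h]

variable [Fintype J] [DecidableEq J]

/-- The graded bimodule `⨁ j, A e_{x j} ⊗ e_{y j} A`, with the generator of the summand `j` in
degree `δ j`. The entry `(n, m)` of the matrix at `j` is the coefficient of `p ⊗ q`, where `p` has
length `n` and starts at `x j` and `q` has length `m` and ends at `y j`. -/
abbrev projBimod : GradedBimodule K where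
  carrier := J → Matrix (Fin 3) (Fin 3) K
  lact := projLact K x
  ract := projRact K y
  comm a b X := funext fun j => by
    change leftMat (x j) a * (X j * rightMat (y j) b.unop) = leftMat (x j) a * X j * _
    rw [mul_assoc]
  grade := projGrade K x y δ
  isInternal := by
    rw [DirectSum.isInternal_submodule_iff_iSupIndep_and_iSup_eq_top]
    constructor
    · intro i
      rw [Submodule.disjoint_def]
      intro X hX hX'
      let C : Submodule K (J → Matrix (Fin 3) (Fin 3) K) :=
        { carrier := {X | ∀ j n m, entryDeg x y δ j n m = i → X j n m = 0}
          add_mem' := fun hX hY j n m h => by simp [hX j n m h, hY j n m h]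
          zero_mem' := fun _ _ _ _ => rfl
          smul_mem' := fun c X hX j n m h => by simp [hX j n m h] }
      have hC := (iSup₂_le (a := C) fun j hj Y hY k n m h =>
        hY k n m (by rw [h]; exact hj.symm)) hX'
      funext j
      ext n m
      by_cases h : entryDeg x y δ j n m = i
      · exact hC j n m h
      · exact hX j n m h
    · rw [eq_top_iff]
      intro X _
      rw [eq_sum_single X]
      refine sum_mem fun j _ => sum_mem fun n _ => sum_mem fun m _ => Submodule.smul_mem _ _
        (Submodule.mem_iSup_of_mem (entryDeg x y δ j n m) fun k n' m' h => ?_)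
      by_cases hk : k = j
      · subst hk
        rw [Pi.single_eq_same, Matrix.single_apply, if_neg]
        rintro ⟨rfl, rfl⟩
        exact h rfl
      · rw [Pi.single_eq_of_ne hk]; rfl
  lact_mem {i k a X} ha hX j n m h := by
    change (leftMat (x j) a * X j) n m = 0
    rw [Matrix.mul_apply]
    refine Finset.sum_eq_zero fun l _ => ?_
    by_cases hl : (pathFrom (x j) n).deg = i + (pathFrom (x j) l).deg
    · rw [hX j l m (by unfold entryDeg at *; omega), mul_zero]
    · rw [leftMat_eq_zero _ ha _ _ hl, zero_mul]
  ract_mem {i k a X} ha hX j n m h := by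
    change (X j * rightMat (y j) a) n m = 0
    rw [Matrix.mul_apply]
    refine Finset.sum_eq_zero fun l _ => ?_
    by_cases hl : (pathTo (y j) m).deg = i + (pathTo (y j) l).deg
    · rw [hX j n l (by unfold entryDeg at *; omega), zero_mul]
    · rw [rightMat_eq_zero _ ha _ _ hl, mul_zero]

end Projective

end TwoCycle

/-! ### Homomorphisms out of the projective bimodules -/

namespace TwoCycle

section Maps

open MulOpposite GradedBimodule

variable {K : Type u} [Field K] {J : Type} [Fintype J] [DecidableEq J] {x y : J → Vertex}
  {δ : J → ℤ}

/-- The generator of the summand `j` of `projBimod`. -/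
def generator (K : Type u) [Field K] (j : J) : J → Matrix (Fin 3) (Fin 3) K :=
  Pi.single j (Matrix.single 0 0 1)

theorem pathTo_zero (z : Vertex) : pathTo z 0 = pathFrom z 0 := by cases z <;> rfl

theorem pathFrom_zero_deg (z : Vertex) : (pathFrom z 0).deg = 0 := by cases z <;> rfl

omit [Fintype J] in
theorem generator_mem (j : J) : generator K j ∈ projGrade K x y δ (δ j) := by
  intro k n m h
  rw [generator]
  by_cases hk : k = j
  · subst hk
    rw [Pi.single_eq_same, Matrix.single_apply, if_neg]
    rintro ⟨rfl, rfl⟩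
    exact h (by rw [entryDeg, pathTo_zero, pathFrom_zero_deg, pathFrom_zero_deg]; ring)
  · rw [Pi.single_eq_of_ne hk]; rfl

/-- Column 0 of `leftMat z a` lists the coefficients of `a e_z`; for a path that starts at `z` it is
a unit vector. -/
theorem leftMat_mul_single (z : Vertex) (n m : Fin 3) :
    leftMat z (gen (pathFrom z n) : A K) * Matrix.single 0 m 1 = Matrix.single n m 1 := by
  have : ∀ k, leftMat z (gen (pathFrom z n) : A K) k 0 = if n = k then 1 else 0 := by
    intro k
    cases z <;> fin_cases n <;> fin_cases k <;>
    simp [leftMat_apply, leftMatFun, pathFrom, gen]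
  ext k l
  rw [Matrix.mul_apply, Fin.sum_univ_three]
  simp [Matrix.single_apply, this, ite_and]
  split_ifs <;> rfl

theorem single_mul_rightMat (z : Vertex) (n m : Fin 3) :
    Matrix.single n 0 1 * rightMat z (gen (pathTo z m) : A K) = Matrix.single n m 1 := by
  have : ∀ k, rightMat z (gen (pathTo z m) : A K) 0 k = if m = k then 1 else 0 := by
    intro k
    cases z <;> fin_cases m <;> fin_cases k <;>
    simp [rightMat_apply, rightMatFun, pathTo, gen]
  ext k l
  rw [Matrix.mul_apply, Fin.sum_univ_three]
  simp [Matrix.single_apply, this, ite_and]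
  split_ifs <;> rfl

omit [Fintype J] in
theorem lact_ract_generator (j : J) (n m : Fin 3) :
    projLact K x (gen (pathFrom (x j) n))
      (projRact K y (op (gen (pathTo (y j) m))) (generator K j)) =
      Pi.single j (Matrix.single n m 1) := by
  funext k
  rw [projLact_apply, projRact_apply, generator]
  by_cases hk : k = j
  · subst hk
    rw [Pi.single_eq_same, Pi.single_eq_same, single_mul_rightMat, leftMat_mul_single]
  · rw [Pi.single_eq_of_ne hk, Pi.single_eq_of_ne hk, zero_mul, mul_zero]

theorem eq_sum_generator (X : J → Matrix (Fin 3) (Fin 3) K) :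
    X = ∑ j, ∑ n, ∑ m, X j n m • projLact K x (gen (pathFrom (x j) n))
      (projRact K y (op (gen (pathTo (y j) m))) (generator K j)) := by
  simp only [lact_ract_generator]
  exact eq_sum_single X

theorem projBimod_linearMap_ext {M : Type*} [AddCommGroup M] [Module K M]
    {f g : (J → Matrix (Fin 3) (Fin 3) K) →ₗ[K] M}
    (h : ∀ j a b, f (projLact K x a (projRact K y (op b) (generator K j))) =
      g (projLact K x a (projRact K y (op b) (generator K j)))) : f = g := by
  refine LinearMap.ext fun X => ?_
  rw [eq_sum_generator (x := x) (y := y) X]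
  simp only [map_sum, map_smul, h]

variable (x y) (B : GradedBimodule K)

/-- The right linear map from `projBimod` whose value at `a ⊗ b` in the summand `j` is
`c j a b`. -/
def homRight (c : J → A K →ₗ[K] B.carrier) :
    (J → Matrix (Fin 3) (Fin 3) K) →ₗ[K] B.carrier where
  toFun X := ∑ j, ∑ n, ∑ m, X j n m •
    B.ract (op (gen (pathTo (y j) m))) (c j (gen (pathFrom (x j) n)))
  map_add' X Y := by simp [add_smul, Finset.sum_add_distrib]
  map_smul' c X := by simp [mul_smul, Finset.smul_sum]

omit [DecidableEq J] in
theorem homRight_apply (c : J → A K →ₗ[K] B.carrier) (X : J → Matrix (Fin 3) (Fin 3) K) :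
    homRight x y B c X = ∑ j, ∑ n, ∑ m, X j n m •
      B.ract (op (gen (pathTo (y j) m))) (c j (gen (pathFrom (x j) n))) := rfl

variable {x y}

omit [DecidableEq J] in
theorem homRight_ract (c : J → A K →ₗ[K] B.carrier) (a : A K) (X : J → Matrix (Fin 3) (Fin 3) K) :
    homRight x y B c (projRact K y (op a) X) = B.ract (op a) (homRight x y B c X) := by
  simp only [homRight_apply, projRact_apply, map_sum, map_smul, Matrix.mul_apply]
  refine Finset.sum_congr rfl fun j _ => Finset.sum_congr rfl fun n _ => ?_
  simp only [Finset.sum_smul, mul_smul]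
  rw [Finset.sum_comm]
  refine Finset.sum_congr rfl fun l _ => ?_
  rw [← Finset.smul_sum, ← Module.End.mul_apply, ← map_mul, ← op_mul, gen_pathTo_mul]
  refine congrArg (X j n l • ·) ?_
  change _ = B.ract (MulOpposite.opLinearEquiv K _) _
  simp only [map_sum, map_smul, LinearMap.sum_apply, LinearMap.smul_apply,
    MulOpposite.coe_opLinearEquiv]

-- For a map that is only right linear, a left multiplication is absorbed into the prescribed
-- values. This serves the contraction of the bar resolution as well as the left linearity of
-- `homOfGen`.
omit [DecidableEq J] in
theorem homRight_lact (c : J → A K →ₗ[K] B.carrier) (a : A K)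
    (X : J → Matrix (Fin 3) (Fin 3) K) :
    homRight x y B c (projLact K x a X) =
      homRight x y B (fun j => c j ∘ₗ LinearMap.mulLeft K a) X := by
  simp only [homRight_apply, projLact_apply, Matrix.mul_apply, LinearMap.comp_apply,
    LinearMap.mulLeft_apply]
  refine Finset.sum_congr rfl fun j _ => ?_
  rw [Finset.sum_comm]
  conv_rhs => rw [Finset.sum_comm]
  refine Finset.sum_congr rfl fun m _ => ?_
  simp only [mul_gen_pathFrom, map_sum, map_smul, Finset.sum_smul, Finset.smul_sum]
  rw [Finset.sum_comm]
  simp only [smul_smul, mul_comm]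

theorem homRight_generator (c : J → A K →ₗ[K] B.carrier) (j : J) :
    homRight x y B c (generator K j) =
      B.ract (op (gen (pathFrom (y j) 0))) (c j (gen (pathFrom (x j) 0))) := by
  rw [homRight_apply, Finset.sum_eq_single j, Finset.sum_eq_single 0, Finset.sum_eq_single 0]
  · simp [generator, pathTo_zero]
  · intro m _ hm
    simp [generator, hm.symm]
  · simp
  · intro n _ hn
    simp [generator, hn.symm]
  · simp
  · intro k _ hk
    simp [generator, hk]
  · simp

omit [DecidableEq J] in
theorem homRight_mem (c : J → A K →ₗ[K] B.carrier)
    (hc : ∀ j i a, a ∈ piece K i → c j a ∈ B.grade (i + δ j)) (i : ℤ)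
    (X : J → Matrix (Fin 3) (Fin 3) K) (hX : X ∈ projGrade K x y δ i) :
    homRight x y B c X ∈ B.grade i := by
  rw [homRight_apply]
  refine sum_mem fun j _ => sum_mem fun n _ => sum_mem fun m _ => ?_
  by_cases h : entryDeg x y δ j n m = i
  · rw [← h, entryDeg]
    exact Submodule.smul_mem _ _ (B.ract_mem (gen_mem_piece K _) (hc j _ _ (gen_mem_piece K _)))
  · rw [hX j n m h, zero_smul]
    exact zero_mem _

variable (x y)

/-- The bimodule homomorphism from `projBimod` with prescribed values at the generators. -/
def homOfGen : (J → B.carrier) →ₗ[K] (J → Matrix (Fin 3) (Fin 3) K) →ₗ[K] B.carrier where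
  toFun b := homRight x y B fun j => LinearMap.applyₗ (b j) ∘ₗ B.lact.toLinearMap
  map_add' b c := LinearMap.ext fun X => by
    simp [homRight_apply, Finset.sum_add_distrib]
  map_smul' r b := LinearMap.ext fun X => by
    simp only [homRight_apply, LinearMap.smul_apply, Finset.smul_sum]
    simp [smul_comm r]

variable {x y}

/-- The generator is `e_x ⊗ e_y`, so the prescribed value survives only after truncation by the two
idempotents. -/
theorem homOfGen_generator (b : J → B.carrier) (j : J) :
    homOfGen x y B b (generator K j) =
      B.lact (gen (pathFrom (x j) 0)) (B.ract (op (gen (pathFrom (y j) 0))) (b j)) :=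
  (homRight_generator B _ j).trans (B.comm _ _ _).symm

theorem homOfGen_mem_hom {b : J → B.carrier} (hb : ∀ j, b j ∈ B.grade (δ j)) :
    homOfGen x y B b ∈ hom (projBimod K x y δ) B := by
  refine ⟨fun a X => ?_, fun a X => homRight_ract B _ a.unop X, homRight_mem B _ fun j i a ha =>
    B.lact_mem ha (hb j)⟩
  refine (homRight_lact B _ a X).trans ?_
  simp only [homOfGen, LinearMap.coe_mk, AddHom.coe_mk, homRight_apply, map_sum, map_smul,
    LinearMap.comp_apply, LinearMap.mulLeft_apply, LinearMap.applyₗ_apply_apply,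
    AlgHom.toLinearMap_apply, map_mul, Module.End.mul_apply, B.comm]

theorem hom_eq_of_generator {B : GradedBimodule K}
    {f g : (J → Matrix (Fin 3) (Fin 3) K) →ₗ[K] B.carrier}
    (hf : f ∈ hom (projBimod K x y δ) B) (hg : g ∈ hom (projBimod K x y δ) B)
    (h : ∀ j, f (generator K j) = g (generator K j)) : f = g := by
  refine projBimod_linearMap_ext (x := x) (y := y) fun j a b => ?_
  rw [hf.1, hf.2.1, hg.1, hg.2.1, h]

omit [Fintype J] in
theorem idem_generator (j : J) :
    projLact K x (gen (pathFrom (x j) 0))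
      (projRact K y (op (gen (pathFrom (y j) 0))) (generator K j)) = generator K j := by
  conv_lhs => rw [← pathTo_zero (y j)]
  exact lact_ract_generator j 0 0

/-- A homomorphism from `projBimod` is determined by its values at the generators. -/
theorem homOfGen_apply_generator {B : GradedBimodule K}
    {f : (J → Matrix (Fin 3) (Fin 3) K) →ₗ[K] B.carrier} (hf : f ∈ hom (projBimod K x y δ) B) :
    homOfGen x y B (fun j => f (generator K j)) = f := by
  refine hom_eq_of_generator (homOfGen_mem_hom B fun j => hf.2.2 _ _ (generator_mem j)) hf
    fun j => ?_
  rw [homOfGen_generator, ← hf.2.1, ← hf.1, idem_generator]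

/-- Preimages of the values at the generators need not be homogeneous, so they are replaced by their
components of degree `δ j`. This is harmless, since `g` commutes with taking components and the
values themselves have degree `δ j`. -/
theorem projBimod_isProjective : (projBimod K x y δ).IsProjective := by
  intro M N g hg hsurj f hf
  choose b hb using fun j => hsurj (f (generator K j))
  have hmem := homOfGen_mem_hom (x := x) (y := y) M (b := fun j => M.component (δ j) (b j))
    fun j => M.component_mem _ _
  refine ⟨_, hmem, hom_eq_of_generator (comp_mem_hom hg hmem) hf fun j => ?_⟩
  rw [LinearMap.comp_apply, homOfGen_generator, hg.1, hg.2.1, map_component hg, hb,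
    component_of_mem _ (hf.2.2 _ _ (generator_mem j)), if_pos rfl, ← hf.2.1, ← hf.1, idem_generator]

end Maps

end TwoCycle

/-! ### Words and the terms of the normalized bar resolution -/

namespace TwoCycle

open MulOpposite GradedBimodule

section Words

variable {K : Type u} [Field K]

/-- The basis elements of `A` other than `e0`; together with `1` they form a basis of `A`. -/
abbrev RedGen : Type := {g : Gen // g ≠ Gen.e0}

/-- The coordinates with respect to the basis that consists of `1` and the `RedGen`. -/
def redCoord (g : Gen) : A K →ₗ[K] K where
  toFun a := a g - oneA g * a .e0
  map_add' a b := by simp only [A.add_apply]; ring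
  map_smul' c a := by simp only [A.smul_apply, RingHom.id_apply, smul_eq_mul]; ring

theorem redCoord_apply (g : Gen) (a : A K) : redCoord g a = a g - oneA g * a .e0 := rfl

theorem redCoord_one (g : Gen) : redCoord g (1 : A K) = 0 := by
  simp [redCoord_apply, A.one_def, oneA]

theorem redCoord_gen (g h : RedGen) : redCoord g.1 (gen h.1 : A K) = if g = h then 1 else 0 := by
  have : (Gen.e0 : Gen) ≠ h.1 := h.2.symm
  simp [redCoord_apply, gen, this, Subtype.ext_iff]

theorem redCoord_eq_zero {g : Gen} {i : ℤ} {a : A K} (ha : a ∈ piece K i) (h : g.deg ≠ i) :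
    redCoord g a = 0 := by
  rw [redCoord_apply, ha g h, zero_sub, neg_eq_zero]
  by_cases hi : i = 0
  · cases g <;> simp [oneA] <;> simp [Gen.deg, hi] at h
  · rw [ha .e0 (Ne.symm hi), mul_zero]

theorem eq_sum_redCoord (a : A K) :
    a = a .e0 • 1 + ∑ g : RedGen, redCoord g.1 a • gen g.1 := by
  have h1 : (1 : A K) = gen .e0 + gen .f0 := by
    ext g; cases g <;> simp [A.one_def, oneA, gen]
  have h2 : ∑ g : RedGen, redCoord g.1 a • (gen g.1 : A K) = ∑ g : Gen, redCoord g a • gen g := by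
    rw [← Finset.sum_subtype (Finset.univ.erase Gen.e0) (by simp)
      fun g : Gen => redCoord g a • (gen g : A K)]
    refine Finset.sum_subset (Finset.subset_univ _) fun g _ hg => ?_
    obtain rfl : g = Gen.e0 := by simpa using hg
    simp [redCoord_apply, oneA]
  rw [h2, Gen.sum_univ, h1]
  conv_lhs => rw [sum_gen K a, Gen.sum_univ]
  simp only [redCoord_apply, oneA]
  module

theorem A.linearMap_ext {M : Type*} [AddCommGroup M] [Module K M] {f g : A K →ₗ[K] M}
    (h1 : f 1 = g 1) (h : ∀ k : RedGen, f (gen k.1) = g (gen k.1)) : f = g := by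
  refine LinearMap.ext fun a => ?_
  rw [eq_sum_redCoord a]
  simp only [map_add, map_smul, map_sum, h1, h]

/-- The tuple of elements of `A` given by a word in the basis elements. -/
def word {r : ℕ} (w : Fin r → RedGen) : Fin r → A K := fun i => gen (w i).1

/-- Multilinear maps that vanish if one of the entries is `1` are determined by their values on
words. -/
theorem multilinear_ext_word {M : Type*} [AddCommGroup M] [Module K M] {r : ℕ}
    {f g : MultilinearMap K (fun _ : Fin r => A K) M}
    (hf : ∀ x : Fin r → A K, (∃ i, x i = 1) → f x = 0)
    (hg : ∀ x : Fin r → A K, (∃ i, x i = 1) → g x = 0)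
    (h : ∀ w, f (word w) = g (word w)) : f = g := by
  let c : A K → Option RedGen → K := fun a o => o.elim (a .e0) fun k => redCoord k.1 a
  let e : Option RedGen → A K := fun o => o.elim 1 fun k => gen k.1
  have key : ∀ (f : MultilinearMap K (fun _ : Fin r => A K) M) (x : Fin r → A K),
      f x = ∑ w : Fin r → Option RedGen, (∏ i, c (x i) (w i)) • f (fun i => e (w i)) := by
    intro f x
    have hx : x = fun i => ∑ o, c (x i) o • e o := by
      funext i
      rw [Fintype.sum_option]
      exact eq_sum_redCoord (x i)
    conv_lhs => rw [hx, MultilinearMap.map_sum]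
    exact Finset.sum_congr rfl fun w _ => f.map_smul_univ _ _
  ext x
  rw [key f x, key g x]
  refine Finset.sum_congr rfl fun w _ => ?_
  -- In the expansion with respect to the basis formed by `1` and the `RedGen`, `none` stands for
  -- the basis element `1`, and both maps kill every term that contains it.
  by_cases hw : ∃ i, w i = none
  · obtain ⟨i, hi⟩ := hw
    rw [hf _ ⟨i, by simp [hi, e]⟩, hg _ ⟨i, by simp [hi, e]⟩]
  · push Not at hw
    choose k hk using fun i => Option.ne_none_iff_exists'.1 (hw i)
    have : (fun i => e (w i)) = word k := by
      funext i
      simp [hk, e, word]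
    rw [this, h]

end Words

section Bar

variable (K : Type u) [Field K]

/-- The indices of the summands of the normalized bar resolution. -/
abbrev BarIdx (r : ℕ) : Type := Vertex × (Fin r → RedGen) × Vertex

/-- The carrier of the term of length `r` of the normalized bar resolution. -/
abbrev BarCarrier (r : ℕ) : Type u := BarIdx r → Matrix (Fin 3) (Fin 3) K

/-- The term `A ⊗ (A/K)^{⊗ r} ⊗ A` of the normalized bar resolution. -/
abbrev barBimod (r : ℕ) : GradedBimodule K :=
  projBimod K (fun j : BarIdx r => j.1) (fun j : BarIdx r => j.2.2)
    (fun j => ∑ i, (j.2.1 i).1.deg)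

/-- The left action on the bar resolution. -/
abbrev barL {r : ℕ} (a : A K) : BarCarrier K r →ₗ[K] BarCarrier K r :=
  projLact K (fun j : BarIdx r => j.1) a

/-- The right action on the bar resolution. -/
abbrev barR {r : ℕ} (a : A K) : BarCarrier K r →ₗ[K] BarCarrier K r :=
  projRact K (fun j : BarIdx r => j.2.2) (op a)

/-- The map `(a_1, …, a_r) ↦ 1 ⊗ a_1 ⊗ … ⊗ a_r ⊗ 1` to the bar resolution. -/
def barWord (r : ℕ) : MultilinearMap K (fun _ : Fin r => A K) (BarCarrier K r) :=
  ∑ j : BarIdx r, ((MultilinearMap.mkPiAlgebra K (Fin r) K).compLinearMap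
    fun i => redCoord (j.2.1 i).1).smulRight (generator K j)

variable {K}

theorem barWord_apply {r : ℕ} (a : Fin r → A K) :
    barWord K r a = ∑ j : BarIdx r, (∏ i, redCoord (j.2.1 i).1 (a i)) • generator K j := by
  simp [barWord]

theorem barWord_eq_zero {r : ℕ} (a : Fin r → A K) (h : ∃ i, a i = 1) : barWord K r a = 0 := by
  obtain ⟨i, hi⟩ := h
  rw [barWord_apply]
  refine Finset.sum_eq_zero fun j _ => ?_
  rw [Finset.prod_eq_zero (Finset.mem_univ i) (by rw [hi, redCoord_one]), zero_smul]

theorem barWord_mem {r : ℕ} {a : Fin r → A K} {d : Fin r → ℤ} (ha : ∀ i, a i ∈ piece K (d i)) :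
    barWord K r a ∈ (barBimod K r).grade (∑ i, d i) := by
  rw [barWord_apply]
  refine sum_mem fun j _ => ?_
  by_cases h : ∀ i, (j.2.1 i).1.deg = d i
  · simp only [← h]
    exact Submodule.smul_mem _ _ (generator_mem (δ := fun j : BarIdx r => ∑ i, (j.2.1 i).1.deg) j)
  · push Not at h
    obtain ⟨i, hi⟩ := h
    rw [Finset.prod_eq_zero (Finset.mem_univ i) (redCoord_eq_zero (ha i) hi), zero_smul]
    exact zero_mem _

/-- Both outer factors `1` split as the sum of the two vertex idempotents, whence one generator for
each pair of vertices. -/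
theorem barWord_word {r : ℕ} (w : Fin r → RedGen) :
    barWord K r (word w) = ∑ x : Vertex, ∑ y : Vertex, generator K (x, w, y) := by
  have h : ∀ w' : Fin r → RedGen, ∏ i, redCoord (w' i).1 (word w i : A K) =
      if w' = w then 1 else 0 := by
    intro w'
    simp only [word, redCoord_gen]
    by_cases hw : w' = w
    · simp [hw]
    · obtain ⟨i, hi⟩ := Function.ne_iff.1 hw
      rw [if_neg hw, Finset.prod_eq_zero (Finset.mem_univ i) (if_neg hi)]
  rw [barWord_apply, Fintype.sum_prod_type]
  refine Finset.sum_congr rfl fun x _ => ?_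
  rw [Fintype.sum_prod_type, Finset.sum_comm]
  refine Finset.sum_congr rfl fun y _ => ?_
  simp [h]

/-- The idempotent of a vertex. -/
abbrev idem (K : Type u) [Field K] (x : Vertex) : A K := gen (pathFrom x 0)

theorem idem_mul_idem (x y : Vertex) : idem K x * idem K y = if x = y then idem K x else 0 := by
  cases x <;> cases y <;> ext g <;> cases g <;> simp [idem, pathFrom, gen, A.mul_def, mulA]

theorem sum_idem : ∑ x, idem K x = 1 := by
  rw [Vertex.sum_univ]
  ext g; cases g <;> simp [idem, pathFrom, gen, A.one_def, oneA]

theorem sum_lact_idem (B : GradedBimodule K) (v : B.carrier) : ∑ x, B.lact (idem K x) v = v := by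
  rw [← LinearMap.sum_apply, ← map_sum, sum_idem, map_one, Module.End.one_apply]

theorem sum_ract_idem (B : GradedBimodule K) (v : B.carrier) :
    ∑ x, B.ract (op (idem K x)) v = v := by
  rw [Vertex.sum_univ, ← LinearMap.add_apply, ← map_add, ← op_add, ← Vertex.sum_univ (idem K),
    sum_idem, op_one, map_one, Module.End.one_apply]

theorem barL_barL {r : ℕ} (a b : A K) (X : BarCarrier K r) :
    barL K a (barL K b X) = barL K (a * b) X := by
  rw [barL, barL, barL, map_mul, Module.End.mul_apply]

theorem barR_barR {r : ℕ} (a b : A K) (X : BarCarrier K r) :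
    barR K a (barR K b X) = barR K (b * a) X := by
  rw [barR, barR, barR, op_mul, map_mul, Module.End.mul_apply]

theorem barL_barR {r : ℕ} (a b : A K) (X : BarCarrier K r) :
    barL K a (barR K b X) = barR K b (barL K a X) :=
  (barBimod K r).comm a (op b) X

theorem barL_one {r : ℕ} (X : BarCarrier K r) : barL K 1 X = X := by
  rw [barL, map_one, Module.End.one_apply]

theorem barR_one {r : ℕ} (X : BarCarrier K r) : barR K 1 X = X := by
  rw [barR, op_one, map_one, Module.End.one_apply]

/-- The outer idempotents recover each single generator, so the elements `1 ⊗ w ⊗ 1` generate the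
bar term and maps may be compared there. -/
theorem idem_barWord {r : ℕ} (x y : Vertex) (w : Fin r → RedGen) :
    barL K (idem K x) (barR K (idem K y) (barWord K r (word w))) = generator K (x, w, y) := by
  have h : ∀ x' y', barL K (idem K x) (barR K (idem K y) (generator K ((x', w, y') : BarIdx r))) =
      if x = x' then if y' = y then generator K ((x', w, y') : BarIdx r) else 0 else 0 := by
    intro x' y'
    have h' : barL K (idem K x') (barR K (idem K y') (generator K ((x', w, y') : BarIdx r))) = _ :=
      idem_generator (K := K) (x := fun j : BarIdx r => j.1) (y := fun j : BarIdx r => j.2.2)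
        (x', w, y')
    conv_lhs => rw [← h', ← barL_barR, barL_barL, barR_barR, idem_mul_idem, idem_mul_idem]
    have hL : ∀ X, barL K (r := r) 0 X = 0 := fun X => by rw [barL, map_zero]; rfl
    have hR : ∀ X, barR K (r := r) 0 X = 0 := fun X => by rw [barR, op_zero, map_zero]; rfl
    by_cases h1 : x = x'
    · subst h1
      by_cases h2 : y' = y
      · subst h2
        simp only [if_true, h']
      · simp only [if_neg h2, hR, map_zero, if_true]
    · simp only [if_neg h1, hL]
  rw [barWord_word]
  simp only [map_sum, h]
  simp

theorem bar_linearMap_ext {M : Type*} [AddCommGroup M] [Module K M] {r : ℕ}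
    {f g : BarCarrier K r →ₗ[K] M}
    (h : ∀ a b w, f (barL K a (barR K b (barWord K r (word w)))) =
      g (barL K a (barR K b (barWord K r (word w))))) : f = g := by
  refine projBimod_linearMap_ext (x := fun j : BarIdx r => j.1) (y := fun j : BarIdx r => j.2.2) ?_
  rintro ⟨x, w, y⟩ a b
  rw [← idem_barWord, ← barL_barR, barL_barL, barR_barR]
  exact h _ _ _

/-- The truncations by idempotents at the single generators add up to the untruncated value. Hence
bimodule maps can be prescribed freely on words. -/
theorem homOfGen_barWord (B : GradedBimodule K) {r : ℕ} (b : (Fin r → RedGen) → B.carrier)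
    (w : Fin r → RedGen) :
    homOfGen (fun j : BarIdx r => j.1) (fun j : BarIdx r => j.2.2) B (fun j => b j.2.1)
      (barWord K r (word w)) = b w := by
  rw [barWord_word]
  simp only [map_sum, homOfGen_generator]
  simp only [← map_sum, sum_ract_idem, sum_lact_idem]

end Bar

end TwoCycle

/-! ### Contraction, differential and exactness of the bar resolution -/

namespace TwoCycle

open MulOpposite GradedBimodule

section Bar

variable {K : Type u} [Field K]

/-- The contracting homotopy `a ⊗ m ↦ 1 ⊗ a ⊗ m` of the bar resolution. -/
def barHtpy (K : Type u) [Field K] (r : ℕ) : BarCarrier K r →ₗ[K] BarCarrier K (r + 1) :=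
  homRight (fun j : BarIdx r => j.1) (fun j : BarIdx r => j.2.2) (barBimod K (r + 1)) fun j =>
    { toFun := fun a => barWord K (r + 1) (Fin.cons a (word j.2.1))
      map_add' := fun a b => (barWord K (r + 1)).cons_add _ a b
      map_smul' := fun c a => (barWord K (r + 1)).cons_smul _ c a }

theorem barHtpy_barR {r : ℕ} (a : A K) (X : BarCarrier K r) :
    barHtpy K r (barR K a X) = barR K a (barHtpy K r X) :=
  homRight_ract (barBimod K (r + 1)) _ a X

/-- At a generator with left vertex `z`, the element `a` becomes `a e_z`, and the right vertex
contributes an idempotent on the right; summing over both vertices removes the idempotents. -/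
theorem barHtpy_barWord {r : ℕ} (a : A K) (x : Fin r → A K) :
    barHtpy K r (barL K a (barWord K r x)) = barWord K (r + 1) (Fin.cons a x) := by
  have : (barHtpy K r ∘ₗ barL K a).compMultilinearMap (barWord K r) =
      (barWord K (r + 1)).curryLeft a := by
    refine multilinear_ext_word (fun x hx => ?_) (fun x hx => ?_) fun w => ?_
    · rw [LinearMap.compMultilinearMap_apply, barWord_eq_zero _ hx, map_zero]
    · obtain ⟨i, hi⟩ := hx
      exact barWord_eq_zero _ ⟨i.succ, by simpa using hi⟩
    · have h : ∀ z y : Vertex, barHtpy K r (barL K a (generator K ((z, w, y) : BarIdx r))) =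
          barR K (idem K y) ((barWord K (r + 1)).curryLeft (a * idem K z) (word w)) := fun z y =>
        (homRight_lact (barBimod K (r + 1)) _ a _).trans
          (homRight_generator (barBimod K (r + 1)) _ _)
      have hR : ∀ X : BarCarrier K (r + 1), ∑ y, barR K (idem K y) X = X :=
        sum_ract_idem (barBimod K (r + 1))
      rw [LinearMap.compMultilinearMap_apply, LinearMap.comp_apply, barWord_word, map_sum, map_sum]
      calc _ = ∑ z, ∑ y, barR K (idem K y)
            ((barWord K (r + 1)).curryLeft (a * idem K z) (word w)) := by
            refine Finset.sum_congr rfl fun z _ => ?_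
            rw [map_sum, map_sum]
            exact Finset.sum_congr rfl fun y _ => h z y
        _ = ∑ z, (barWord K (r + 1)).curryLeft (a * idem K z) (word w) :=
            Finset.sum_congr rfl fun z _ => hR _
        _ = _ := by
            rw [← sum_apply, ← map_sum, ← Finset.mul_sum, sum_idem, mul_one]
  exact congrArg (fun f => f x) this

theorem barHtpy_mem {r : ℕ} {i : ℤ} {X : BarCarrier K r} (hX : X ∈ (barBimod K r).grade i) :
    barHtpy K r X ∈ (barBimod K (r + 1)).grade i := by
  refine homRight_mem (barBimod K (r + 1)) _ (fun j i a ha => ?_) i X hX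
  have := barWord_mem (K := K) (a := Fin.cons a (word j.2.1))
    (d := Fin.cons i fun k => (j.2.1 k).1.deg) (Fin.cases (by simpa using ha) fun k => by
      simpa [word] using gen_mem_piece K _)
  rwa [Fin.sum_univ_succ] at this

/-- The result has an inner factor `1`, which is zero in the normalized complex. -/
theorem barHtpy_barHtpy {r : ℕ} (X : BarCarrier K r) : barHtpy K (r + 1) (barHtpy K r X) = 0 := by
  have : barHtpy K (r + 1) ∘ₗ barHtpy K r = 0 := by
    refine bar_linearMap_ext fun a b w => ?_
    rw [LinearMap.comp_apply, barL_barR, barHtpy_barR, barHtpy_barR, barHtpy_barWord,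
      ← barL_one (barWord K (r + 1) _), barHtpy_barWord, barWord_eq_zero _ ⟨0, rfl⟩, map_zero]
    rfl
  exact LinearMap.congr_fun this X

/-- The contracting homotopy `a ↦ 1 ⊗ a` of the bar resolution. -/
def barUnit (K : Type u) [Field K] : A K →ₗ[K] BarCarrier K 0 where
  toFun a := barR K a (barWord K 0 ![])
  map_add' a b := by rw [barR, op_add, map_add]; rfl
  map_smul' c a := by rw [barR, op_smul, map_smul]; rfl

theorem barUnit_apply (a : A K) : barUnit K a = barR K a (barWord K 0 ![]) := rfl

/-- The augmentation of the bar resolution. -/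
def barAug (K : Type u) [Field K] : BarCarrier K 0 →ₗ[K] A K :=
  homOfGen (fun j : BarIdx 0 => j.1) (fun j : BarIdx 0 => j.2.2) (regular K) fun _ => (1 : A K)

theorem one_mem_piece : (1 : A K) ∈ piece K 0 := by
  intro g hg
  cases g <;> simp [Gen.deg, A.one_def, oneA] at hg ⊢

theorem barAug_mem : barAug K ∈ hom (barBimod K 0) (regular K) :=
  homOfGen_mem_hom _ fun _ => one_mem_piece

theorem barAug_barL (a : A K) (X : BarCarrier K 0) : barAug K (barL K a X) = a * barAug K X :=
  barAug_mem.1 a X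

theorem barAug_barR (a : A K) (X : BarCarrier K 0) : barAug K (barR K a X) = barAug K X * a :=
  barAug_mem.2.1 (op a) X

theorem barAug_barWord (x : Fin 0 → A K) : barAug K (barWord K 0 x) = 1 := by
  rw [Subsingleton.elim x (word ![])]
  exact homOfGen_barWord (regular K) (fun _ : Fin 0 → RedGen => (1 : A K)) ![]

theorem barAug_barUnit (a : A K) : barAug K (barUnit K a) = a := by
  rw [barUnit_apply, barAug_barR, barAug_barWord, one_mul]

/-- The bimodule homomorphism from the bar resolution that sends `a_0 ⊗ … ⊗ a_r` to the value of
`t` at `a_0 (a_1 ⊗ … ⊗ a_r)`. -/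
def barStep {r : ℕ} (t : BarCarrier K r →ₗ[K] BarCarrier K r) :
    BarCarrier K (r + 1) →ₗ[K] BarCarrier K r :=
  homOfGen (fun j : BarIdx (r + 1) => j.1) (fun j : BarIdx (r + 1) => j.2.2) (barBimod K r)
    fun j => t (barL K (gen (j.2.1 0).1) (barWord K r (word (Fin.tail j.2.1))))

theorem barStep_mem {r : ℕ} {t : BarCarrier K r →ₗ[K] BarCarrier K r}
    (ht : ∀ i, ∀ X ∈ (barBimod K r).grade i, t X ∈ (barBimod K r).grade i) :
    barStep t ∈ hom (barBimod K (r + 1)) (barBimod K r) := by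
  refine homOfGen_mem_hom (barBimod K r) fun j => ht _ _ ?_
  rw [Fin.sum_univ_succ]
  exact (barBimod K r).lact_mem (gen_mem_piece K _) (barWord_mem fun i => gen_mem_piece K _)

/-- On `a ⊗ w ⊗ 1` the equation holds by construction if `a` is a basis element other than `1`. For
`a = 1` the left side is zero by normalization, which is why `t` has to kill the words. -/
theorem barStep_barHtpy {r : ℕ} {t : BarCarrier K r →ₗ[K] BarCarrier K r}
    (ht : ∀ i, ∀ X ∈ (barBimod K r).grade i, t X ∈ (barBimod K r).grade i)
    (ht' : ∀ a X, t (barR K a X) = barR K a (t X))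
    (hw : ∀ w, t (barWord K r (word w)) = 0) (X : BarCarrier K r) :
    barStep t (barHtpy K r X) = t X := by
  have hR : ∀ a X, barStep t (barR K a X) = barR K a (barStep t X) :=
    fun a X => (barStep_mem ht).2.1 (op a) X
  have : barStep t ∘ₗ barHtpy K r = t := by
    refine bar_linearMap_ext fun a b w => ?_
    rw [LinearMap.comp_apply, barL_barR, barHtpy_barR, hR, ht', barHtpy_barWord]
    congr 1
    let f : A K →ₗ[K] BarCarrier K r := barStep t ∘ₗ
      { toFun := fun a => barWord K (r + 1) (Fin.cons a (word w))
        map_add' := fun a b => (barWord K (r + 1)).cons_add _ a b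
        map_smul' := fun c a => (barWord K (r + 1)).cons_smul _ c a }
    let g : A K →ₗ[K] BarCarrier K r := t ∘ₗ LinearMap.applyₗ (barWord K r (word w)) ∘ₗ
      (projLact K fun j : BarIdx r => j.1).toLinearMap
    have hfg : f = g := by
      refine A.linearMap_ext ?_ fun k => ?_
      · change barStep t (barWord K (r + 1) (Fin.cons 1 (word w))) = t (barL K 1 _)
        rw [barWord_eq_zero _ ⟨0, rfl⟩, map_zero, barL_one, hw]
      · have hk : (Fin.cons (gen k.1) (word w) : Fin (r + 1) → A K) = word (Fin.cons k w) := by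
          funext i
          refine Fin.cases ?_ (fun i => ?_) i <;> simp [word]
        change barStep t (barWord K (r + 1) (Fin.cons (gen k.1) (word w))) = t (barL K (gen k.1) _)
        rw [hk]
        exact homOfGen_barWord (barBimod K r) (fun w : Fin (r + 1) → RedGen =>
          t (barL K (gen (w 0).1) (barWord K r (word (Fin.tail w))))) (Fin.cons k w)
    exact LinearMap.congr_fun hfg a
  exact LinearMap.congr_fun this X

/-- The map `1 - s d`, where `s` is the contracting homotopy and `d` is the differential of the bar
resolution that starts at length `r`. -/
def barRem (K : Type u) [Field K] : ∀ r, BarCarrier K r →ₗ[K] BarCarrier K r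
  | 0 => LinearMap.id - barUnit K ∘ₗ barAug K
  | r + 1 => LinearMap.id - barHtpy K r ∘ₗ barStep (barRem K r)

/-- The differential of the bar resolution. -/
def barD (K : Type u) [Field K] (r : ℕ) : BarCarrier K (r + 1) →ₗ[K] BarCarrier K r :=
  barStep (barRem K r)

theorem barRem_zero_apply (X : BarCarrier K 0) : barRem K 0 X = X - barUnit K (barAug K X) := rfl

theorem barRem_succ_apply (r : ℕ) (X : BarCarrier K (r + 1)) :
    barRem K (r + 1) X = X - barHtpy K r (barD K r X) := rfl

theorem barUnit_mem {i : ℤ} {a : A K} (ha : a ∈ piece K i) :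
    barUnit K a ∈ (barBimod K 0).grade i := by
  have := (barBimod K 0).ract_mem ha (barWord_mem (K := K) (a := ![]) (d := ![]) fun i => i.elim0)
  rw [Finset.univ_eq_empty, Finset.sum_empty, zero_add] at this
  exact this

theorem barRem_mem (r : ℕ) :
    ∀ i, ∀ X ∈ (barBimod K r).grade i, barRem K r X ∈ (barBimod K r).grade i := by
  induction r with
  | zero => exact fun i X hX => sub_mem hX (barUnit_mem (barAug_mem.2.2 i X hX))
  | succ r ih => exact fun i X hX => sub_mem hX (barHtpy_mem ((barStep_mem ih).2.2 i X hX))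

theorem barD_mem (r : ℕ) : barD K r ∈ hom (barBimod K (r + 1)) (barBimod K r) :=
  barStep_mem (barRem_mem r)

theorem barD_barL {r : ℕ} (a : A K) (X : BarCarrier K (r + 1)) :
    barD K r (barL K a X) = barL K a (barD K r X) := (barD_mem r).1 a X

theorem barD_barR {r : ℕ} (a : A K) (X : BarCarrier K (r + 1)) :
    barD K r (barR K a X) = barR K a (barD K r X) := (barD_mem r).2.1 (op a) X

theorem barRem_barR {r : ℕ} (a : A K) (X : BarCarrier K r) :
    barRem K r (barR K a X) = barR K a (barRem K r X) := by
  cases r with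
  | zero =>
    rw [barRem_zero_apply, barRem_zero_apply, map_sub, barAug_barR, barUnit_apply, barUnit_apply,
      barR_barR]
  | succ r =>
    rw [barRem_succ_apply, barRem_succ_apply, map_sub, barD_barR, barHtpy_barR]

theorem barHtpy_barUnit (a : A K) : barHtpy K 0 (barUnit K a) = 0 := by
  rw [barUnit_apply, barHtpy_barR, ← barL_one (barWord K 0 _), barHtpy_barWord,
    barWord_eq_zero _ ⟨0, rfl⟩, map_zero]

/-- By definition `barRem` is the identity minus a map into the image of the previous contraction,
and two successive contractions compose to zero. -/
theorem barHtpy_barRem {r : ℕ} (X : BarCarrier K r) :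
    barHtpy K r (barRem K r X) = barHtpy K r X := by
  cases r with
  | zero => rw [barRem_zero_apply, map_sub, barHtpy_barUnit, sub_zero]
  | succ r => rw [barRem_succ_apply, map_sub, barHtpy_barHtpy, sub_zero]

theorem barWord_eq_barHtpy {r : ℕ} (x : Fin (r + 1) → A K) :
    barWord K (r + 1) x = barHtpy K r (barL K (x 0) (barWord K r (Fin.tail x))) := by
  rw [barHtpy_barWord, Fin.cons_self_tail]

/-- A word of positive length is itself in the image of the contraction `s`, and `(1 - s d) s = s -
s (1 - s d) = 0`. The identity `d s = 1 - s d` one length lower rests on the induction hypothesis.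
-/
theorem barRem_barWord {r : ℕ} (w : Fin r → RedGen) : barRem K r (barWord K r (word w)) = 0 := by
  induction r with
  | zero =>
    rw [barRem_zero_apply, barAug_barWord, barUnit_apply, barR_one, Subsingleton.elim (word w) ![],
      sub_self]
  | succ r ih =>
    rw [barRem_succ_apply, barWord_eq_barHtpy, barD,
      barStep_barHtpy (barRem_mem r) barRem_barR ih, barHtpy_barRem, sub_self]

/-- This is the homotopy identity `d s + s d = 1`, for which the recursive definition of the
differential is made. Exactness follows from it without the explicit formula for `d`. -/
theorem barD_barHtpy {r : ℕ} (X : BarCarrier K r) : barD K r (barHtpy K r X) = barRem K r X :=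
  barStep_barHtpy (barRem_mem r) barRem_barR barRem_barWord X

theorem barAug_comp_barD : barAug K ∘ₗ barD K 0 = 0 := by
  refine bar_linearMap_ext fun a b w => ?_
  rw [LinearMap.comp_apply, barD_barL, barD_barR, barWord_eq_barHtpy, barD_barHtpy, barAug_barL,
    barAug_barR, barRem_zero_apply, map_sub, barAug_barUnit, sub_self, zero_mul, mul_zero]
  rfl

theorem barD_comp_barD (r : ℕ) : barD K r ∘ₗ barD K (r + 1) = 0 := by
  -- Words lie in the image of `s`, so `d d s = 0` suffices. Here `d d s = d (1 - s d) = d - (1 - s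
  -- d) d = s d d`, which vanishes by the case of one length less; at the bottom the augmentation
  -- plays the part of `d`.
  have key : ∀ X, barD K r (barD K (r + 1) (barHtpy K (r + 1) X)) = 0 := by
    induction r with
    | zero =>
      intro X
      have h : barAug K (barD K 0 X) = 0 := LinearMap.congr_fun barAug_comp_barD X
      rw [barD_barHtpy, barRem_succ_apply, map_sub, barD_barHtpy, barRem_zero_apply, h, map_zero,
        sub_zero, sub_self]
    | succ r ih =>
      intro X
      have h : barD K r ∘ₗ barD K (r + 1) = 0 := by
        refine bar_linearMap_ext fun a b w => ?_
        rw [LinearMap.comp_apply, barD_barL, barD_barR, barWord_eq_barHtpy, barD_barL, barD_barR,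
          ih, map_zero, map_zero]
        rfl
      have hX : barD K r (barD K (r + 1) X) = 0 := LinearMap.congr_fun h X
      rw [barD_barHtpy, barRem_succ_apply, map_sub, barD_barHtpy, barRem_succ_apply, hX,
        map_zero, sub_zero, sub_self]
  refine bar_linearMap_ext fun a b w => ?_
  rw [LinearMap.comp_apply, barD_barL, barD_barR, barWord_eq_barHtpy, barD_barL, barD_barR,
    key, map_zero, map_zero]
  rfl

/-- The normalized bar resolution. -/
def barResolution (K : Type u) [Field K] : ProjectiveResolution K where
  X := barBimod K
  projective n := projBimod_isProjective
  d := barD K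
  d_mem := barD_mem
  ε := barAug K
  ε_mem := barAug_mem
  ε_surjective a := ⟨barUnit K a, barAug_barUnit a⟩
  exact_zero X := by
    refine ⟨fun hX => ⟨barHtpy K 0 X, ?_⟩, ?_⟩
    · have hX : barAug K X = 0 := hX
      rw [barD_barHtpy, barRem_zero_apply, hX, map_zero, sub_zero]
    · rintro ⟨Y, rfl⟩
      exact LinearMap.congr_fun barAug_comp_barD Y
  exact_succ n X := by
    refine ⟨fun hX => ⟨barHtpy K (n + 1) X, ?_⟩, ?_⟩
    · have hX : barD K n X = 0 := hX
      rw [barD_barHtpy, barRem_succ_apply, hX, map_zero, sub_zero]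
    · rintro ⟨Y, rfl⟩
      exact LinearMap.congr_fun (barD_comp_barD n) Y

theorem contractNth_zero_eq_cons {r : ℕ} (a : Fin (r + 2) → A K) :
    Fin.contractNth (0 : Fin (r + 1)).castSucc (· * ·) a =
      Fin.cons (a 0 * a 1) (Fin.tail (Fin.tail a)) := by
  funext i
  refine Fin.cases ?_ (fun i => ?_) i
  · rw [Fin.contractNth_apply_of_eq _ _ _ _ rfl]; rfl
  · rw [Fin.contractNth_apply_of_gt _ _ _ _ (by simp)]; rfl

theorem contractNth_succ_eq_cons {r : ℕ} (k : Fin r) (a : Fin (r + 2) → A K) :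
    Fin.contractNth k.succ.castSucc (· * ·) a =
      Fin.cons (a 0) (Fin.contractNth k.castSucc (· * ·) (Fin.tail a)) := by
  funext i
  refine Fin.cases ?_ (fun i => ?_) i
  · rw [Fin.contractNth_apply_of_lt _ _ _ _ (by simp)]; rfl
  · rw [Fin.cons_succ]
    rcases lt_trichotomy (i : ℕ) k with h | h | h
    · rw [Fin.contractNth_apply_of_lt _ _ _ _ (by simpa using h),
        Fin.contractNth_apply_of_lt _ _ _ _ (by simpa using h)]
      rfl
    · rw [Fin.contractNth_apply_of_eq _ _ _ _ (by simpa using h),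
        Fin.contractNth_apply_of_eq _ _ _ _ (by simpa using h)]
      rfl
    · rw [Fin.contractNth_apply_of_gt _ _ _ _ (by simpa using h),
        Fin.contractNth_apply_of_gt _ _ _ _ (by simpa using h)]
      rfl

/-- The usual formula for the differential of the bar resolution. -/
theorem barD_barWord {r : ℕ} (a : Fin (r + 1) → A K) :
    barD K r (barWord K (r + 1) a) = barL K (a 0) (barWord K r (Fin.tail a)) +
      ∑ i : Fin r, (-1 : K) ^ ((i : ℕ) + 1) • barWord K r (Fin.contractNth i.castSucc (· * ·) a) +
      (-1 : K) ^ (r + 1) • barR K (a (Fin.last r)) (barWord K r (Fin.init a)) := by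
  induction r with
  | zero =>
    rw [barWord_eq_barHtpy, barD_barHtpy, barRem_zero_apply, barAug_barL, barAug_barWord, mul_one,
      barUnit_apply, Subsingleton.elim (Fin.init a) ![]]
    simp [sub_eq_add_neg]
  | succ r ih =>
    have hinit : Fin.init a = (Fin.cons (a 0) (Fin.init (Fin.tail a)) : Fin (r + 1) → A K) := by
      funext i
      refine Fin.cases ?_ (fun i => ?_) i <;> rfl
    -- Now `d [a₀, …] = a₀ [a₁, …] - s (a₀ d [a₁, …])`. The first term of the inner formula yields
    -- the product `a₀ a₁`, and the others are shifted by one place with the opposite sign.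
    rw [barWord_eq_barHtpy, barD_barHtpy, barRem_succ_apply, barD_barL, ih, Fin.sum_univ_succ,
      contractNth_zero_eq_cons, hinit]
    simp only [contractNth_succ_eq_cons, map_add, map_sum, map_smul, barL_barL, barHtpy_barWord,
      barL_barR, barHtpy_barR]
    simp only [Fin.val_succ, Fin.val_zero, pow_succ _ (_ + 1), mul_neg, mul_one, neg_smul,
      Finset.sum_neg_distrib, zero_add, pow_one, one_smul]
    have h1 : Fin.tail a 0 = a 1 := rfl
    have h2 : Fin.tail a (Fin.last r) = a (Fin.last (r + 1)) := rfl
    rw [h1, h2]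
    abel

end Bar

end TwoCycle

/-! ### Hochschild cohomology as Ext -/

namespace TwoCycle

open MulOpposite GradedBimodule

section HochschildExt

variable {K : Type u} [Field K]

/-- The graded bimodule `A[s]`. -/
abbrev shiftA (K : Type u) [Field K] (s : ℤ) : GradedBimodule K := (regular K).shift s

theorem bar_hom_ext {B : GradedBimodule K} {r : ℕ} {f g : BarCarrier K r →ₗ[K] B.carrier}
    (hf : f ∈ hom (barBimod K r) B) (hg : g ∈ hom (barBimod K r) B)
    (h : ∀ w, f (barWord K r (word w)) = g (barWord K r (word w))) : f = g := by
  refine bar_linearMap_ext fun a b w => ?_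
  have hf1 : ∀ a X, f (barL K a X) = B.lact a (f X) := hf.1
  have hf2 : ∀ a X, f (barR K a X) = B.ract (op a) (f X) := fun a => hf.2.1 (op a)
  have hg1 : ∀ a X, g (barL K a X) = B.lact a (g X) := hg.1
  have hg2 : ∀ a X, g (barR K a X) = B.ract (op a) (g X) := fun a => hg.2.1 (op a)
  rw [hf1, hf2, hg1, hg2, h]

/-- The Hochschild cochain given by a map from the bar resolution. -/
def toCochain (K : Type u) [Field K] (r : ℕ) :
    (BarCarrier K r →ₗ[K] A K) →ₗ[K] MultilinearMap K (fun _ : Fin r => A K) (A K) where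
  toFun f := f.compMultilinearMap (barWord K r)
  map_add' _ _ := rfl
  map_smul' _ _ := rfl

theorem toCochain_apply {r : ℕ} (f : BarCarrier K r →ₗ[K] A K) (x : Fin r → A K) :
    toCochain K r f x = f (barWord K r x) := rfl

/-- The map from the bar resolution given by a Hochschild cochain. -/
def ofCochain (K : Type u) [Field K] (r : ℕ) (s : ℤ) :
    MultilinearMap K (fun _ : Fin r => A K) (A K) →ₗ[K] (BarCarrier K r →ₗ[K] A K) :=
  homOfGen (fun j : BarIdx r => j.1) (fun j : BarIdx r => j.2.2) (shiftA K s) ∘ₗ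
    { toFun := fun c j => c (word j.2.1)
      map_add' := fun _ _ => rfl
      map_smul' := fun _ _ => rfl }

variable {r : ℕ} {s : ℤ}

theorem toCochain_mem {f : BarCarrier K r →ₗ[K] A K} (hf : f ∈ hom (barBimod K r) (shiftA K s)) :
    toCochain K r f ∈ cochains K r s :=
  ⟨fun _ _ hx => hf.2.2 _ _ (barWord_mem hx), fun x hx => by
    rw [toCochain_apply, barWord_eq_zero x hx, map_zero]⟩

theorem ofCochain_mem {c : MultilinearMap K (fun _ : Fin r => A K) (A K)}
    (hc : c ∈ cochains K r s) : ofCochain K r s c ∈ hom (barBimod K r) (shiftA K s) :=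
  homOfGen_mem_hom (shiftA K s) fun _ => hc.1 _ _ fun _ => gen_mem_piece K _

theorem ofCochain_barWord (c : MultilinearMap K (fun _ : Fin r => A K) (A K)) (w : Fin r → RedGen) :
    ofCochain K r s c (barWord K r (word w)) = c (word w) :=
  homOfGen_barWord (shiftA K s) (fun w => c (word w)) w

theorem toCochain_ofCochain {c : MultilinearMap K (fun _ : Fin r => A K) (A K)}
    (hc : c ∈ cochains K r s) : toCochain K r (ofCochain K r s c) = c :=
  multilinear_ext_word (toCochain_mem (ofCochain_mem hc)).2 hc.2 fun w => ofCochain_barWord c w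

theorem ofCochain_toCochain {f : BarCarrier K r →ₗ[K] A K}
    (hf : f ∈ hom (barBimod K r) (shiftA K s)) : ofCochain K r s (toCochain K r f) = f :=
  bar_hom_ext (ofCochain_mem (toCochain_mem hf)) hf fun w => ofCochain_barWord _ w

/-- This is the bar formula transported by `f`. The twist in the first term of `delta` is the left
action on the shifted bimodule. -/
theorem delta_toCochain {f : BarCarrier K r →ₗ[K] A K}
    (hf : f ∈ hom (barBimod K r) (shiftA K s)) :
    delta K r s (toCochain K r f) = toCochain K (r + 1) (f ∘ₗ barD K r) := by
  have hL : ∀ a X, f (barL K a X) = twist K s a * f X := hf.1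
  have hR : ∀ a X, f (barR K a X) = f X * a := fun a => hf.2.1 (op a)
  ext1 a
  change _ = f (barD K r (barWord K (r + 1) a))
  rw [delta_apply, toCochain_apply, barD_barWord, map_add, map_add, map_sum,
    map_smul, hL, hR]
  simp only [map_smul]
  rfl

/-- Hochschild cohomology is computed by the bar resolution. -/
theorem nonempty_HH_equiv_ext_bar (r : ℕ) (s : ℤ) :
    Nonempty (HH K r s ≃ₗ[K] (barResolution K).Ext (shiftA K s) r) := by
  refine nonempty_subquotient_equiv_of_inverse (W := BarCarrier K r →ₗ[K] A K)
    (ofCochain K r s) (toCochain K r) ?_ ?_ ?_ ?_ ?_ ?_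
  · rintro c ⟨hc, hc'⟩
    have h : toCochain K (r + 1) (ofCochain K r s c ∘ₗ barD K r) = 0 := by
      rw [← delta_toCochain (ofCochain_mem hc), toCochain_ofCochain hc]
      exact hc'
    have hmem := comp_mem_hom (ofCochain_mem hc) (barD_mem (K := K) r)
    refine ⟨ofCochain_mem hc, ?_⟩
    change ofCochain K r s c ∘ₗ barD K r = 0
    refine (ofCochain_toCochain hmem).symm.trans ?_
    refine (congrArg (ofCochain K (r + 1) s) h).trans ?_
    exact map_zero _
  · cases r with
    | zero =>
      rintro b (rfl : b = 0)
      exact map_zero (ofCochain K 0 s)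
    | succ r =>
      rintro _ ⟨c, hc, rfl⟩
      refine ⟨ofCochain K r s c, ofCochain_mem hc, ?_⟩
      change ofCochain K r s c ∘ₗ barD K r = _
      have hmem := comp_mem_hom (ofCochain_mem hc) (barD_mem (K := K) r)
      refine (ofCochain_toCochain hmem).symm.trans (congrArg (ofCochain K (r + 1) s) ?_)
      refine (delta_toCochain (ofCochain_mem hc)).symm.trans ?_
      rw [toCochain_ofCochain hc]
  · rintro f ⟨hf, hf'⟩
    refine ⟨toCochain_mem hf, ?_⟩
    have hf' : f ∘ₗ barD K r = 0 := hf'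
    exact (delta_toCochain hf).trans ((congrArg (toCochain K (r + 1)) hf').trans (map_zero _))
  · cases r with
    | zero =>
      rintro b (rfl : b = 0)
      exact map_zero (toCochain K 0)
    | succ r =>
      rintro _ ⟨f, hf, rfl⟩
      exact ⟨toCochain K r f, toCochain_mem hf, delta_toCochain hf⟩
  · rintro c ⟨hc, -⟩
    exact toCochain_ofCochain hc
  · rintro f ⟨hf, -⟩
    exact ofCochain_toCochain hf

/-- Hochschild cohomology is the graded `Ext` of bimodules. -/
theorem nonempty_HH_equiv_ext (P : ProjectiveResolution K) (r : ℕ) (s : ℤ) :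
    Nonempty (HH K r s ≃ₗ[K] P.Ext (shiftA K s) r) := by
  obtain ⟨e⟩ := nonempty_HH_equiv_ext_bar (K := K) r s
  obtain ⟨e'⟩ := (barResolution K).nonempty_ext_equiv P (shiftA K s) r
  exact ⟨e.trans e'⟩

end HochschildExt

end TwoCycle

/-! ### The minimal resolution -/

namespace TwoCycle

open MulOpposite GradedBimodule

/-- The end of the path of length `L` that starts at `j`. -/
def endVertex (L : ℕ) (j : Vertex) : Vertex := if Even L then j else j.swap

/-- The degree of the path of length `L` that starts at `j`. -/
def pathDegree (L : ℕ) : Vertex → ℤ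
  | .a => ((L + 1) / 2 : ℕ)
  | .b => (L / 2 : ℕ)

/-- The arrow that starts at a vertex. -/
def arrowFrom : Vertex → Gen
  | .a => .u
  | .b => .v

theorem endVertex_succ (L : ℕ) (j : Vertex) : endVertex (L + 1) j = (endVertex L j).swap := by
  by_cases h : Even L <;> simp [endVertex, Nat.even_add_one, h]

theorem endVertex_swap (L : ℕ) (j : Vertex) : endVertex L j.swap = (endVertex L j).swap := by
  by_cases h : Even L <;> simp [endVertex, h]

theorem pathDegree_zero (j : Vertex) : pathDegree 0 j = 0 := by cases j <;> rfl

/-- The last arrow is split off here; `pathDegree_succ_right` splits off the first one. They are the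
degree bookkeeping for `shiftLeft` and `shiftRight`. -/
theorem pathDegree_succ_left (L : ℕ) (j : Vertex) :
    pathDegree (L + 1) j = pathDegree L j + (arrowFrom (endVertex L j)).deg := by
  by_cases h : Even L
  · obtain ⟨k, rfl⟩ := h
    cases j <;> simp [endVertex, arrowFrom, Gen.deg, pathDegree] <;> omega
  · obtain ⟨k, rfl⟩ := Nat.not_even_iff_odd.1 h
    cases j <;> simp [endVertex, arrowFrom, Gen.deg, pathDegree, Vertex.swap] <;> omega

theorem pathDegree_succ_right (L : ℕ) (j : Vertex) :
    pathDegree (L + 1) j = pathDegree L j.swap + (arrowFrom j).deg := by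
  cases j <;> simp [arrowFrom, Gen.deg, pathDegree, Vertex.swap]
  omega

theorem pathFrom_deg (x : Vertex) (n : Fin 2) :
    (pathFrom x n.succ).deg = (pathFrom x.swap n.castSucc).deg + (arrowFrom x).deg := by
  cases x <;> fin_cases n <;> rfl

theorem pathTo_deg (x : Vertex) (n : Fin 2) :
    (pathTo x n.succ).deg = (pathTo x.swap n.castSucc).deg + (arrowFrom x.swap).deg := by
  cases x <;> fin_cases n <;> rfl

section Shifts

variable (K : Type u) [Field K]

/-- The carrier of the terms of the minimal resolution. -/
abbrev MinCarrier : Type u := Vertex → Matrix (Fin 3) (Fin 3) K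

/-- The graded bimodule generated by the paths of length `L`, which is a term of the minimal
resolution if `L` is of the form `3 k` or `3 k + 1`. -/
abbrev minBimod (L : ℕ) : GradedBimodule K := projBimod K (endVertex L) id (pathDegree L)

/-- The nilpotent lower shift. -/
def lowerShift : Matrix (Fin 3) (Fin 3) K := !![0, 0, 0; 1, 0, 0; 0, 1, 0]

/-- The nilpotent upper shift. -/
def upperShift : Matrix (Fin 3) (Fin 3) K := !![0, 1, 0; 0, 0, 1; 0, 0, 0]

/-- The corner matrix unit. -/
def corner : Matrix (Fin 3) (Fin 3) K := !![0, 0, 1; 0, 0, 0; 0, 0, 0]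

variable {K}

theorem lowerShift_mul_zero (X : Matrix (Fin 3) (Fin 3) K) (m : Fin 3) :
    (lowerShift K * X) 0 m = 0 := by
  simp [lowerShift, Matrix.mul_apply, Fin.sum_univ_three]

theorem lowerShift_mul_succ (X : Matrix (Fin 3) (Fin 3) K) (n : Fin 2) (m : Fin 3) :
    (lowerShift K * X) n.succ m = X n.castSucc m := by
  fin_cases n <;> simp [lowerShift, Matrix.mul_apply, Fin.sum_univ_three]

theorem mul_upperShift_zero (X : Matrix (Fin 3) (Fin 3) K) (n : Fin 3) :
    (X * upperShift K) n 0 = 0 := by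
  simp [upperShift, Matrix.mul_apply, Fin.sum_univ_three]

theorem mul_upperShift_succ (X : Matrix (Fin 3) (Fin 3) K) (n : Fin 3) (m : Fin 2) :
    (X * upperShift K) n m.succ = X n m.castSucc := by
  fin_cases m <;> simp [upperShift, Matrix.mul_apply, Fin.sum_univ_three]

/-- The lower shift is the map `p ↦ p x` from paths starting at the other vertex to paths starting
at `x`, with `x` also denoting the arrow; such right multiplications commute with left ones. -/
theorem lowerShift_mul_leftMat (x : Vertex) (a : A K) :
    lowerShift K * leftMat x.swap a = leftMat x a * lowerShift K := by
  cases x <;>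
    simp only [lowerShift, leftMat_apply, leftMatFun, Vertex.swap, Matrix.mul_fin_three] <;>
    simp

theorem rightMat_mul_upperShift (x : Vertex) (a : A K) :
    rightMat x.swap a * upperShift K = upperShift K * rightMat x a := by
  cases x <;>
    simp only [upperShift, rightMat_apply, rightMatFun, Vertex.swap, Matrix.mul_fin_three] <;>
    simp

variable (K)

/-- Prolongation of the left factor: `p ⊗ ρ x ⊗ q ↦ p x ⊗ ρ ⊗ q`. -/
def shiftLeft : Module.End K (MinCarrier K) :=
  LinearMap.pi fun j => LinearMap.mulLeft K (lowerShift K) ∘ₗ LinearMap.proj j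

/-- Prolongation of the right factor. -/
def shiftRight : Module.End K (MinCarrier K) :=
  LinearMap.pi fun j => LinearMap.mulRight K (upperShift K) ∘ₗ LinearMap.proj j.swap

variable {K}

theorem shiftLeft_apply (X : MinCarrier K) (j : Vertex) :
    shiftLeft K X j = lowerShift K * X j := rfl

theorem shiftRight_apply (X : MinCarrier K) (j : Vertex) :
    shiftRight K X j = X j.swap * upperShift K := rfl

theorem shiftLeft_mem (L : ℕ) : shiftLeft K ∈ hom (minBimod K (L + 1)) (minBimod K L) := by
  refine ⟨fun a X => funext fun j => ?_, fun a X => funext fun j => ?_, fun i X hX j n m h => ?_⟩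
  · rw [shiftLeft_apply, projLact_apply, projLact_apply, shiftLeft_apply, endVertex_succ,
      ← mul_assoc, lowerShift_mul_leftMat, mul_assoc]
  · obtain ⟨a⟩ := a
    change lowerShift K * (X j * rightMat j a) = lowerShift K * X j * rightMat j a
    rw [mul_assoc]
  · rw [shiftLeft_apply]
    refine Fin.cases (fun _ => lowerShift_mul_zero _ _) (fun n h => ?_) n h
    rw [lowerShift_mul_succ]
    refine hX j _ m fun h' => h ?_
    rw [← h', entryDeg, entryDeg, pathDegree_succ_left, endVertex_succ, pathFrom_deg]
    ring

theorem shiftRight_mem (L : ℕ) : shiftRight K ∈ hom (minBimod K (L + 1)) (minBimod K L) := by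
  refine ⟨fun a X => funext fun j => ?_, fun a X => funext fun j => ?_, fun i X hX j n m h => ?_⟩
  · rw [shiftRight_apply, projLact_apply, projLact_apply, shiftRight_apply, endVertex_succ,
      endVertex_swap, Vertex.swap_swap, mul_assoc]
  · obtain ⟨a⟩ := a
    change X j.swap * rightMat j.swap a * upperShift K = X j.swap * upperShift K * rightMat j a
    rw [mul_assoc, rightMat_mul_upperShift, mul_assoc]
  · rw [shiftRight_apply]
    refine Fin.cases (fun _ => mul_upperShift_zero _ _) (fun m h => ?_) m h
    rw [mul_upperShift_succ]
    refine hX j.swap n _ fun h' => h ?_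
    rw [← h', entryDeg, entryDeg, pathDegree_succ_right, endVertex_succ, endVertex_swap,
      Vertex.swap_swap, Vertex.swap_swap, id, id, pathTo_deg]
    ring

variable (K)

/-- The differential from the paths of length `3 k + 1` to the paths of length `3 k`. -/
def minD₁ : Module.End K (MinCarrier K) := shiftLeft K - shiftRight K

/-- The differential from the paths of length `3 k + 3` to the paths of length `3 k + 1`. -/
def minD₂ : Module.End K (MinCarrier K) :=
  shiftLeft K * shiftLeft K + shiftLeft K * shiftRight K + shiftRight K * shiftRight K

/-- The map that removes an arrow from the left factor. -/
def unshiftLeft : Module.End K (MinCarrier K) :=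
  LinearMap.pi fun j => LinearMap.mulLeft K (upperShift K) ∘ₗ LinearMap.proj j

/-- The map that removes two arrows from the left factor. -/
def unshiftLeftTwo : Module.End K (MinCarrier K) :=
  LinearMap.pi fun j => LinearMap.mulLeft K (corner K) ∘ₗ LinearMap.proj j

variable {K}

theorem unshiftLeft_apply (X : MinCarrier K) (j : Vertex) :
    unshiftLeft K X j = upperShift K * X j := rfl

theorem unshiftLeftTwo_apply (X : MinCarrier K) (j : Vertex) :
    unshiftLeftTwo K X j = corner K * X j := rfl

theorem shiftRight_mul_shiftLeft :
    shiftRight K * shiftLeft K = shiftLeft K * shiftRight K :=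
  LinearMap.ext fun X => funext fun j => by
    simp only [Module.End.mul_apply, shiftLeft_apply, shiftRight_apply, mul_assoc]

theorem shiftRight_mul_unshiftLeft :
    shiftRight K * unshiftLeft K = unshiftLeft K * shiftRight K :=
  LinearMap.ext fun X => funext fun j => by
    simp only [Module.End.mul_apply, unshiftLeft_apply, shiftRight_apply, mul_assoc]

theorem shiftRight_mul_unshiftLeftTwo :
    shiftRight K * unshiftLeftTwo K = unshiftLeftTwo K * shiftRight K :=
  LinearMap.ext fun X => funext fun j => by
    simp only [Module.End.mul_apply, unshiftLeftTwo_apply, shiftRight_apply, mul_assoc]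

/-- With `l`, `p`, `q` for `shiftLeft`, `unshiftLeft`, `unshiftLeftTwo`, this and the next lemma
contract the periodic complex with differentials `l` and `l²`, that is, the case `r = 0`. The third
relation `l q + q l = p` is needed to perturb the contraction to general `r`. -/
theorem shiftLeft_unshiftLeft_add :
    shiftLeft K * unshiftLeft K + unshiftLeftTwo K * shiftLeft K * shiftLeft K = 1 := by
  have h : lowerShift K * upperShift K + corner K * lowerShift K * lowerShift K = 1 := by
    simp only [lowerShift, upperShift, corner, Matrix.mul_fin_three, Matrix.one_fin_three]
    simp
  refine LinearMap.ext fun X => funext fun j => ?_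
  simp only [Module.End.mul_apply, LinearMap.add_apply, Pi.add_apply, shiftLeft_apply,
    unshiftLeft_apply, unshiftLeftTwo_apply, ← mul_assoc, ← add_mul, h, one_mul,
    Module.End.one_apply]

theorem unshiftLeft_shiftLeft_add :
    shiftLeft K * shiftLeft K * unshiftLeftTwo K + unshiftLeft K * shiftLeft K = 1 := by
  have h : lowerShift K * lowerShift K * corner K + upperShift K * lowerShift K = 1 := by
    simp only [lowerShift, upperShift, corner, Matrix.mul_fin_three, Matrix.one_fin_three]
    simp
  refine LinearMap.ext fun X => funext fun j => ?_
  simp only [Module.End.mul_apply, LinearMap.add_apply, Pi.add_apply, shiftLeft_apply,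
    unshiftLeft_apply, unshiftLeftTwo_apply, ← mul_assoc, ← add_mul, h, one_mul,
    Module.End.one_apply]

theorem shiftLeft_unshiftLeftTwo_add :
    shiftLeft K * unshiftLeftTwo K + unshiftLeftTwo K * shiftLeft K = unshiftLeft K := by
  have h : lowerShift K * corner K + corner K * lowerShift K = upperShift K := by
    simp only [lowerShift, upperShift, corner, Matrix.mul_fin_three]
    simp
  refine LinearMap.ext fun X => funext fun j => ?_
  simp only [Module.End.mul_apply, LinearMap.add_apply, Pi.add_apply, shiftLeft_apply,
    unshiftLeft_apply, unshiftLeftTwo_apply, ← mul_assoc, ← add_mul, h]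

theorem shiftLeft_cube : shiftLeft K * shiftLeft K * shiftLeft K = 0 := by
  have h : lowerShift K * lowerShift K * lowerShift K = 0 := by
    simp only [lowerShift, Matrix.mul_fin_three]
    ext i j
    fin_cases i <;> fin_cases j <;> simp
  refine LinearMap.ext fun X => funext fun j => ?_
  simp only [Module.End.mul_apply, shiftLeft_apply, ← mul_assoc, h, zero_mul]
  rfl

theorem shiftRight_cube : shiftRight K * shiftRight K * shiftRight K = 0 := by
  have h : upperShift K * (upperShift K * upperShift K) = 0 := by
    simp only [upperShift, Matrix.mul_fin_three]
    ext i j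
    fin_cases i <;> fin_cases j <;> simp
  refine LinearMap.ext fun X => funext fun j => ?_
  simp only [Module.End.mul_apply, shiftRight_apply, mul_assoc, h, mul_zero]
  rfl

/-- The product is `l³ - r³`, as `l` and `r` commute. -/
theorem minD₁_mul_minD₂ : minD₁ K * minD₂ K = 0 := by
  have h : ∀ {R : Type u} [Ring R] {l r : R}, r * l = l * r → l * l * l = 0 → r * r * r = 0 →
      (l - r) * (l * l + l * r + r * r) = 0 := by
    intro R _ l r h₁ h₂ h₃
    -- The ring is not commutative: the multiples of `h₁` on either side reorder the mixed words in
    -- `l` and `r`.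
    linear_combination (norm := noncomm_ring) h₂ - h₃ - h₁ * l - l * h₁ - h₁ * r
  exact h shiftRight_mul_shiftLeft shiftLeft_cube shiftRight_cube

theorem minD₂_mul_minD₁ : minD₂ K * minD₁ K = 0 := by
  have h : ∀ {R : Type u} [Ring R] {l r : R}, r * l = l * r → l * l * l = 0 → r * r * r = 0 →
      (l * l + l * r + r * r) * (l - r) = 0 := by
    intro R _ l r h₁ h₂ h₃
    linear_combination (norm := noncomm_ring) h₂ - h₃ + l * h₁ + r * h₁ + h₁ * r
  exact h shiftRight_mul_shiftLeft shiftLeft_cube shiftRight_cube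

/-- The homotopy `p` for `r = 0` is corrected to `p + q r`. The terms with one `r` then add up to
`(l q + q l) r - r p = 0`, and those with two cancel because `r` commutes with `q`. -/
theorem minD₁_homotopy :
    minD₁ K * (unshiftLeft K + unshiftLeftTwo K * shiftRight K) +
      unshiftLeftTwo K * minD₂ K = 1 := by
  have h : ∀ {R : Type u} [Ring R] {l r p q : R}, r * p = p * r → r * q = q * r →
      l * p + q * l * l = 1 → l * q + q * l = p →
      (l - r) * (p + q * r) + q * (l * l + l * r + r * r) = 1 := by
    intro R _ l r p q h₁ h₂ h₃ h₄
    linear_combination (norm := noncomm_ring) h₃ + h₄ * r - h₁ - h₂ * r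
  exact h shiftRight_mul_unshiftLeft shiftRight_mul_unshiftLeftTwo shiftLeft_unshiftLeft_add
    shiftLeft_unshiftLeftTwo_add

theorem minD₂_homotopy :
    minD₂ K * unshiftLeftTwo K +
      (unshiftLeft K + unshiftLeftTwo K * shiftRight K) * minD₁ K = 1 := by
  have h : ∀ {R : Type u} [Ring R] {l r p q : R}, r * l = l * r → r * q = q * r →
      l * l * q + p * l = 1 → l * q + q * l = p →
      (l * l + l * r + r * r) * q + (p + q * r) * (l - r) = 1 := by
    intro R _ l r p q h₁ h₂ h₃ h₄
    linear_combination (norm := noncomm_ring) h₃ + h₄ * r + l * h₂ + r * h₂ + h₂ * r + q * h₁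
  exact h shiftRight_mul_shiftLeft shiftRight_mul_unshiftLeftTwo unshiftLeft_shiftLeft_add
    shiftLeft_unshiftLeftTwo_add

variable (K)

/-- The augmentation of the minimal resolution. -/
def minAug : MinCarrier K →ₗ[K] A K :=
  homOfGen (endVertex 0) id (regular K) fun j => idem K j

variable {K}

theorem minAug_mem : minAug K ∈ hom (minBimod K 0) (regular K) :=
  homOfGen_mem_hom (regular K) fun j => by
    have := gen_mem_piece K (pathFrom j 0)
    rwa [pathFrom_zero_deg, ← pathDegree_zero j] at this

theorem minAug_apply (X : MinCarrier K) : minAug K X = ∑ j, ∑ n, ∑ m,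
    X j n m • (gen (pathFrom j n) * idem K j * gen (pathTo j m)) := rfl

theorem minD₂_apply (X : MinCarrier K) (j : Vertex) :
    minD₂ K X j = lowerShift K * (lowerShift K * X j) + lowerShift K * (X j.swap * upperShift K) +
      X j * upperShift K * upperShift K := by
  change _ + _ + X j.swap.swap * upperShift K * upperShift K = _
  rw [Vertex.swap_swap]
  rfl

theorem minD₂_apply_two (X : MinCarrier K) (j : Vertex) (m : Fin 3) :
    minD₂ K X j 2 m = X j 0 m + (X j.swap * upperShift K) 1 m +
      (X j * upperShift K * upperShift K) 2 m := by
  have h₁ : ∀ Y : Matrix (Fin 3) (Fin 3) K, (lowerShift K * Y) 2 m = Y 1 m :=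
    fun Y => lowerShift_mul_succ Y 1 m
  have h₂ : ∀ Y : Matrix (Fin 3) (Fin 3) K, (lowerShift K * Y) 1 m = Y 0 m :=
    fun Y => lowerShift_mul_succ Y 0 m
  rw [minD₂_apply, Matrix.add_apply, Matrix.add_apply, h₁, h₁, h₂]

theorem mul_upperShift_one (X : Matrix (Fin 3) (Fin 3) K) (n : Fin 3) :
    (X * upperShift K) n 1 = X n 0 := mul_upperShift_succ X n 0

theorem mul_upperShift_two (X : Matrix (Fin 3) (Fin 3) K) (n : Fin 3) :
    (X * upperShift K) n 2 = X n 1 := mul_upperShift_succ X n 1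

theorem minD₂_apply_two_zero (X : MinCarrier K) (j : Vertex) : minD₂ K X j 2 0 = X j 0 0 := by
  simp only [minD₂_apply_two, mul_upperShift_zero, add_zero]

theorem minD₂_apply_two_one (X : MinCarrier K) (j : Vertex) :
    minD₂ K X j 2 1 = X j 0 1 + X j.swap 1 0 := by
  simp only [minD₂_apply_two, mul_upperShift_zero, mul_upperShift_one, add_zero]

theorem minD₂_apply_two_two (X : MinCarrier K) (j : Vertex) :
    minD₂ K X j 2 2 = X j 0 2 + X j.swap 1 1 + X j 2 0 := by
  simp only [minD₂_apply_two, mul_upperShift_one, mul_upperShift_two]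

/-- A path of length `m` ending at `j` arises from the factorizations with left factor of length 0,
1 or 2, which are the three terms in the bottom row of `l² + lr + r²`. So the augmentation is a
truncation of `minD₂`, and both the complex property and exactness at the end are inherited from the
periodic part. -/
theorem minAug_apply_pathTo (X : MinCarrier K) (j : Vertex) (m : Fin 3) :
    minAug K X (pathTo j m) = minD₂ K X j 2 m := by
  rw [minAug_apply]
  simp only [Vertex.sum_univ, Fin.sum_univ_three, A.add_apply, A.smul_apply, A.mul_def, mulA]
  cases j <;> fin_cases m <;>
    simp [minD₂_apply_two_zero, minD₂_apply_two_one, minD₂_apply_two_two, pathTo, pathFrom, idem,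
      gen, Vertex.swap] <;> ring

theorem exists_eq_pathTo (g : Gen) : ∃ j m, g = pathTo j m := by
  cases g
  exacts [⟨.a, 0, rfl⟩, ⟨.b, 0, rfl⟩, ⟨.b, 1, rfl⟩, ⟨.a, 1, rfl⟩, ⟨.a, 2, rfl⟩, ⟨.b, 2, rfl⟩]

theorem corner_mul (X : Matrix (Fin 3) (Fin 3) K) (h : ∀ m, X 2 m = 0) : corner K * X = 0 := by
  ext n m
  fin_cases n <;> simp [corner, Matrix.mul_apply, Fin.sum_univ_three, h]

theorem minAug_comp_minD₁ (X : MinCarrier K) : minAug K (minD₁ K X) = 0 := by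
  ext g
  obtain ⟨j, m, rfl⟩ := exists_eq_pathTo g
  have : minD₂ K (minD₁ K X) = 0 := LinearMap.congr_fun minD₂_mul_minD₁ X
  rw [minAug_apply_pathTo, this]
  rfl

theorem minAug_exact : Function.Exact (minD₁ K) (minAug K) := by
  intro X
  refine ⟨fun hX => ⟨(unshiftLeft K + unshiftLeftTwo K * shiftRight K) X, ?_⟩, ?_⟩
  · have h := LinearMap.congr_fun (minD₁_homotopy (K := K)) X
    -- The corner matrix sees only the bottom row of `minD₂ K X`, which is the augmentation.
    have h0 : unshiftLeftTwo K (minD₂ K X) = 0 := by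
      funext j
      refine corner_mul _ fun m => ?_
      change minD₂ K X j 2 m = 0
      rw [← minAug_apply_pathTo, hX]
      rfl
    rwa [LinearMap.add_apply, Module.End.mul_apply, Module.End.mul_apply, h0, add_zero] at h
  · rintro ⟨Y, rfl⟩
    exact minAug_comp_minD₁ Y

theorem minD_exact_one_two : Function.Exact (minD₂ K) (minD₁ K) := by
  intro X
  refine ⟨fun hX => ⟨unshiftLeftTwo K X, ?_⟩, ?_⟩
  · have h := LinearMap.congr_fun (minD₂_homotopy (K := K)) X
    rwa [LinearMap.add_apply, Module.End.mul_apply, Module.End.mul_apply, hX, map_zero,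
      add_zero] at h
  · rintro ⟨Y, rfl⟩
    exact LinearMap.congr_fun minD₁_mul_minD₂ Y

theorem minD_exact_two_one : Function.Exact (minD₁ K) (minD₂ K) := by
  intro X
  refine ⟨fun hX => ⟨(unshiftLeft K + unshiftLeftTwo K * shiftRight K) X, ?_⟩, ?_⟩
  · have h := LinearMap.congr_fun (minD₁_homotopy (K := K)) X
    rwa [LinearMap.add_apply, Module.End.mul_apply, Module.End.mul_apply, hX, map_zero,
      add_zero] at h
  · rintro ⟨Y, rfl⟩
    exact LinearMap.congr_fun minD₂_mul_minD₁ Y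

theorem minAug_surjective : Function.Surjective (minAug K) := by
  intro a
  -- The preimage is `∑ e_j ⊗ e_j a`, supported in row 0.
  refine ⟨fun j => Matrix.of fun n m => if n = 0 then a (pathTo j m) else 0, ?_⟩
  ext g
  obtain ⟨j, m, rfl⟩ := exists_eq_pathTo g
  rw [minAug_apply_pathTo]
  fin_cases m <;> simp [minD₂_apply_two_zero, minD₂_apply_two_one, minD₂_apply_two_two]

variable (K)

/-- The differentials of the minimal resolution. -/
def minD (n : ℕ) : Module.End K (MinCarrier K) := if Even n then minD₁ K else minD₂ K

variable {K}

/-- The length `⌊3n/2⌋` grows by 1 for even `n` and by 2 for odd `n`, matching the number of arrows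
moved by each differential. -/
theorem minD_mem (n : ℕ) :
    minD K n ∈ hom (minBimod K (3 * (n + 1) / 2)) (minBimod K (3 * n / 2)) := by
  by_cases h : Even n
  · have h' : 3 * (n + 1) / 2 = 3 * n / 2 + 1 := by
      obtain ⟨k, rfl⟩ := h
      omega
    rw [minD, if_pos h, h']
    exact sub_mem (shiftLeft_mem _) (shiftRight_mem _)
  · have h' : 3 * (n + 1) / 2 = 3 * n / 2 + 1 + 1 := by
      obtain ⟨k, rfl⟩ := Nat.not_even_iff_odd.1 h
      omega
    rw [minD, if_neg h, h']
    exact add_mem (add_mem (comp_mem_hom (shiftLeft_mem _) (shiftLeft_mem _))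
      (comp_mem_hom (shiftLeft_mem _) (shiftRight_mem _)))
      (comp_mem_hom (shiftRight_mem _) (shiftRight_mem _))

/-- The minimal projective resolution of `A`. -/
def minResolution (K : Type u) [Field K] : ProjectiveResolution K where
  X n := minBimod K (3 * n / 2)
  projective _ := projBimod_isProjective
  d := minD K
  d_mem := minD_mem
  ε := minAug K
  ε_mem := minAug_mem
  ε_surjective := minAug_surjective
  exact_zero := minAug_exact
  exact_succ n := by
    by_cases h : Even n
    · rw [minD, minD, if_pos h, if_neg (by simpa [Nat.even_add_one] using h)]
      exact minD_exact_one_two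
    · rw [minD, minD, if_neg h, if_pos (by simpa [Nat.even_add_one] using h)]
      exact minD_exact_two_one

end Shifts

end TwoCycle

/-! ### The small complex of values at the two generators -/

namespace TwoCycle

open MulOpposite GradedBimodule

/-- The vertex where a path starts. -/
def Gen.source : Gen → Vertex
  | .e0 => .a
  | .f0 => .b
  | .u => .a
  | .v => .b
  | .e1 => .a
  | .f1 => .b

/-- The vertex where a path ends. -/
def Gen.target : Gen → Vertex
  | .e0 => .a
  | .f0 => .b
  | .u => .b
  | .v => .a
  | .e1 => .a
  | .f1 => .b

section Small

variable (K : Type u) [Field K]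

/-- The degree-preserving homomorphisms from `minBimod K L` to `A[s]`, in terms of their values at
the two generators. -/
def smallCochains (L : ℕ) (s : ℤ) : Submodule K (Vertex → A K) where
  carrier := {c | ∀ j g,
    ¬ (g.source = j ∧ g.target = endVertex L j ∧ g.deg = pathDegree L j + s) → c j g = 0}
  add_mem' hc hd j g h := by simp [hc j g h, hd j g h]
  zero_mem' _ _ _ := rfl
  smul_mem' r c hc j g h := by simp [hc j g h]

/-- Multiplication from the left with the arrow that prolongs a path of length `L`. -/
def arrowMul (L : ℕ) (s : ℤ) : Module.End K (Vertex → A K) :=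
  LinearMap.pi fun j =>
    LinearMap.mulLeft K (twist K s (gen (arrowFrom (endVertex L j)))) ∘ₗ LinearMap.proj j

/-- Multiplication from the right with an arrow. -/
def mulArrow : Module.End K (Vertex → A K) :=
  LinearMap.pi fun j => LinearMap.mulRight K (gen (arrowFrom j)) ∘ₗ LinearMap.proj j.swap

/-- The differential that the minimal resolution induces on `smallCochains`. -/
def smallD (n : ℕ) (s : ℤ) : Module.End K (Vertex → A K) :=
  if Even n then arrowMul K (3 * n / 2) s - mulArrow K
  else arrowMul K (3 * n / 2 + 1) s * arrowMul K (3 * n / 2) s +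
    mulArrow K * arrowMul K (3 * n / 2) s + mulArrow K * mulArrow K

/-- The cocycles of the small complex. -/
def smallCocycles (n : ℕ) (s : ℤ) : Submodule K (Vertex → A K) :=
  smallCochains K (3 * n / 2) s ⊓ LinearMap.ker (smallD K n s)

/-- The coboundaries of the small complex. -/
def smallCoboundaries : ℕ → ℤ → Submodule K (Vertex → A K)
  | 0, _ => ⊥
  | n + 1, s => (smallCochains K (3 * n / 2) s).map (smallD K n s)

/-- The cohomology of the small complex. -/
abbrev SmallHH (n : ℕ) (s : ℤ) : Type u :=
  ↥(smallCocycles K n s) ⧸ (smallCoboundaries K n s).submoduleOf (smallCocycles K n s)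

variable {K}

theorem arrowMul_apply (L : ℕ) (s : ℤ) (c : Vertex → A K) (j : Vertex) :
    arrowMul K L s c j = twist K s (gen (arrowFrom (endVertex L j))) * c j := rfl

theorem mulArrow_apply (c : Vertex → A K) (j : Vertex) :
    mulArrow K c j = c j.swap * gen (arrowFrom j) := rfl

theorem idem_mul_mul_idem_apply (x y : Vertex) (a : A K) (g : Gen) :
    (idem K x * a * idem K y) g = if g.source = y ∧ g.target = x then a g else 0 := by
  cases x <;> cases y <;> cases g <;>
    simp [idem, pathFrom, A.mul_def, mulA, gen, Gen.source, Gen.target]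

theorem twist_idem (s : ℤ) (x : Vertex) : twist K s (idem K x) = idem K x := by
  rw [twist_of_mem K s 0 (by simpa [pathFrom_zero_deg] using gen_mem_piece K (pathFrom x 0))]
  simp

variable (K)

/-- The values of a map at the generators. -/
def evalGen : (MinCarrier K →ₗ[K] A K) →ₗ[K] (Vertex → A K) :=
  LinearMap.pi fun j => LinearMap.applyₗ (generator K j)

variable {K} {L n : ℕ} {s : ℤ}

theorem evalGen_apply (f : MinCarrier K →ₗ[K] A K) (j : Vertex) :
    evalGen K f j = f (generator K j) := rfl

/-- The generator is fixed by the idempotents at its two ends, so its image is a combination of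
paths parallel to the generating path. -/
theorem evalGen_mem {f : MinCarrier K →ₗ[K] A K} (hf : f ∈ hom (minBimod K L) (shiftA K s)) :
    evalGen K f ∈ smallCochains K L s := by
  intro j g h
  have hL : ∀ a X, f (projLact K (endVertex L) a X) = twist K s a * f X := hf.1
  have hR : ∀ a X, f (projRact K id (op a) X) = f X * a := fun a => hf.2.1 (op a)
  have h1 : f (generator K j) ∈ piece K (pathDegree L j + s) := hf.2.2 _ _ (generator_mem j)
  have h2 : idem K (endVertex L j) * f (generator K j) * idem K j = f (generator K j) := by
    conv_rhs => rw [← idem_generator (x := endVertex L) (y := id) j]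
    rw [hL, hR, twist_idem, mul_assoc]
    rfl
  rw [evalGen_apply, ← h2, idem_mul_mul_idem_apply]
  split_ifs with h3
  · exact h1 g fun h4 => h ⟨h3.1, h3.2, h4⟩
  · rfl

variable (L s) in
/-- The map with given values at the generators. -/
def ofGen (K : Type u) [Field K] : (Vertex → A K) →ₗ[K] (MinCarrier K →ₗ[K] A K) :=
  homOfGen (endVertex L) id (shiftA K s)

theorem ofGen_mem {c : Vertex → A K} (hc : c ∈ smallCochains K L s) :
    ofGen L s K c ∈ hom (minBimod K L) (shiftA K s) :=
  homOfGen_mem_hom (shiftA K s) fun j g hg => hc j g fun h => hg h.2.2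

theorem evalGen_ofGen {c : Vertex → A K} (hc : c ∈ smallCochains K L s) :
    evalGen K (ofGen L s K c) = c := by
  funext j
  have : evalGen K (ofGen L s K c) j = twist K s (idem K (endVertex L j)) * (c j * idem K j) :=
    homOfGen_generator (shiftA K s) c j
  rw [this, twist_idem, ← mul_assoc]
  ext g
  rw [idem_mul_mul_idem_apply]
  split_ifs with h
  · rfl
  · exact (hc j g fun h' => h ⟨h'.1, h'.2.1⟩).symm

theorem ofGen_evalGen {f : MinCarrier K →ₗ[K] A K} (hf : f ∈ hom (minBimod K L) (shiftA K s)) :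
    ofGen L s K (evalGen K f) = f :=
  homOfGen_apply_generator hf

theorem shiftLeft_generator (L : ℕ) (j : Vertex) : shiftLeft K (generator K j) =
    projLact K (endVertex L) (gen (arrowFrom (endVertex L j))) (generator K j) := by
  funext k
  rw [shiftLeft_apply, projLact_apply, generator]
  by_cases hk : k = j
  · subst hk
    rw [Pi.single_eq_same]
    have : (arrowFrom (endVertex L k)) = pathFrom (endVertex L k) 1 := by
      cases endVertex L k <;> rfl
    rw [this, leftMat_mul_single]
    ext n m
    fin_cases n <;> fin_cases m <;> simp [lowerShift, Matrix.mul_apply, Fin.sum_univ_three]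
  · rw [Pi.single_eq_of_ne hk, mul_zero, mul_zero]

theorem shiftRight_generator (j : Vertex) : shiftRight K (generator K j) =
    projRact K id (op (gen (arrowFrom j))) (generator K j.swap) := by
  funext k
  rw [shiftRight_apply, projRact_apply, generator, generator]
  by_cases hk : k = j.swap
  · subst hk
    rw [Vertex.swap_swap, Pi.single_eq_same, Pi.single_eq_same, id]
    have : arrowFrom j = pathTo j.swap 1 := by cases j <;> rfl
    rw [this, single_mul_rightMat]
    ext n m
    fin_cases n <;> fin_cases m <;> simp [upperShift, Matrix.mul_apply, Fin.sum_univ_three]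
  · have hk' : k.swap ≠ j := by
      rintro rfl
      exact hk k.swap_swap.symm
    rw [Pi.single_eq_of_ne hk', Pi.single_eq_of_ne hk, zero_mul, zero_mul]

theorem evalGen_comp_shiftLeft {f : MinCarrier K →ₗ[K] A K}
    (hf : f ∈ hom (minBimod K L) (shiftA K s)) :
    evalGen K (f ∘ₗ shiftLeft K) = arrowMul K L s (evalGen K f) := by
  funext j
  change f (shiftLeft K (generator K j)) = _
  rw [shiftLeft_generator L]
  exact hf.1 _ _

theorem evalGen_comp_shiftRight {f : MinCarrier K →ₗ[K] A K}
    (hf : f ∈ hom (minBimod K L) (shiftA K s)) :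
    evalGen K (f ∘ₗ shiftRight K) = mulArrow K (evalGen K f) := by
  funext j
  change f (shiftRight K (generator K j)) = _
  rw [shiftRight_generator]
  exact hf.2.1 _ _

theorem smallD_evalGen {f : MinCarrier K →ₗ[K] A K}
    (hf : f ∈ hom (minBimod K (3 * n / 2)) (shiftA K s)) :
    smallD K n s (evalGen K f) = evalGen K (f ∘ₗ minD K n) := by
  by_cases h : Even n
  · rw [smallD, minD, if_pos h, if_pos h, minD₁, LinearMap.comp_sub, map_sub,
      evalGen_comp_shiftLeft hf, evalGen_comp_shiftRight hf]
    rfl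
  · have hl := comp_mem_hom hf (shiftLeft_mem (K := K) (3 * n / 2))
    have hr := comp_mem_hom hf (shiftRight_mem (K := K) (3 * n / 2))
    -- Precomposition reverses the order of the factors. The left shift applied second meets a path
    -- of length one more, hence the index `3 * n / 2 + 1`.
    have h1 := (evalGen_comp_shiftLeft hl).trans
      (congrArg (arrowMul K (3 * n / 2 + 1) s) (evalGen_comp_shiftLeft hf))
    have h2 := (evalGen_comp_shiftRight hl).trans
      (congrArg (mulArrow K) (evalGen_comp_shiftLeft hf))
    have h3 := (evalGen_comp_shiftRight hr).trans
      (congrArg (mulArrow K) (evalGen_comp_shiftRight hf))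
    rw [smallD, minD, if_neg h, if_neg h, minD₂, LinearMap.comp_add, LinearMap.comp_add, map_add,
      map_add]
    exact (congrArg₂ (· + ·) (congrArg₂ (· + ·) h1 h2) h3).symm

/-- `Ext` of the minimal resolution is the cohomology of the small complex. -/
theorem nonempty_ext_equiv_smallHH (n : ℕ) (s : ℤ) :
    Nonempty ((minResolution K).Ext (shiftA K s) n ≃ₗ[K] SmallHH K n s) := by
  refine nonempty_subquotient_equiv_of_inverse (V := MinCarrier K →ₗ[K] A K)
    (evalGen K) (ofGen (3 * n / 2) s K) ?_ ?_ ?_ ?_ ?_ ?_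
  · rintro f ⟨hf, hf'⟩
    refine ⟨evalGen_mem hf, ?_⟩
    have hf' : f ∘ₗ minD K n = 0 := hf'
    exact (smallD_evalGen hf).trans ((congrArg (evalGen K) hf').trans (map_zero _))
  · cases n with
    | zero =>
      rintro b (rfl : b = 0)
      exact map_zero (evalGen K)
    | succ n =>
      rintro _ ⟨f, hf, rfl⟩
      exact ⟨evalGen K f, evalGen_mem hf, smallD_evalGen hf⟩
  · rintro c ⟨hc, hc'⟩
    have h : evalGen K (ofGen (3 * n / 2) s K c ∘ₗ minD K n) = 0 := by
      rw [← smallD_evalGen (ofGen_mem hc), evalGen_ofGen hc]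
      exact hc'
    have hmem := comp_mem_hom (ofGen_mem hc) (minD_mem (K := K) n)
    refine ⟨ofGen_mem hc, ?_⟩
    change ofGen (3 * n / 2) s K c ∘ₗ minD K n = 0
    refine (ofGen_evalGen hmem).symm.trans ?_
    exact (congrArg (ofGen (3 * (n + 1) / 2) s K) h).trans (map_zero _)
  · cases n with
    | zero =>
      rintro b (rfl : b = 0)
      exact map_zero (ofGen _ s K)
    | succ n =>
      rintro _ ⟨c, hc, rfl⟩
      refine ⟨ofGen (3 * n / 2) s K c, ofGen_mem hc, ?_⟩
      change ofGen (3 * n / 2) s K c ∘ₗ minD K n = _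
      have hmem := comp_mem_hom (ofGen_mem hc) (minD_mem (K := K) n)
      refine (ofGen_evalGen hmem).symm.trans (congrArg (ofGen (3 * (n + 1) / 2) s K) ?_)
      refine (smallD_evalGen (ofGen_mem hc)).symm.trans ?_
      rw [evalGen_ofGen hc]
  · rintro f ⟨hf, -⟩
    exact ofGen_evalGen hf
  · rintro c ⟨hc, -⟩
    exact evalGen_ofGen hc

theorem nonempty_HH_equiv_smallHH (K : Type u) [Field K] (n : ℕ) (s : ℤ) :
    Nonempty (HH K n s ≃ₗ[K] SmallHH K n s) := by
  obtain ⟨e⟩ := nonempty_HH_equiv_ext (minResolution K) n s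
  obtain ⟨e'⟩ := nonempty_ext_equiv_smallHH (K := K) n s
  exact ⟨e.trans e'⟩

/-! ### Periodicity -/

theorem endVertex_add_two_mul (L t : ℕ) (j : Vertex) : endVertex (L + 2 * t) j = endVertex L j := by
  simp [endVertex, Nat.even_add]

theorem pathDegree_add_two_mul (L t : ℕ) (j : Vertex) :
    pathDegree (L + 2 * t) j = pathDegree L j + t := by
  cases j <;> simp only [pathDegree] <;> omega

/-- Two additional arrows leave the ends unchanged and raise the degree by one, so the shift by `-t`
compensates `2 * t` arrows. -/
theorem smallCochains_periodic (L t : ℕ) (s : ℤ) :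
    smallCochains K (L + 2 * t) (s - t) = smallCochains K L s := by
  ext c
  have h : ∀ j, pathDegree L j + t + (s - t) = pathDegree L j + s := fun j => by ring
  simp only [smallCochains, endVertex_add_two_mul, pathDegree_add_two_mul, h]

theorem arrowMul_periodic (L t : ℕ) {s : ℤ} (ht : twist K (s - t) = twist K s) :
    arrowMul K (L + 2 * t) (s - t) = arrowMul K L s := by
  simp only [arrowMul, endVertex_add_two_mul, ht]

theorem smallD_periodic {m t : ℕ} (hm : 3 * m = 4 * t) (n : ℕ) {s : ℤ}
    (ht : twist K (s - t) = twist K s) : smallD K (n + m) (s - t) = smallD K n s := by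
  have hL : 3 * (n + m) / 2 = 3 * n / 2 + 2 * t := by omega
  have hm' : Even m := by
    rw [Nat.even_iff]
    omega
  have hn : Even (n + m) ↔ Even n := by simp [Nat.even_add, hm']
  simp only [smallD, hn, hL, arrowMul_periodic _ t ht, Nat.add_right_comm _ (2 * t) 1]

/-- The condition `3 * m = 4 * t` says that `m` steps of the resolution lengthen the paths by `2 *
t`. It makes `m` even, so the kind of differential is kept, and `ht` takes care of the sign. Length
0 is excluded, since only there are the coboundaries zero by definition. -/
theorem nonempty_HH_periodic {m t : ℕ} (hm : 3 * m = 4 * t) (s : ℤ)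
    (ht : twist K (s - t) = twist K s) {r : ℕ} (hr : 0 < r) :
    Nonempty (HH K (r + m) (s - t) ≃ₗ[K] HH K r s) := by
  obtain ⟨e⟩ := nonempty_HH_equiv_smallHH K (r + m) (s - t)
  obtain ⟨e'⟩ := nonempty_HH_equiv_smallHH K r s
  have h1 : smallCocycles K (r + m) (s - t) = smallCocycles K r s := by
    have hL : 3 * (r + m) / 2 = 3 * r / 2 + 2 * t := by omega
    rw [smallCocycles, smallCocycles, hL, smallCochains_periodic, smallD_periodic hm r ht]
  have h2 : smallCoboundaries K (r + m) (s - t) = smallCoboundaries K r s := by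
    obtain ⟨k, rfl⟩ := Nat.exists_eq_succ_of_ne_zero hr.ne'
    have hk : k.succ + m = (k + m) + 1 := by omega
    have hL : 3 * (k + m) / 2 = 3 * k / 2 + 2 * t := by omega
    rw [hk]
    simp only [smallCoboundaries, hL, smallCochains_periodic, smallD_periodic hm k ht]
  have e'' : SmallHH K (r + m) (s - t) ≃ₗ[K] SmallHH K r s := by
    unfold SmallHH
    rw [h1, h2]
  exact ⟨e.trans (e''.trans e'.symm)⟩

theorem twist_sub_six (s : ℤ) : twist K (s - (6 : ℕ)) = twist K s := by
  ext x g
  change twistFun K _ x g = twistFun K _ x g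
  have h : (-1 : K) ^ ((s - (6 : ℕ)) * g.deg) = (-1 : K) ^ (s * g.deg) := by
    have : (s - (6 : ℕ)) * g.deg = s * g.deg + 2 * (-3 * g.deg) := by push_cast; ring
    rw [this, zpow_add₀ (by simp), zpow_mul _ 2]
    simp
  rw [twistFun_apply, twistFun_apply, h]

theorem twist_of_charP_two [CharP K 2] (s t : ℤ) : twist K s = twist K t := by
  have h : (-1 : K) = 1 := CharTwo.neg_eq 1
  ext x g
  change twistFun K _ x g = twistFun K _ x g
  rw [twistFun_apply, twistFun_apply, h, one_zpow, one_zpow]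

end Small

end TwoCycle

/-! ### The differentials as 2×2 matrices -/

namespace TwoCycle

/-- A subquotient is isomorphic to a space onto which it maps with the right kernel. -/
theorem nonempty_subquotient_equiv_of_functional {K V W : Type*} [Field K] [AddCommGroup V]
    [Module K V] [AddCommGroup W] [Module K W] {Z B : Submodule K V} (F : V →ₗ[K] W)
    (hF : ∀ w, ∃ z ∈ Z, F z = w) (hB : ∀ b ∈ B, F b = 0) (hZ : ∀ z ∈ Z, F z = 0 → z ∈ B) :
    Nonempty ((Z ⧸ B.submoduleOf Z) ≃ₗ[K] W) := by
  have hsurj : Function.Surjective (F ∘ₗ Z.subtype) := fun w => by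
    obtain ⟨z, hz, h⟩ := hF w
    exact ⟨⟨z, hz⟩, h⟩
  have hker : B.submoduleOf Z = LinearMap.ker (F ∘ₗ Z.subtype) := by
    ext z
    exact ⟨fun h => hB _ h, fun h => hZ _ z.2 h⟩
  rw [hker]
  exact ⟨LinearMap.quotKerEquivOfSurjective _ hsurj⟩

theorem subsingleton_subquotient {K V : Type*} [Field K] [AddCommGroup V] [Module K V]
    {Z B : Submodule K V} (h : Z ≤ B) : Subsingleton (Z ⧸ B.submoduleOf Z) :=
  Submodule.Quotient.subsingleton_iff.2 (eq_top_iff.2 fun z _ => h z.2)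

/-- In a field `c` is zero or a unit, so the quotient is `K` or zero. -/
theorem nonempty_equiv_quotient_span {K M : Type*} [Field K] [AddCommGroup M] [Module K M] (c : K)
    (h0 : c = 0 → Nonempty (M ≃ₗ[K] K)) (h : c ≠ 0 → Subsingleton M) :
    Nonempty (M ≃ₗ[K] K ⧸ Ideal.span {c}) := by
  by_cases hc : c = 0
  · obtain ⟨e⟩ := h0 hc
    have : Ideal.span {c} = (⊥ : Submodule K K) := by
      rw [hc]
      exact Ideal.span_singleton_eq_bot.2 rfl
    exact ⟨e.trans (Submodule.quotEquivOfEqBot _ this).symm⟩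
  · have : Subsingleton (K ⧸ Ideal.span {c}) := by
      rw [Ideal.Quotient.subsingleton_iff, Ideal.span_singleton_eq_top]
      exact (Ne.isUnit hc)
    have := h hc
    exact ⟨LinearEquiv.ofSubsingleton _ _⟩

section Table

variable {K : Type u} [Field K]

/-- The element of `smallCochains` with two given coefficients. -/
def pairCochain (K : Type u) [Field K] (g h : Gen) : K × K →ₗ[K] (Vertex → A K) where
  toFun p j := match j with
    | .a => p.1 • gen g
    | .b => p.2 • gen h
  map_add' p q := by funext j; cases j <;> simp [add_smul]
  map_smul' c p := by funext j; cases j <;> simp [mul_smul]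

/-- The coefficients of the two values of a cochain. -/
def pairCoeff (K : Type u) [Field K] (g h : Gen) : (Vertex → A K) →ₗ[K] K × K where
  toFun c := (c .a g, c .b h)
  map_add' _ _ := rfl
  map_smul' _ _ := rfl

theorem gen_apply (g k : Gen) : (gen g : A K) k = if k = g then 1 else 0 := rfl

theorem pairCochain_a (g h : Gen) (p : K × K) : pairCochain K g h p .a = p.1 • gen g := rfl

theorem pairCochain_b (g h : Gen) (p : K × K) : pairCochain K g h p .b = p.2 • gen h := rfl

theorem pairCoeff_apply (g h : Gen) (c : Vertex → A K) : pairCoeff K g h c = (c .a g, c .b h) := rfl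

@[simp] theorem pairCoeff_pairCochain (g h : Gen) (p : K × K) :
    pairCoeff K g h (pairCochain K g h p) = p := by
  simp [pairCoeff_apply, pairCochain_a, pairCochain_b, gen_apply]

/-- Cochains with values in the idempotents. -/
abbrev lowCochain (K : Type u) [Field K] := pairCochain K .e0 .f0

/-- Cochains with values in the loops. -/
abbrev highCochain (K : Type u) [Field K] := pairCochain K .e1 .f1

/-- Cochains with values in the arrows. -/
abbrev oddCochain (K : Type u) [Field K] := pairCochain K .u .v

theorem mem_range_pairCochain {g h : Gen} {c : Vertex → A K} (hg : ∀ k, k ≠ g → c .a k = 0)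
    (hh : ∀ k, k ≠ h → c .b k = 0) : c ∈ LinearMap.range (pairCochain K g h) := by
  refine ⟨pairCoeff K g h c, ?_⟩
  funext j
  ext k
  cases j
  · by_cases hk : k = g
    · simp [pairCochain_a, pairCoeff_apply, gen_apply, hk]
    · simp [pairCochain_a, pairCoeff_apply, gen_apply, hk, hg]
  · by_cases hk : k = h
    · simp [pairCochain_b, pairCoeff_apply, gen_apply, hk]
    · simp [pairCochain_b, pairCoeff_apply, gen_apply, hk, hh]

/-- A path of length `2 * k` is closed of degree `k`; the parallel paths in `A` are the idempotent
of degree 0 and the loop of degree 1, which occur for two consecutive values of `s`. -/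
theorem smallCochains_low (k : ℕ) :
    smallCochains K (2 * k) (-k) = LinearMap.range (lowCochain K) := by
  have h : (2 * k + 1) / 2 = k := by omega
  refine le_antisymm (fun c hc => mem_range_pairCochain (fun g hg => hc .a g ?_)
    (fun g hg => hc .b g ?_)) ?_
  · rintro _ ⟨p, rfl⟩ j g hg
    cases j <;> cases g <;> simp [Gen.source, Gen.target, Gen.deg, endVertex, pathDegree, h,
      pairCochain_a, pairCochain_b, gen_apply] at hg ⊢
  · cases g <;> simp [Gen.source, Gen.target, Gen.deg, endVertex, pathDegree, h] at hg ⊢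
  · cases g <;> simp [Gen.source, Gen.target, Gen.deg, endVertex, pathDegree] at hg ⊢

theorem smallCochains_high (k : ℕ) :
    smallCochains K (2 * k) (1 - k) = LinearMap.range (highCochain K) := by
  have h : (2 * k + 1) / 2 = k := by omega
  refine le_antisymm (fun c hc => mem_range_pairCochain (fun g hg => hc .a g ?_)
    (fun g hg => hc .b g ?_)) ?_
  · rintro _ ⟨p, rfl⟩ j g hg
    cases j <;> cases g <;> simp [Gen.source, Gen.target, Gen.deg, endVertex, pathDegree, h,
      pairCochain_a, pairCochain_b, gen_apply] at hg ⊢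
  · cases g <;> simp [Gen.source, Gen.target, Gen.deg, endVertex, pathDegree, h] at hg ⊢
  · cases g <;> simp [Gen.source, Gen.target, Gen.deg, endVertex, pathDegree] at hg ⊢

/-- The paths of odd length from `a` and from `b` have degrees `k + 1` and `k`, and the parallel
arrows `u` and `v` have degrees 1 and 0, so both coefficients occur for the same `s`. -/
theorem smallCochains_odd (k : ℕ) :
    smallCochains K (2 * k + 1) (-k) = LinearMap.range (oddCochain K) := by
  have h : (2 * k + 1) / 2 = k := by omega
  have h' : (2 * k + 1 + 1) / 2 = k + 1 := by omega
  refine le_antisymm (fun c hc => mem_range_pairCochain (fun g hg => hc .a g ?_)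
    (fun g hg => hc .b g ?_)) ?_
  · rintro _ ⟨p, rfl⟩ j g hg
    cases j <;> cases g <;>
      simp [Gen.source, Gen.target, Gen.deg, endVertex, pathDegree, h, h', Vertex.swap,
        pairCochain_a, pairCochain_b, gen_apply] at hg ⊢
  · cases g <;>
      simp [Gen.source, Gen.target, Gen.deg, endVertex, pathDegree, h', Vertex.swap] at hg ⊢
  · cases g <;>
      simp [Gen.source, Gen.target, Gen.deg, endVertex, pathDegree, h, Vertex.swap] at hg ⊢

theorem smallCochains_even_eq_bot (k : ℕ) {s : ℤ} (h0 : s ≠ -k) (h1 : s ≠ 1 - k) :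
    smallCochains K (2 * k) s = ⊥ := by
  have h : (2 * k + 1) / 2 = k := by omega
  rw [eq_bot_iff]
  intro c hc
  funext j
  ext g
  refine hc j g fun hg => ?_
  cases j <;> cases g <;>
    simp [Gen.source, Gen.target, Gen.deg, endVertex, pathDegree, h] at hg <;> omega

theorem smallCochains_odd_eq_bot (k : ℕ) {s : ℤ} (h0 : s ≠ -k) :
    smallCochains K (2 * k + 1) s = ⊥ := by
  have h : (2 * k + 1) / 2 = k := by omega
  have h' : (2 * k + 1 + 1) / 2 = k + 1 := by omega
  rw [eq_bot_iff]
  intro c hc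
  funext j
  ext g
  refine hc j g fun hg => ?_
  cases j <;> cases g <;>
    simp [Gen.source, Gen.target, Gen.deg, endVertex, pathDegree, h, h', Vertex.swap] at hg <;>
    omega

theorem twist_arrow_u (s : ℤ) : twist K s (gen .u) = (-1 : K) ^ s • gen .u := by
  have := twist_of_mem K s 1 (gen_mem_piece K .u)
  rwa [mul_one] at this

theorem twist_arrow_v (s : ℤ) : twist K s (gen .v) = gen .v := by
  have := twist_of_mem K s 0 (gen_mem_piece K .v)
  rwa [mul_zero, zpow_zero, one_smul] at this

variable {L n : ℕ} {s : ℤ} (p : K × K)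

theorem arrowMul_lowCochain (hL : Even L) : arrowMul K L s (lowCochain K p) =
    oddCochain K ((-1 : K) ^ s * p.1, p.2) := by
  funext j
  ext g
  cases j <;> cases g <;> simp [arrowMul_apply, endVertex, hL, arrowFrom, twist_arrow_u,
    twist_arrow_v, pairCochain_a, pairCochain_b, A.mul_def, mulA, gen_apply, mul_comm]

theorem arrowMul_highCochain (hL : Even L) : arrowMul K L s (highCochain K p) = 0 := by
  funext j
  ext g
  cases j <;> cases g <;> simp [arrowMul_apply, endVertex, hL, arrowFrom, twist_arrow_u,
    twist_arrow_v, pairCochain_a, pairCochain_b, A.mul_def, mulA, gen_apply, mul_comm]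

theorem arrowMul_oddCochain (hL : ¬ Even L) : arrowMul K L s (oddCochain K p) =
    highCochain K (p.1, (-1 : K) ^ s * p.2) := by
  funext j
  ext g
  cases j <;> cases g <;> simp [arrowMul_apply, endVertex, hL, arrowFrom, twist_arrow_u,
    twist_arrow_v, pairCochain_a, pairCochain_b, A.mul_def, mulA, gen_apply, Vertex.swap, mul_comm]

theorem mulArrow_lowCochain : mulArrow K (lowCochain K p) = oddCochain K p.swap := by
  funext j
  ext g
  cases j <;> cases g <;> simp [mulArrow_apply, arrowFrom, pairCochain_a, pairCochain_b,
    A.mul_def, mulA, gen_apply, Vertex.swap]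

theorem mulArrow_oddCochain : mulArrow K (oddCochain K p) = highCochain K p.swap := by
  funext j
  ext g
  cases j <;> cases g <;> simp [mulArrow_apply, arrowFrom, pairCochain_a, pairCochain_b,
    A.mul_def, mulA, gen_apply, Vertex.swap]

theorem mulArrow_highCochain : mulArrow K (highCochain K p) = 0 := by
  funext j
  ext g
  cases j <;> cases g <;> simp [mulArrow_apply, arrowFrom, pairCochain_a, pairCochain_b,
    A.mul_def, mulA, gen_apply, Vertex.swap]

/-- The determinant is `(-1)^s - 1`, as for `smallD_oddCochain_of_even`. For even `s` the matrix has
rank one, and for odd `s` it is invertible unless the characteristic is 2. -/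
theorem smallD_lowCochain_of_even (hn : Even n) (hL : Even (3 * n / 2)) :
    smallD K n s (lowCochain K p) = oddCochain K ((-1 : K) ^ s * p.1 - p.2, p.2 - p.1) := by
  rw [smallD, if_pos hn, LinearMap.sub_apply, arrowMul_lowCochain p hL, mulArrow_lowCochain,
    ← map_sub]
  rfl

theorem smallD_oddCochain_of_even (hn : Even n) (hL : ¬ Even (3 * n / 2)) :
    smallD K n s (oddCochain K p) = highCochain K (p.1 - p.2, (-1 : K) ^ s * p.2 - p.1) := by
  rw [smallD, if_pos hn, LinearMap.sub_apply, arrowMul_oddCochain p hL, mulArrow_oddCochain,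
    ← map_sub]
  rfl

/-- With `ε = (-1)^s` the determinant is `(1 + ε)² - ε = 2 + ε`, that is, 3 for even `s` and 1 for
odd `s`. -/
theorem smallD_lowCochain_of_odd (hn : ¬ Even n) (hL : Even (3 * n / 2)) :
    smallD K n s (lowCochain K p) = highCochain K ((-1 : K) ^ s * p.1 + p.2 + p.1,
      (-1 : K) ^ s * p.2 + (-1 : K) ^ s * p.1 + p.2) := by
  rw [smallD, if_neg hn]
  simp only [LinearMap.add_apply, Module.End.mul_apply, arrowMul_lowCochain p hL,
    mulArrow_lowCochain, mulArrow_oddCochain,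
    arrowMul_oddCochain _ (show ¬ Even (3 * n / 2 + 1) by simpa [Nat.even_add_one] using hL),
    ← map_add]
  rfl

/-- This differential adds two arrows to an arrow, and paths of length three vanish in `A`. -/
theorem smallD_oddCochain_of_odd (hn : ¬ Even n) (hL : ¬ Even (3 * n / 2)) :
    smallD K n s (oddCochain K p) = 0 := by
  rw [smallD, if_neg hn]
  simp only [LinearMap.add_apply, Module.End.mul_apply, arrowMul_oddCochain p hL,
    mulArrow_oddCochain, mulArrow_highCochain,
    arrowMul_highCochain _ (show Even (3 * n / 2 + 1) by simpa [Nat.even_add_one] using hL),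
    add_zero]

theorem smallD_highCochain (hL : Even (3 * n / 2)) : smallD K n s (highCochain K p) = 0 := by
  rw [smallD]
  split_ifs
  · rw [LinearMap.sub_apply, arrowMul_highCochain p hL, mulArrow_highCochain, sub_zero]
  · simp only [LinearMap.add_apply, Module.End.mul_apply, arrowMul_highCochain p hL,
      mulArrow_highCochain, map_zero, add_zero]

end Table

end TwoCycle

/-! ### The entries of the table -/

namespace TwoCycle

section Entries

variable {K : Type u} [Field K]

/-- A description of the cocycles and of the coboundaries of the small complex in terms of pairs of
coefficients. -/
structure PairPresentation (n : ℕ) (s : ℤ) (g h : Gen) (Z B : K × K → Prop) : Prop where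
  mem_cocycles : ∀ c, c ∈ smallCocycles K n s ↔ ∃ p, Z p ∧ pairCochain K g h p = c
  mem_coboundaries : ∀ c, c ∈ smallCoboundaries K n s ↔ ∃ p, B p ∧ pairCochain K g h p = c

theorem pairCochain_eq_zero {g h : Gen} {p : K × K} : pairCochain K g h p = 0 ↔ p = 0 := by
  refine ⟨fun hp => ?_, fun hp => by rw [hp, map_zero]⟩
  rw [← pairCoeff_pairCochain g h p, hp, map_zero]

theorem PairPresentation.nonempty_equiv {n : ℕ} {s : ℤ} {g h : Gen} {Z B : K × K → Prop}
    (P : PairPresentation n s g h Z B) {W : Type u} [AddCommGroup W] [Module K W]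
    (F : K × K →ₗ[K] W) (hF : ∀ w, ∃ p, Z p ∧ F p = w) (hB : ∀ p, B p → F p = 0)
    (hZ : ∀ p, Z p → F p = 0 → B p) : Nonempty (HH K n s ≃ₗ[K] W) := by
  obtain ⟨e⟩ := nonempty_HH_equiv_smallHH K n s
  have : Nonempty (SmallHH K n s ≃ₗ[K] W) := by
    refine nonempty_subquotient_equiv_of_functional (F ∘ₗ pairCoeff K g h) (fun w => ?_)
      (fun b hb => ?_) fun z hz hFz => ?_
    · obtain ⟨p, hp, hw⟩ := hF w
      exact ⟨_, (P.mem_cocycles _).2 ⟨p, hp, rfl⟩, by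
        rw [LinearMap.comp_apply, pairCoeff_pairCochain, hw]⟩
    · obtain ⟨p, hp, rfl⟩ := (P.mem_coboundaries b).1 hb
      rw [LinearMap.comp_apply, pairCoeff_pairCochain, hB p hp]
    · obtain ⟨p, hp, rfl⟩ := (P.mem_cocycles z).1 hz
      rw [LinearMap.comp_apply, pairCoeff_pairCochain] at hFz
      exact (P.mem_coboundaries _).2 ⟨p, hZ p hp hFz, rfl⟩
  obtain ⟨e'⟩ := this
  exact ⟨e.trans e'⟩

theorem subsingleton_HH {n : ℕ} {s : ℤ} (h : smallCocycles K n s ≤ smallCoboundaries K n s) :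
    Subsingleton (HH K n s) := by
  obtain ⟨e⟩ := nonempty_HH_equiv_smallHH K n s
  have := subsingleton_subquotient h
  exact e.toEquiv.subsingleton

theorem PairPresentation.subsingleton {n : ℕ} {s : ℤ} {g h : Gen} {Z B : K × K → Prop}
    (P : PairPresentation n s g h Z B) (hZ : ∀ p, Z p → B p) : Subsingleton (HH K n s) :=
  subsingleton_HH fun z hz => by
    obtain ⟨p, hp, rfl⟩ := (P.mem_cocycles z).1 hz
    exact (P.mem_coboundaries _).2 ⟨p, hZ p hp, rfl⟩

theorem smallCoboundaries_eq_bot {n : ℕ} {s : ℤ} (h : smallCochains K (3 * n / 2) s = ⊥) :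
    smallCoboundaries K (n + 1) s = ⊥ := by
  rw [smallCoboundaries, h, Submodule.map_bot]

/-- This covers the source of a differential that receives no nonzero coboundaries; `of_cokernel`
covers the target. All entries are of one of these two kinds. -/
theorem PairPresentation.of_kernel {n : ℕ} {s : ℤ} {g h g' h' : Gen} {M : K × K → K × K}
    (hC : smallCochains K (3 * n / 2) s = LinearMap.range (pairCochain K g h))
    (hD : ∀ p, smallD K n s (pairCochain K g h p) = pairCochain K g' h' (M p))
    (hB : smallCoboundaries K n s = ⊥) :
    PairPresentation n s g h (fun p => M p = 0) (fun p => p = 0) where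
  mem_cocycles c := by
    rw [smallCocycles, Submodule.mem_inf, hC]
    constructor
    · rintro ⟨⟨p, rfl⟩, hp⟩
      rw [LinearMap.mem_ker, hD, pairCochain_eq_zero] at hp
      exact ⟨p, hp, rfl⟩
    · rintro ⟨p, hp, rfl⟩
      exact ⟨⟨p, rfl⟩, by rw [LinearMap.mem_ker, hD, hp, map_zero]⟩
  mem_coboundaries c := by
    rw [hB, Submodule.mem_bot]
    exact ⟨fun hc => ⟨0, rfl, by rw [hc, map_zero]⟩, by rintro ⟨p, rfl, rfl⟩; rw [map_zero]⟩

theorem PairPresentation.of_cokernel {n : ℕ} {s : ℤ} {g h g' h' : Gen} {M : K × K → K × K}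
    (hC : smallCochains K (3 * (n + 1) / 2) s = LinearMap.range (pairCochain K g h))
    (hD : ∀ p, smallD K (n + 1) s (pairCochain K g h p) = 0)
    (hC' : smallCochains K (3 * n / 2) s = LinearMap.range (pairCochain K g' h'))
    (hD' : ∀ p, smallD K n s (pairCochain K g' h' p) = pairCochain K g h (M p)) :
    PairPresentation (n + 1) s g h (fun _ => True) (fun p => ∃ q, M q = p) where
  mem_cocycles c := by
    rw [smallCocycles, Submodule.mem_inf, hC]
    constructor
    · rintro ⟨⟨p, rfl⟩, -⟩
      exact ⟨p, trivial, rfl⟩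
    · rintro ⟨p, -, rfl⟩
      exact ⟨⟨p, rfl⟩, hD p⟩
  mem_coboundaries c := by
    rw [smallCoboundaries, hC']
    constructor
    · rintro ⟨_, ⟨q, rfl⟩, rfl⟩
      exact ⟨M q, ⟨q, rfl⟩, (hD' q).symm⟩
    · rintro ⟨_, ⟨q, rfl⟩, rfl⟩
      exact ⟨_, ⟨q, rfl⟩, hD' q⟩

theorem nonempty_HH_zero_one : Nonempty (HH K 0 1 ≃ₗ[K] K × K) := by
  -- The differential is zero here, so the target pair `.u`, `.u` is an arbitrary choice.
  have P : PairPresentation (K := K) 0 1 .e1 .f1 _ _ := .of_kernel (M := fun _ => 0) (g' := .u)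
    (h' := .u) (smallCochains_high 0)
    (fun p => (smallD_highCochain p (by decide)).trans (map_zero _).symm) rfl
  exact P.nonempty_equiv LinearMap.id (fun w => ⟨w, rfl, rfl⟩) (fun p hp => hp) fun p _ hp => hp

/-- In the rank-one cases the kernel is the line of slope `t`, on which the first coordinate is an
isomorphism to `K`. -/
theorem PairPresentation.nonempty_equiv_of_kernel {n : ℕ} {s : ℤ} {g h : Gen} {Z : K × K → Prop}
    (P : PairPresentation (K := K) n s g h Z (fun p => p = 0)) (t : K)
    (hZ : ∀ p, Z p ↔ p.2 = t * p.1) : Nonempty (HH K n s ≃ₗ[K] K) := by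
  refine P.nonempty_equiv (LinearMap.fst K K K) (fun w => ⟨(w, t * w), (hZ _).2 rfl, rfl⟩)
    (fun p hp => by rw [hp, map_zero]) fun p hp hp' => ?_
  have hp' : p.1 = 0 := hp'
  exact Prod.ext hp' (((hZ p).1 hp).trans (by rw [hp', mul_zero]; rfl))

/-- In the rank-one cases the image is always the antidiagonal, so the sum of the coordinates
identifies the cokernel with `K`. -/
theorem PairPresentation.nonempty_equiv_of_cokernel {n : ℕ} {s : ℤ} {g h : Gen}
    {B : K × K → Prop} (P : PairPresentation (K := K) n s g h (fun _ => True) B)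
    (hB : ∀ p, B p ↔ p.1 + p.2 = 0) : Nonempty (HH K n s ≃ₗ[K] K) :=
  P.nonempty_equiv (LinearMap.fst K K K + LinearMap.snd K K K)
    (fun w => ⟨(w, 0), trivial, add_zero w⟩) (fun p hp => (hB p).1 hp) fun p _ hp => (hB p).2 hp

theorem nonempty_HH_zero_zero : Nonempty (HH K 0 0 ≃ₗ[K] K) := by
  have P : PairPresentation (K := K) 0 0 .e0 .f0 _ _ := .of_kernel (smallCochains_low 0)
    (fun p => smallD_lowCochain_of_even p (by decide) (by decide)) rfl
  refine P.nonempty_equiv_of_kernel 1 fun p => ?_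
  simp only [Prod.mk_eq_zero]
  exact ⟨fun h => by linear_combination h.2, fun h =>
    ⟨by rw [zpow_zero]; linear_combination -h, by linear_combination h⟩⟩

theorem nonempty_HH_one_zero : Nonempty (HH K 1 0 ≃ₗ[K] K) := by
  have P : PairPresentation (K := K) 1 0 .u .v _ _ := .of_cokernel (smallCochains_odd 0)
    (fun p => smallD_oddCochain_of_odd p (by decide) (by decide)) (smallCochains_low 0)
    (fun p => smallD_lowCochain_of_even p (by decide) (by decide))
  refine P.nonempty_equiv_of_cokernel fun p => ⟨?_, fun h => ⟨(p.1, 0), Prod.ext ?_ ?_⟩⟩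
  · rintro ⟨q, rfl⟩
    simp
  · simp
  · linear_combination -h

/-- Here `s` is odd and the determinant is -2. The combinations that give `2 * p.1 = 0` and `2 * p.2
= 0` are rows of the adjugate matrix, up to sign. -/
theorem nonempty_HH_two : Nonempty (HH K 2 (-1) ≃ₗ[K] K ⧸ Ideal.span {(2 : K)}) := by
  have P : PairPresentation (K := K) 2 (-1) .u .v _ _ := .of_kernel (smallCochains_odd 1)
    (fun p => smallD_oddCochain_of_even p (by decide) (by decide))
    (smallCoboundaries_eq_bot (n := 1) (smallCochains_odd_eq_bot 0 (by decide)))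
  have hs : (-1 : K) ^ (-1 : ℤ) = -1 := Odd.neg_one_zpow (by decide)
  simp only [hs, Prod.mk_eq_zero] at P
  refine nonempty_equiv_quotient_span _ (fun h2 => P.nonempty_equiv_of_kernel 1 fun p => ?_)
    fun h2 => P.subsingleton fun p hp => ?_
  · exact ⟨fun h => by linear_combination -h.1, fun h =>
      ⟨by linear_combination -h, by linear_combination -h - p.1 * h2⟩⟩
  · exact Prod.ext ((mul_eq_zero.1 (show 2 * p.1 = 0 by
      linear_combination hp.1 - hp.2)).resolve_left h2) ((mul_eq_zero.1 (show 2 * p.2 = 0 by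
      linear_combination -hp.1 - hp.2)).resolve_left h2)

theorem nonempty_HH_three_neg_one :
    Nonempty (HH K 3 (-1) ≃ₗ[K] K ⧸ Ideal.span {(2 : K)}) := by
  have P : PairPresentation (K := K) 3 (-1) .e1 .f1 _ _ := .of_cokernel (smallCochains_high 2)
    (fun p => smallD_highCochain p (by decide)) (smallCochains_odd 1)
    (fun p => smallD_oddCochain_of_even p (by decide) (by decide))
  have hs : (-1 : K) ^ (-1 : ℤ) = -1 := Odd.neg_one_zpow (by decide)
  simp only [hs] at P
  refine nonempty_equiv_quotient_span _
    (fun h2 => P.nonempty_equiv_of_cokernel fun p => ⟨?_, fun h => ⟨(p.1, 0), Prod.ext ?_ ?_⟩⟩)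
    fun h2 => P.subsingleton fun p _ =>
      -- The preimage is given by the inverse of the matrix of determinant -2.
      ⟨((p.1 - p.2) / 2, -(p.1 + p.2) / 2), Prod.ext ?_ ?_⟩
  · rintro ⟨q, rfl⟩
    linear_combination -q.2 * h2
  · simp
  · linear_combination -h
  · dsimp only
    field_simp
    ring
  · dsimp only
    field_simp
    ring

theorem nonempty_HH_three_neg_two :
    Nonempty (HH K 3 (-2) ≃ₗ[K] K ⧸ Ideal.span {(3 : K)}) := by
  have P : PairPresentation (K := K) 3 (-2) .e0 .f0 _ _ := .of_kernel (smallCochains_low 2)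
    (fun p => smallD_lowCochain_of_odd p (by decide) (by decide))
    (smallCoboundaries_eq_bot (n := 2) (smallCochains_odd_eq_bot 1 (by decide)))
  have hs : (-1 : K) ^ (-2 : ℤ) = 1 := Even.neg_one_zpow (by decide)
  simp only [hs, Prod.mk_eq_zero] at P
  -- The first equation is `2 * p.1 + p.2 = 0`, whence the slope -2; in characteristic 3 the second
  -- equation is a multiple of the first.
  refine nonempty_equiv_quotient_span _ (fun h3 => P.nonempty_equiv_of_kernel (-2) fun p => ?_)
    fun h3 => P.subsingleton fun p hp => ?_
  · exact ⟨fun h => by linear_combination h.1, fun h =>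
      ⟨by linear_combination h, by linear_combination 2 * h - p.1 * h3⟩⟩
  · exact Prod.ext ((mul_eq_zero.1 (show 3 * p.1 = 0 by
      linear_combination 2 * hp.1 - hp.2)).resolve_left h3) ((mul_eq_zero.1 (show 3 * p.2 = 0 by
      linear_combination 2 * hp.2 - hp.1)).resolve_left h3)

theorem nonempty_HH_four_neg_two :
    Nonempty (HH K 4 (-2) ≃ₗ[K] K ⧸ Ideal.span {(3 : K)}) := by
  have P : PairPresentation (K := K) 4 (-2) .e1 .f1 _ _ := .of_cokernel (smallCochains_high 3)
    (fun p => smallD_highCochain p (by decide)) (smallCochains_low 2)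
    (fun p => smallD_lowCochain_of_odd p (by decide) (by decide))
  have hs : (-1 : K) ^ (-2 : ℤ) = 1 := Even.neg_one_zpow (by decide)
  simp only [hs] at P
  refine nonempty_equiv_quotient_span _
    -- The vector `(0, p.1)` maps to `(p.1, 2 * p.1)`, which is `(p.1, -p.1)` in characteristic 3.
    (fun h3 => P.nonempty_equiv_of_cokernel fun p => ⟨?_, fun h => ⟨(0, p.1), Prod.ext ?_ ?_⟩⟩)
    fun h3 => P.subsingleton fun p _ =>
      ⟨((2 * p.1 - p.2) / 3, (2 * p.2 - p.1) / 3), Prod.ext ?_ ?_⟩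
  · rintro ⟨q, rfl⟩
    linear_combination (q.1 + q.2) * h3
  · simp
  · linear_combination -h + p.1 * h3
  · dsimp only
    field_simp
    ring
  · dsimp only
    field_simp
    ring

theorem nonempty_HH_four_neg_three :
    Nonempty (HH K 4 (-3) ≃ₗ[K] K ⧸ Ideal.span {(2 : K)}) := by
  have P : PairPresentation (K := K) 4 (-3) .e0 .f0 _ _ := .of_kernel (smallCochains_low 3)
    (fun p => smallD_lowCochain_of_even p (by decide) (by decide))
    (smallCoboundaries_eq_bot (n := 3) (smallCochains_even_eq_bot 2 (by decide) (by decide)))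
  have hs : (-1 : K) ^ (-3 : ℤ) = -1 := Odd.neg_one_zpow (by decide)
  simp only [hs, Prod.mk_eq_zero] at P
  refine nonempty_equiv_quotient_span _ (fun h2 => P.nonempty_equiv_of_kernel 1 fun p => ?_)
    fun h2 => P.subsingleton fun p hp => ?_
  · exact ⟨fun h => by linear_combination h.2, fun h =>
      ⟨by linear_combination -h - p.1 * h2, by linear_combination h⟩⟩
  · exact Prod.ext ((mul_eq_zero.1 (show 2 * p.1 = 0 by
      linear_combination -hp.1 - hp.2)).resolve_left h2) ((mul_eq_zero.1 (show 2 * p.2 = 0 by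
      linear_combination -hp.1 + hp.2)).resolve_left h2)

theorem nonempty_HH_five : Nonempty (HH K 5 (-3) ≃ₗ[K] K ⧸ Ideal.span {(2 : K)}) := by
  have P : PairPresentation (K := K) 5 (-3) .u .v _ _ := .of_cokernel (smallCochains_odd 3)
    (fun p => smallD_oddCochain_of_odd p (by decide) (by decide)) (smallCochains_low 3)
    (fun p => smallD_lowCochain_of_even p (by decide) (by decide))
  have hs : (-1 : K) ^ (-3 : ℤ) = -1 := Odd.neg_one_zpow (by decide)
  simp only [hs] at P
  refine nonempty_equiv_quotient_span _
    (fun h2 => P.nonempty_equiv_of_cokernel fun p => ⟨?_, fun h => ⟨(0, -p.1), Prod.ext ?_ ?_⟩⟩)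
    fun h2 => P.subsingleton fun p _ =>
      ⟨(-(p.1 + p.2) / 2, (p.2 - p.1) / 2), Prod.ext ?_ ?_⟩
  · rintro ⟨q, rfl⟩
    linear_combination -q.1 * h2
  · simp
  · linear_combination -h
  · dsimp only
    field_simp
    ring
  · dsimp only
    field_simp
    ring

theorem nonempty_HH_six : Nonempty (HH K 6 (-4) ≃ₗ[K] K) := by
  have P : PairPresentation (K := K) 6 (-4) .u .v _ _ := .of_kernel (smallCochains_odd 4)
    (fun p => smallD_oddCochain_of_even p (by decide) (by decide))
    (smallCoboundaries_eq_bot (n := 5) (smallCochains_odd_eq_bot 3 (by decide)))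
  have hs : (-1 : K) ^ (-4 : ℤ) = 1 := Even.neg_one_zpow (by decide)
  simp only [hs, Prod.mk_eq_zero] at P
  exact P.nonempty_equiv_of_kernel 1 fun p => ⟨fun h => by linear_combination h.2, fun h =>
    ⟨by linear_combination -h, by linear_combination h⟩⟩

theorem nonempty_HH_seven : Nonempty (HH K 7 (-4) ≃ₗ[K] K) := by
  have P : PairPresentation (K := K) 7 (-4) .e1 .f1 _ _ := .of_cokernel (smallCochains_high 5)
    (fun p => smallD_highCochain p (by decide)) (smallCochains_odd 4)
    (fun p => smallD_oddCochain_of_even p (by decide) (by decide))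
  have hs : (-1 : K) ^ (-4 : ℤ) = 1 := Even.neg_one_zpow (by decide)
  simp only [hs] at P
  refine P.nonempty_equiv_of_cokernel fun p => ⟨?_, fun h => ⟨(p.1, 0), Prod.ext ?_ ?_⟩⟩
  · rintro ⟨q, rfl⟩
    ring
  · simp
  · linear_combination -h

theorem nonempty_HH_eight : Nonempty (HH K 8 (-6) ≃ₗ[K] K) := by
  have P : PairPresentation (K := K) 8 (-6) .e0 .f0 _ _ := .of_kernel (smallCochains_low 6)
    (fun p => smallD_lowCochain_of_even p (by decide) (by decide))
    (smallCoboundaries_eq_bot (n := 7) (smallCochains_even_eq_bot 5 (by decide) (by decide)))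
  have hs : (-1 : K) ^ (-6 : ℤ) = 1 := Even.neg_one_zpow (by decide)
  simp only [hs, Prod.mk_eq_zero] at P
  exact P.nonempty_equiv_of_kernel 1 fun p => ⟨fun h => by linear_combination h.2, fun h =>
    ⟨by linear_combination -h, by linear_combination h⟩⟩

/-- The matrix from length 7 to length 8 in internal degree -5 has determinant 1, so nonzero
cochains give no cohomology at either end. -/
theorem subsingleton_HH_seven : Subsingleton (HH K 7 (-5)) := by
  have P : PairPresentation (K := K) 7 (-5) .e0 .f0 _ _ := .of_kernel (smallCochains_low 5)
    (fun p => smallD_lowCochain_of_odd p (by decide) (by decide))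
    (smallCoboundaries_eq_bot (n := 6) (smallCochains_odd_eq_bot 4 (by decide)))
  have hs : (-1 : K) ^ (-5 : ℤ) = -1 := Odd.neg_one_zpow (by decide)
  simp only [hs, Prod.mk_eq_zero] at P
  exact P.subsingleton fun p hp => Prod.ext (show p.1 = 0 by linear_combination -hp.2)
    (show p.2 = 0 by linear_combination hp.1)

theorem subsingleton_HH_eight : Subsingleton (HH K 8 (-5)) := by
  have P : PairPresentation (K := K) 8 (-5) .e1 .f1 _ _ := .of_cokernel (smallCochains_high 6)
    (fun p => smallD_highCochain p (by decide)) (smallCochains_low 5)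
    (fun p => smallD_lowCochain_of_odd p (by decide) (by decide))
  have hs : (-1 : K) ^ (-5 : ℤ) = -1 := Odd.neg_one_zpow (by decide)
  simp only [hs] at P
  refine P.subsingleton fun p _ => ⟨(-p.2, p.1), Prod.ext ?_ ?_⟩
  · dsimp only
    ring
  · dsimp only
    ring

theorem subsingleton_HH_of_smallCochains_eq_bot {n : ℕ} {s : ℤ}
    (h : smallCochains K (3 * n / 2) s = ⊥) : Subsingleton (HH K n s) :=
  subsingleton_HH <| by
    rw [smallCocycles, h, bot_inf_eq]
    exact bot_le

/-- Outside the listed positions the cochains themselves vanish, except at `(7,-5)` and `(8,-5)`,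
which are the two ends of an isomorphism. -/
theorem subsingleton_HH_of_notMem {r : ℕ} {s : ℤ} (hr : r ≤ 8)
    (hs : (r, s) ∉ ({(0, 1), (0, 0), (1, 0), (2, -1), (3, -1), (3, -2), (4, -2), (4, -3), (5, -3),
        (6, -4), (7, -4), (8, -6)} : Set (ℕ × ℤ))) : Subsingleton (HH K r s) := by
  simp only [Set.mem_insert_iff, Set.mem_singleton_iff, Prod.mk.injEq, not_or, not_and] at hs
  interval_cases r <;> simp at hs
  · exact subsingleton_HH_of_smallCochains_eq_bot
      (smallCochains_even_eq_bot 0 (by omega) (by omega))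
  · exact subsingleton_HH_of_smallCochains_eq_bot (smallCochains_odd_eq_bot 0 (by omega))
  · exact subsingleton_HH_of_smallCochains_eq_bot (smallCochains_odd_eq_bot 1 (by omega))
  · exact subsingleton_HH_of_smallCochains_eq_bot
      (smallCochains_even_eq_bot 2 (by omega) (by omega))
  · exact subsingleton_HH_of_smallCochains_eq_bot
      (smallCochains_even_eq_bot 3 (by omega) (by omega))
  · exact subsingleton_HH_of_smallCochains_eq_bot (smallCochains_odd_eq_bot 3 (by omega))
  · exact subsingleton_HH_of_smallCochains_eq_bot (smallCochains_odd_eq_bot 4 (by omega))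
  · by_cases h : s = -5
    · rw [h]
      exact subsingleton_HH_seven
    · exact subsingleton_HH_of_smallCochains_eq_bot
        (smallCochains_even_eq_bot 5 (by omega) (by omega))
  · by_cases h : s = -5
    · rw [h]
      exact subsingleton_HH_eight
    · exact subsingleton_HH_of_smallCochains_eq_bot
        (smallCochains_even_eq_bot 6 (by omega) (by omega))

end Entries

end TwoCycle

/-- `HH K r s` is `HH^{r+s}(A,A)^s`, so that `HH^{r+s+2}(A,A)^{s-6}` is `HH K (r + 8) (s - 6)` and
`HH^{r+s+1}(A,A)^{s-3}` is `HH K (r + 4) (s - 3)`. -/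
theorem theorem5p1 (K : Type u) [Field K] :
    -- Hochschild cohomology is the graded `Ext` of bimodules
    (Nonempty (TwoCycle.ProjectiveResolution K) ∧
      ∀ (P : TwoCycle.ProjectiveResolution K) (r : ℕ) (s : ℤ),
        Nonempty (TwoCycle.HH K r s ≃ₗ[K]
          P.Ext ((TwoCycle.GradedBimodule.regular K).shift s) r)) ∧
    -- periodicity
    (∀ (r : ℕ) (s : ℤ), 0 < r →
      Nonempty (TwoCycle.HH K (r + 8) (s - 6) ≃ₗ[K] TwoCycle.HH K r s)) ∧
    (CharP K 2 → ∀ (r : ℕ) (s : ℤ), 0 < r →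
      Nonempty (TwoCycle.HH K (r + 4) (s - 3) ≃ₗ[K] TwoCycle.HH K r s)) ∧
    -- the non-zero entries of the table for `0 ≤ r ≤ 8`
    Nonempty (TwoCycle.HH K 0 1 ≃ₗ[K] K × K) ∧
    Nonempty (TwoCycle.HH K 0 0 ≃ₗ[K] K) ∧
    Nonempty (TwoCycle.HH K 1 0 ≃ₗ[K] K) ∧
    Nonempty (TwoCycle.HH K 2 (-1) ≃ₗ[K] K ⧸ Ideal.span {(2 : K)}) ∧
    Nonempty (TwoCycle.HH K 3 (-1) ≃ₗ[K] K ⧸ Ideal.span {(2 : K)}) ∧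
    Nonempty (TwoCycle.HH K 3 (-2) ≃ₗ[K] K ⧸ Ideal.span {(3 : K)}) ∧
    Nonempty (TwoCycle.HH K 4 (-2) ≃ₗ[K] K ⧸ Ideal.span {(3 : K)}) ∧
    Nonempty (TwoCycle.HH K 4 (-3) ≃ₗ[K] K ⧸ Ideal.span {(2 : K)}) ∧
    Nonempty (TwoCycle.HH K 5 (-3) ≃ₗ[K] K ⧸ Ideal.span {(2 : K)}) ∧
    Nonempty (TwoCycle.HH K 6 (-4) ≃ₗ[K] K) ∧
    Nonempty (TwoCycle.HH K 7 (-4) ≃ₗ[K] K) ∧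
    Nonempty (TwoCycle.HH K 8 (-6) ≃ₗ[K] K) ∧
    -- all other entries of the table vanish
    (∀ (r : ℕ) (s : ℤ), r ≤ 8 →
      (r, s) ∉ ({(0, 1), (0, 0), (1, 0), (2, -1), (3, -1), (3, -2), (4, -2), (4, -3), (5, -3),
        (6, -4), (7, -4), (8, -6)} : Set (ℕ × ℤ)) →
      Subsingleton (TwoCycle.HH K r s)) := by
  refine ⟨⟨⟨TwoCycle.barResolution K⟩, fun P r s => TwoCycle.nonempty_HH_equiv_ext P r s⟩,
    fun r s hr => ?_, fun _ r s hr => ?_, TwoCycle.nonempty_HH_zero_one,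
    TwoCycle.nonempty_HH_zero_zero, TwoCycle.nonempty_HH_one_zero, TwoCycle.nonempty_HH_two,
    TwoCycle.nonempty_HH_three_neg_one, TwoCycle.nonempty_HH_three_neg_two,
    TwoCycle.nonempty_HH_four_neg_two, TwoCycle.nonempty_HH_four_neg_three,
    TwoCycle.nonempty_HH_five, TwoCycle.nonempty_HH_six, TwoCycle.nonempty_HH_seven,
    TwoCycle.nonempty_HH_eight, fun r s => TwoCycle.subsingleton_HH_of_notMem⟩
  -- Eight steps lengthen the paths by 12, so `t = 6` is even and the sign is unchanged; four steps
  -- have the odd `t = 3`, where characteristic 2 is used.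
  · exact TwoCycle.nonempty_HH_periodic (m := 8) (t := 6) rfl s (TwoCycle.twist_sub_six s) hr
  · exact TwoCycle.nonempty_HH_periodic (m := 4) (t := 3) rfl s
      (TwoCycle.twist_of_charP_two _ _) hr
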